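/- **Setting.** For every $\delta>0$ let $\Gamma^{\#\delta}$ be an infinite connected oriented planar graph, properly embedded in $\mathbb C$ (edges are simple arcs which meet only at vertices, except that the two orientations of an edge may be drawn as the same arc; every compact set meets finitely many vertices and edges), with a weight $w(u,v)>0$ on each oriented edge $(u,v)$. Assume that each vertex has an outgoing edge and that there are no edges from a vertex to itself. The random walk jumps from $u$ to $v$ with probability $q(u,v)=w(u,v)/\sum_{v'}w(u,v')$; only its trajectory matters, which is also regarded as a continuous curve that follows the edges. Fix an integer $C$ and reals $\delta_0,\alpha_0>0$ and assume: * (Bounded density) for every $\delta>0$, every ball of radius $\delta$ contains fewer than $C$ vertices of $\Gamma^{\#\delta}$. * (Uniform crossing estimate) Let $R=[0,3]\times[0,1]$, $B_1=B((\tfrac12,\tfrac12),\tfrac14)$, $B_2=B((\tfrac52,\tfrac12),\tfrac14)$. For all $0<\delta<\delta_0$, $z\in\mathbb C$, $l\ge 1/\delta_0$ and every vertex $v$ of $\Gamma^{\#\delta}$ in $l\delta B_1+z$, the random walk started from $v$ visits a vertex in $l\delta B_2+z$ before its trajectory exits $l\delta R+z$, with probability larger than $\alpha_0$. The same holds with $B_1$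 and $B_2$ exchanged, and for the crossings, in both directions, of $R'=[0,1]\times[0,3]$ between $B((\tfrac12,\tfrac12),\tfrac14)$ and $B((\tfrac12,\tfrac52),\tfrac14)$. Let $D\subset\mathbb C$ be a bounded simply connected domain. Walks are killed when their trajectory first meets $\partial D$. *Good Ordering.* For $j=0,1,2,\dots$ let $Q_j$ be the set of vertices obtained by picking, in each (half-open) cell of $6^{-j}\mathbb Z^2$, among the vertices of $\Gamma^{\#\delta}$ in $D$ which are not in $Q_0\cup\dots\cup Q_{j-1}$, the one closest to the centre of the cell (ties are broken by the lexicographic order; nothing is picked if there is none). Order each $Q_j$ by the lexicographic order of the cells, and order all vertices in $D$ as $(Q_0,Q_1,\dots)$. *Wilson's algorithm.* Starting from the empty set, repeatedly take the first vertex in the ordering that is not yet sampled, run an independent random walk from it until it is killed on $\partial D$ or visits an already sampled vertex, and add its chronological loop erasure, called a branch, to the sampled set, until all vertices in $D$ are sampled. *Loop soups.* The random walk loop soup $\mathcal L^{\#\delta}$ in $D$ is the Poisson point process of unrooted loops following edges that stay in $D$, whose intensity gives to an unrooted loop the mass $\sum \frac1p\prod_{i=0}^{p-1}q(v_i,v_{i+1})$,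 the sum being over the distinct rooted loops $(v_0,\dots,v_p)$, $v_p=v_0$, that represent it. Take it independent of Wilson's algorithm, and let $\mathcal L^{\#\delta}_j$ consist of the loops of $\mathcal L^{\#\delta}$ that visit a vertex of one of the first $j$ branches (of all branches if there are fewer than $j$). These are random elements of the space $\mathcal M(D)$, the quotient of the space $M(D)$ of sequences of unrooted loops in $D$ with finitely many loops of diameter at least $\eta$ for every $\eta>0$, by the vanishing of the pseudometric $$d\big((X_i),(Y_j)\big)=\inf_{I,\lambda}\ \sup\Big\{d(X_i,Y_{\lambda(i)}),\,i\in I;\ \tfrac12\operatorname{diam}X_i,\, i\notin I;\ \tfrac12\operatorname{diam}Y_j,\, j\notin\lambda(I)\Big\},$$ with the infimum over finite $I\subset\mathbb N$ and injective $\lambda:I\to\mathbb N$, where the distance between two loops is the infimum of their uniform distance over changes of root and increasing changes of parametrization; a finite multiset of loops is completed by constant loops. Let $d_{LP}$ be the Lévy–Prokhorov distance between laws on $\mathcal M(D)$. **Theorem (Schramm's finiteness theorem).** For every $\varepsilon>0$ there is an integer $j_0=j_0(\varepsilon)$, depending only on $\varepsilon$ (and on $D$, $C$, $\delta_0$, $\alpha_0$),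 such that for every $0<\delta<6^{-j_0}\delta_0$, when Wilson's algorithm is run in $D$ with the Good Ordering: 1. with probability at least $1-\varepsilon$, all the random walks that are run after the first $j_0$ branches have been sampled have trajectories of diameter at most $\varepsilon$; 2. for every $j>j_0$, $d_{LP}(\mathcal L^{\#\delta},\mathcal L^{\#\delta}_j)\le\varepsilon$. -/

import Mathlib

open MeasureTheory ProbabilityTheory Set
open scoped ENNReal NNReal unitInterval

noncomputable section

/-! ### Weighted oriented plane graphs and their random walk -/

/-- An infinite, connected, oriented planar graph with weighted edges, properly embedded in the
plane.  There is an oriented edge from `u` to `v` exactly when `weight u v ≠ 0`; it is drawn as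
the simple arc `edge u v` (the value of `edge u v` is irrelevant when there is no such edge).
Distinct edges meet only at vertices, except that the two orientations `(u, v)` and `(v, u)` may
be drawn as the same arc. -/
structure PlaneGraph where
  verts : Set ℂ
  weight : verts → verts → ℝ≥0
  edge : ∀ u v : verts, Path (u : ℂ) (v : ℂ)
  weight_self : ∀ u, weight u u = 0
  exists_out : ∀ u, ∃ v, weight u v ≠ 0
  edge_injective : ∀ u v, weight u v ≠ 0 → Function.Injective (edge u v)
  edge_interior : ∀ u v, weight u v ≠ 0 → ∀ t : I, 0 < t → t < 1 → edge u v t ∉ verts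
  noncrossing : ∀ u v u' v', weight u v ≠ 0 → weight u' v' ≠ 0 →
    ∀ s t : I, 0 < s → s < 1 → 0 < t → t < 1 → edge u v s = edge u' v' t →
      range (edge u v) = range (edge u' v')
  proper : ∀ K : Set ℂ, IsCompact K → (verts ∩ K).Finite ∧
    {e : verts × verts | weight e.1 e.2 ≠ 0 ∧ (range (edge e.1 e.2) ∩ K).Nonempty}.Finite
  infinite : verts.Infinite
  connected : (SimpleGraph.fromRel fun u v : verts => weight u v ≠ 0).Connected

namespace PlaneGraph

variable (Γ : PlaneGraph)

instance : Countable Γ.verts := by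
  have h : Γ.verts = ⋃ n : ℕ, Γ.verts ∩ Metric.closedBall (0 : ℂ) n := by
    rw [← inter_iUnion, Metric.iUnion_closedBall_nat, inter_univ]
  have h2 : Γ.verts.Countable := by
    rw [h]
    exact countable_iUnion fun n =>
      (Γ.proper _ (isCompact_closedBall (0 : ℂ) n)).1.countable
  exact h2.to_subtype

theorem finite_out (u : Γ.verts) : {v : Γ.verts | Γ.weight u v ≠ 0}.Finite := by
  have h := (Γ.proper {(u : ℂ)} isCompact_singleton).2
  refine (h.image Prod.snd).subset fun v hv => ⟨(u, v), ⟨hv, ?_⟩, rfl⟩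
  exact ⟨u, ⟨0, (Γ.edge u v).source⟩, rfl⟩

/-- The total jump rate at `u`. -/
def rate (u : Γ.verts) : ℝ≥0∞ := ∑' v, (Γ.weight u v : ℝ≥0∞)

theorem rate_ne_zero (u : Γ.verts) : Γ.rate u ≠ 0 := by
  obtain ⟨v, hv⟩ := Γ.exists_out u
  intro h
  exact hv (by simpa using ENNReal.tsum_eq_zero.1 h v)

theorem rate_ne_top (u : Γ.verts) : Γ.rate u ≠ ∞ := by
  have h : Γ.rate u = ∑ v ∈ (Γ.finite_out u).toFinset, (Γ.weight u v : ℝ≥0∞) := by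
    refine tsum_eq_sum fun v hv => ?_
    simpa using hv
  rw [h]
  exact ENNReal.sum_ne_top.2 fun v _ => ENNReal.coe_ne_top

/-- The jump distribution at `u`: the probability of `v` is `q u v = weight u v / rate u`. -/
def jump (u : Γ.verts) : PMF Γ.verts :=
  PMF.normalize (fun v => (Γ.weight u v : ℝ≥0∞)) (Γ.rate_ne_zero u) (Γ.rate_ne_top u)

/-- The transition probability `q(u, v)`. -/
def q (u v : Γ.verts) : ℝ≥0 := (Γ.jump u v).toNNReal

/-- The one-step transition kernel of the random walk. -/
def stepKernel : Kernel Γ.verts Γ.verts where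
  toFun u := (Γ.jump u).toMeasure
  measurable' := .of_discrete

instance : IsMarkovKernel Γ.stepKernel :=
  ⟨fun u => inferInstanceAs (IsProbabilityMeasure (Γ.jump u).toMeasure)⟩

/-- The law, on sequences of vertices, of (the successive positions of) the random walk started
from `v`. -/
def walkLaw (v : Γ.verts) : Measure (ℕ → Γ.verts) :=
  Kernel.trajMeasure (X := fun _ => Γ.verts) (Measure.dirac v) fun n =>
    Γ.stepKernel.comap (fun x : ((i : Finset.Iic n) → Γ.verts) => x ⟨n, by simp⟩)
      (measurable_pi_apply _)

instance (v : Γ.verts) : IsProbabilityMeasure (Γ.walkLaw v) := by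
  unfold walkLaw; infer_instance

/-! ### Bounded density and the uniform crossing estimate -/

/-- Every ball of radius `δ` contains fewer than `C` vertices. -/
def BoundedDensity (δ : ℝ) (C : ℕ) : Prop :=
  ∀ z : ℂ, (Γ.verts ∩ Metric.ball z δ).encard < C

/-- The walk `x` visits the set `B` before its trajectory (a curve following the edges) leaves
`R`. -/
def HitsBeforeExit (x : ℕ → Γ.verts) (B R : Set ℂ) : Prop :=
  ∃ n, (x n : ℂ) ∈ B ∧ (∀ i ≤ n, (x i : ℂ) ∈ R) ∧
    ∀ i < n, range (Γ.edge (x i) (x (i + 1))) ⊆ R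

/-- The set `r S + z`. -/
def place (r : ℝ) (z : ℂ) (S : Set ℂ) : Set ℂ := (fun s => (r : ℂ) * s + z) '' S

/-- From every vertex in a copy of `S` of scale `l δ`, `l ≥ 1 / δ₀`, the walk visits the
corresponding copy of `B` before exiting that of `R`, with probability larger than `α₀`. -/
def CrossingFrom (δ δ₀ α₀ : ℝ) (S B R : Set ℂ) : Prop :=
  ∀ (z : ℂ) (l : ℝ), 1 / δ₀ ≤ l → ∀ v : Γ.verts, (v : ℂ) ∈ place (l * δ) z S →
    ENNReal.ofReal α₀ <
      Γ.walkLaw v {x | Γ.HitsBeforeExit x (place (l * δ) z B) (place (l * δ) z R)}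

/-- The uniform crossing estimate at mesh size `δ`: crossings in the long direction, both ways,
of the horizontal rectangle `[0,3] × [0,1]` and of the vertical rectangle `[0,1] × [0,3]`. -/
def UniformCrossing (δ δ₀ α₀ : ℝ) : Prop :=
  let R : Set ℂ := Icc 0 3 ×ℂ Icc 0 1
  let R' : Set ℂ := Icc 0 1 ×ℂ Icc 0 3
  let B₁ : Set ℂ := Metric.ball ⟨1 / 2, 1 / 2⟩ (1 / 4)
  let B₂ : Set ℂ := Metric.ball ⟨5 / 2, 1 / 2⟩ (1 / 4)
  let B₂' : Set ℂ := Metric.ball ⟨1 / 2, 5 / 2⟩ (1 / 4)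
  Γ.CrossingFrom δ δ₀ α₀ B₁ B₂ R ∧ Γ.CrossingFrom δ δ₀ α₀ B₂ B₁ R ∧
    Γ.CrossingFrom δ δ₀ α₀ B₁ B₂' R' ∧ Γ.CrossingFrom δ δ₀ α₀ B₂' B₁ R'

/-! ### The Good Ordering -/

/-- The cell of `6⁻ʲ ℤ²` (as a half-open square, labelled by integers) that contains `z`. -/
def cell (j : ℕ) (z : ℂ) : ℤ × ℤ := (⌊6 ^ j * z.re⌋, ⌊6 ^ j * z.im⌋)

/-- The centre of a cell of `6⁻ʲ ℤ²`. -/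
def cellCenter (j : ℕ) (c : ℤ × ℤ) : ℂ := ⟨(c.1 + 1 / 2) / 6 ^ j, (c.2 + 1 / 2) / 6 ^ j⟩

/-- The vertices picked at step `j` when the available vertices are those of `S`: in each cell the
one closest to the centre, ties being broken by the lexicographic order. -/
def pick (j : ℕ) (S : Set Γ.verts) : Set Γ.verts :=
  {v ∈ S | ∀ w ∈ S, cell j w = cell j v →
    toLex (dist (v : ℂ) (cellCenter j (cell j v)), toLex ((v : ℂ).re, (v : ℂ).im)) ≤
      toLex (dist (w : ℂ) (cellCenter j (cell j v)), toLex ((w : ℂ).re, (w : ℂ).im))}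

/-- The vertices in `D` that are not chosen in the steps before step `j`. -/
def unchosen (D : Set ℂ) : ℕ → Set Γ.verts
  | 0 => {v | (v : ℂ) ∈ D}
  | j + 1 => unchosen D j \ Γ.pick j (unchosen D j)

/-- The set `Q_j` of vertices picked at step `j`. -/
def Q (D : Set ℂ) (j : ℕ) : Set Γ.verts := Γ.pick j (Γ.unchosen D j)

/-- `v` comes before `w`: it is picked at an earlier step, or at the same step in a cell that is
smaller in the lexicographic order. -/
def Precedes (D : Set ℂ) (v w : Γ.verts) : Prop :=
  ∃ i j, v ∈ Γ.Q D i ∧ w ∈ Γ.Q D j ∧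
    (i < j ∨ i = j ∧ toLex (cell i (v : ℂ)) < toLex (cell i (w : ℂ)))

/-- `ord` lists all the vertices in `D`, in the Good Ordering `(Q_0, Q_1, …)`. -/
def IsGoodOrdering (D : Set ℂ) (ord : List Γ.verts) : Prop :=
  (∀ v, v ∈ ord ↔ (v : ℂ) ∈ D) ∧ ord.Pairwise (Γ.Precedes D)

/-! ### Wilson's algorithm in a domain -/

/-- There is an edge from `u` to `v`, and it stays in `D`. -/
def StepIn (D : Set ℂ) (u v : Γ.verts) : Prop :=
  Γ.weight u v ≠ 0 ∧ range (Γ.edge u v) ⊆ D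

/-- The walk `x` is neither killed on the boundary of `D` nor stopped in `T` before or at step
`n`, so that it attempts its jump number `n + 1`. -/
def Alive (D : Set ℂ) (T : Set Γ.verts) (x : ℕ → Γ.verts) (n : ℕ) : Prop :=
  (∀ i ≤ n, x i ∉ T) ∧ ∀ i < n, Γ.StepIn D (x i) (x (i + 1))

/-- The part of the edge from `u` to `v` up to its first crossing point with the boundary of `D`
(the crossing point included; this is the whole edge if it stays in `D`). -/
def truncatedEdge (D : Set ℂ) (u v : Γ.verts) : Set ℂ :=
  {z | ∃ t : I, z = Γ.edge u v t ∧ ∀ s < t, Γ.edge u v s ∈ D}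

/-- The trajectory, as a subset of the plane, of the walk `x` followed along the edges until it
reaches the boundary of `D` or visits a vertex of `T`. -/
def trace (D : Set ℂ) (T : Set Γ.verts) (x : ℕ → Γ.verts) : Set ℂ :=
  ⋃ (n : ℕ) (_ : Γ.Alive D T x n), Γ.truncatedEdge D (x n) (x (n + 1))

/-- The index of the last vertex visited by the walk before its killing on the boundary of `D`, or
of the first visited vertex in `T`, whichever comes first. -/
def stopIndex (D : Set ℂ) (T : Set Γ.verts) (x : ℕ → Γ.verts) : ℕ :=
  sInf {n | x n ∈ T ∨ ¬ Γ.StepIn D (x n) (x (n + 1))}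

open scoped Classical in
/-- The part of a list after the last occurrence of `v` (the whole list if there is none). -/
def afterLast {V : Type*} (v : V) (l : List V) : List V := l.rtakeWhile fun w => decide (w ≠ v)

theorem length_afterLast_le {V : Type*} (v : V) (l : List V) :
    (afterLast v l).length ≤ l.length := (List.rtakeWhile_suffix _ l).length_le

/-- Chronological loop erasure of a finite path: keep the first vertex, jump to its last visit,
go on from the next vertex. -/
def loopErase {V : Type*} : List V → List V
  | [] => []
  | v :: l => v :: loopErase (afterLast v l)
termination_by l => l.length
decreasing_by exact Nat.lt_succ_of_le (length_afterLast_le v l)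

/-- The vertices of the branch generated by the walk `x`: the loop erasure of `x` run until it
leaves `D` or hits `T`. -/
def branch (D : Set ℂ) (T : Set Γ.verts) (x : ℕ → Γ.verts) : List Γ.verts :=
  loopErase ((List.range (Γ.stopIndex D T x + 1)).map x)

open scoped Classical in
/-- Wilson's algorithm in `D`, with wired boundary, when the set `T` is already sampled, the
vertices that remain to be examined are those of the list, and the walk from `v` (if one is run)
is `X v`.  The output lists, for each branch in the order of sampling, its starting vertex
and the set of vertices sampled before. -/
def wilson (D : Set ℂ) (X : Γ.verts → ℕ → Γ.verts) :
    Set Γ.verts → List Γ.verts → List (Γ.verts × Set Γ.verts)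
  | _, [] => []
  | T, v :: l =>
    if v ∈ T then wilson D X T l
    else (v, T) :: wilson D X (T ∪ {u | u ∈ Γ.branch D T (X v)}) l

/-- The vertices of the first `j` branches of Wilson's algorithm for the ordering `ord`. -/
def firstBranches (D : Set ℂ) (ord : List Γ.verts) (X : Γ.verts → ℕ → Γ.verts) (j : ℕ) :
    Set Γ.verts :=
  {u | ∃ b ∈ (Γ.wilson D X ∅ ord).take j, u ∈ Γ.branch D b.2 (X b.1)}

/-- All the random walks run by Wilson's algorithm after its first `j` branches have trajectories
of diameter at most `ε`. -/
def LaterWalksSmall (D : Set ℂ) (ord : List Γ.verts) (X : Γ.verts → ℕ → Γ.verts) (j : ℕ)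
    (ε : ℝ) : Prop :=
  ∀ b ∈ (Γ.wilson D X ∅ ord).drop j,
    Metric.ediam (Γ.trace D b.2 (X b.1)) ≤ ENNReal.ofReal ε

/-- The law of the randomness of Wilson's algorithm: independent random walks, one from each
vertex (the algorithm runs at most one walk from each vertex). -/
def wilsonLaw : Measure (Γ.verts → ℕ → Γ.verts) := Measure.infinitePi fun v => Γ.walkLaw v

end PlaneGraph

/-! ### The space of loop soups -/

/-- Continuous loops in `D`. -/
def LoopIn (D : Set ℂ) : Type := {γ : C(UnitAddCircle, ℂ) // ∀ t, γ t ∈ D}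

namespace LoopIn

variable {D : Set ℂ}

/-- The diameter of the range of a loop. -/
def diam (γ : LoopIn D) : ℝ≥0∞ := Metric.ediam (range γ.1)

/-- The distance between unrooted, unparametrized loops: the infimum of the uniform distance over
changes of root and of (orientation preserving) parametrization.  Together these are the
homeomorphisms of the circle that lift to increasing bijections `h` of `ℝ` with
`h (t + 1) = h t + 1`. -/
instance : EDist (LoopIn D) :=
  ⟨fun γ η => ⨅ h : CircleDeg1Liftˣ, ⨆ t : ℝ, edist (γ.1 (t : UnitAddCircle)) (η.1 (h t : ℝ))⟩

theorem edist_def (γ η : LoopIn D) : edist γ η =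
    ⨅ h : CircleDeg1Liftˣ, ⨆ t : ℝ, edist (γ.1 (t : UnitAddCircle)) (η.1 (h t : ℝ)) := rfl

theorem edist_comm_le (γ η : LoopIn D) : edist γ η ≤ edist η γ := by
  rw [edist_def η γ]
  refine le_iInf fun h => ?_
  rw [edist_def]
  refine (iInf_le _ h⁻¹).trans (iSup_le fun t => ?_)
  refine le_trans (le_of_eq ?_) (le_iSup _ ((h⁻¹ : CircleDeg1Liftˣ) t))
  rw [CircleDeg1Lift.units_apply_inv_apply, edist_comm]

instance : PseudoEMetricSpace (LoopIn D) where
  edist_self γ := by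
    refine le_antisymm ?_ zero_le
    rw [edist_def]
    exact (iInf_le _ 1).trans (iSup_le fun t => by simp)
  edist_comm γ η := le_antisymm (edist_comm_le γ η) (edist_comm_le η γ)
  edist_triangle γ η ζ := by
    rw [edist_def γ η, edist_def η ζ]
    refine ENNReal.le_iInf_add_iInf fun h k => ?_
    rw [edist_def]
    refine (iInf_le _ (k * h)).trans (iSup_le fun t => ?_)
    refine (edist_triangle _ (η.1 (h t : ℝ)) _).trans (add_le_add ?_ ?_)
    · exact le_iSup (fun t : ℝ => edist (γ.1 (t : UnitAddCircle)) (η.1 (h t : ℝ))) t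
    · exact le_iSup (fun t : ℝ => edist (η.1 (t : UnitAddCircle)) (ζ.1 (k t : ℝ))) (h t)

theorem diam_le (γ η : LoopIn D) : γ.diam ≤ η.diam + 2 * edist γ η := by
  rw [edist_def, ENNReal.mul_iInf_of_ne (by simp) (by simp), ENNReal.add_iInf]
  refine le_iInf fun h => ?_
  have key : ∀ x : UnitAddCircle, ∃ y : UnitAddCircle, edist (γ.1 x) (η.1 y) ≤
      ⨆ t : ℝ, edist (γ.1 (t : UnitAddCircle)) (η.1 (h t : ℝ)) := by
    intro x
    obtain ⟨t, rfl⟩ := QuotientAddGroup.mk_surjective x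
    exact ⟨(h t : ℝ), le_iSup (fun t : ℝ => edist (γ.1 (t : UnitAddCircle)) (η.1 (h t : ℝ))) t⟩
  refine Metric.ediam_le ?_
  rintro _ ⟨x, rfl⟩ _ ⟨x', rfl⟩
  obtain ⟨y, hy⟩ := key x
  obtain ⟨y', hy'⟩ := key x'
  have h1 : edist (η.1 y) (η.1 y') ≤ η.diam :=
    Metric.edist_le_ediam_of_mem (mem_range_self y) (mem_range_self y')
  have h2 := edist_triangle4 (γ.1 x) (η.1 y) (η.1 y') (γ.1 x')
  rw [edist_comm (η.1 y')] at h2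
  refine h2.trans ((add_le_add (add_le_add hy h1) hy').trans (le_of_eq ?_))
  rw [two_mul]; ring

/-- The constant loop. -/
def const (z : D) : LoopIn D := ⟨ContinuousMap.const _ z, fun _ => z.2⟩

theorem diam_const (z : D) : (const z).diam = 0 :=
  Metric.ediam_subsingleton (by rintro _ ⟨x, rfl⟩ _ ⟨y, rfl⟩; rfl)

end LoopIn

/-- The set `M(D)`: sequences of loops in `D` with finitely many loops of diameter at least `ε`,
for every `ε > 0`. -/
def LoopSeq (D : Set ℂ) : Type :=
  {X : ℕ → LoopIn D // ∀ ε : ℝ, 0 < ε → {n | ENNReal.ofReal ε ≤ (X n).diam}.Finite}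

namespace LoopSeq

variable {D : Set ℂ}

/-- The cost of the matching of `X i` with `Y (m i)`, for `i ∈ J`. -/
def cost (X Y : LoopSeq D) (J : Finset ℕ) (m : ℕ → ℕ) : ℝ≥0∞ :=
  (⨆ i ∈ J, edist (X.1 i) (Y.1 (m i))) ⊔ (⨆ i ∉ J, (X.1 i).diam / 2) ⊔
    (⨆ j ∉ J.image m, (Y.1 j).diam / 2)

/-- The pseudometric of `M(D)`: the infimum of the costs of the finite partial matchings. -/
instance : EDist (LoopSeq D) :=
  ⟨fun X Y => ⨅ (J : Finset ℕ) (m : ℕ → ℕ) (_ : InjOn m J), cost X Y J m⟩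

theorem edist_def (X Y : LoopSeq D) :
    edist X Y = ⨅ (J : Finset ℕ) (m : ℕ → ℕ) (_ : InjOn m J), cost X Y J m := rfl

theorem edist_le_cost (X Y : LoopSeq D) {J : Finset ℕ} {m : ℕ → ℕ} (hm : InjOn m J) :
    edist X Y ≤ cost X Y J m :=
  (iInf_le _ J).trans ((iInf_le _ m).trans (iInf_le _ hm))

theorem cost_le_iff (X Y : LoopSeq D) (J : Finset ℕ) (m : ℕ → ℕ) (c : ℝ≥0∞) :
    cost X Y J m ≤ c ↔ (∀ i ∈ J, edist (X.1 i) (Y.1 (m i)) ≤ c) ∧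
      (∀ i ∉ J, (X.1 i).diam / 2 ≤ c) ∧ (∀ j ∉ J.image m, (Y.1 j).diam / 2 ≤ c) := by
  simp only [cost, sup_le_iff, iSup_le_iff, and_assoc]

theorem edist_comm_le (X Y : LoopSeq D) : edist X Y ≤ edist Y X := by
  rw [edist_def Y X]
  refine le_iInf fun J => le_iInf fun m => le_iInf fun hm => ?_
  obtain ⟨h1, h2, h3⟩ := (cost_le_iff Y X J m _).1 le_rfl
  have hinv : ∀ i ∈ J, Function.invFunOn m J (m i) = i := fun i hi => hm.leftInvOn_invFunOn hi
  have himg : (J.image m).image (Function.invFunOn m J) = J := by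
    ext i
    simp only [Finset.mem_image, exists_exists_and_eq_and]
    exact ⟨fun ⟨a, ha, h⟩ => by rw [hinv a ha] at h; exact h ▸ ha, fun hi => ⟨i, hi, hinv i hi⟩⟩
  have hinj : InjOn (Function.invFunOn m J) (J.image m) := by
    intro a ha b hb hab
    simp only [Finset.coe_image, mem_image, Finset.mem_coe] at ha hb
    obtain ⟨a, ha, rfl⟩ := ha
    obtain ⟨b, hb, rfl⟩ := hb
    rw [hinv a ha, hinv b hb] at hab
    rw [hab]
  refine (edist_le_cost X Y hinj).trans ((cost_le_iff _ _ _ _ _).2 ⟨?_, h3, ?_⟩)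
  · intro i hi
    obtain ⟨a, ha, rfl⟩ := Finset.mem_image.1 hi
    rw [hinv a ha, edist_comm]
    exact h1 a ha
  · rw [himg]
    exact h2

theorem half_diam_le {γ η : LoopIn D} {a b : ℝ≥0∞} (h : edist γ η ≤ a) (h' : η.diam / 2 ≤ b) :
    γ.diam / 2 ≤ a + b := by
  have h2 : η.diam ≤ b * 2 := (ENNReal.div_le_iff (by simp) (by simp)).1 h'
  rw [ENNReal.div_le_iff (by simp) (by simp)]
  refine (LoopIn.diam_le γ η).trans ((add_le_add h2 (mul_le_mul_right h 2)).trans (le_of_eq ?_))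
  ring

instance : PseudoEMetricSpace (LoopSeq D) where
  edist_self X := by
    refine le_antisymm (ENNReal.le_of_forall_pos_le_add fun ε hε _ => ?_) zero_le
    have hf := X.2 ε (by exact_mod_cast hε)
    rw [zero_add]
    refine (edist_le_cost X X (J := hf.toFinset) (m := id) (injOn_id _)).trans
      ((cost_le_iff _ _ _ _ _).2 ⟨?_, ?_, ?_⟩)
    · intro i _
      simp
    all_goals
      intro i hi
      simp only [Finset.image_id, Finite.mem_toFinset, mem_ofPred_eq, not_le,
        ENNReal.ofReal_coe_nnreal] at hi
      exact ENNReal.half_le_self.trans hi.le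
  edist_comm X Y := le_antisymm (edist_comm_le X Y) (edist_comm_le Y X)
  edist_triangle X Y Z := by
    classical
    rw [edist_def X Y, edist_def Y Z]
    refine ENNReal.le_iInf_add_iInf fun J K => ENNReal.le_iInf_add_iInf fun m k =>
      ENNReal.le_iInf_add_iInf fun hm hk => ?_
    obtain ⟨h1, h2, h3⟩ := (cost_le_iff X Y J m _).1 le_rfl
    obtain ⟨k1, k2, k3⟩ := (cost_le_iff Y Z K k _).1 le_rfl
    have hinj : InjOn (k ∘ m) (J.filter fun i => m i ∈ K) := by
      intro a ha b hb hab
      simp only [Finset.coe_filter, mem_ofPred_eq] at ha hb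
      exact hm ha.1 hb.1 (hk ha.2 hb.2 hab)
    refine (edist_le_cost X Z hinj).trans ((cost_le_iff _ _ _ _ _).2 ⟨?_, ?_, ?_⟩)
    · intro i hi
      obtain ⟨hi, hi'⟩ := Finset.mem_filter.1 hi
      exact (edist_triangle _ (Y.1 (m i)) _).trans (add_le_add (h1 i hi) (k1 _ hi'))
    · intro i hi
      by_cases hiJ : i ∈ J
      · exact half_diam_le (h1 i hiJ) (k2 (m i) fun h => hi (Finset.mem_filter.2 ⟨hiJ, h⟩))
      · exact (h2 i hiJ).trans le_self_add
    · intro j hj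
      by_cases hjK : j ∈ K.image k
      · obtain ⟨a, ha, rfl⟩ := Finset.mem_image.1 hjK
        have haJ : a ∉ J.image m := by
          intro h
          obtain ⟨i, hi, rfl⟩ := Finset.mem_image.1 h
          exact hj (Finset.mem_image.2 ⟨i, Finset.mem_filter.2 ⟨hi, ha⟩, rfl⟩)
        rw [add_comm]
        refine half_diam_le (η := Y.1 a) ?_ (h3 a haJ)
        rw [edist_comm]
        exact k1 a ha
      · exact (k3 j hjK).trans le_add_self

/-- The sequence that starts with the loops of a finite list and goes on with constant loops. -/
def ofList (z : D) (L : List (LoopIn D)) : LoopSeq D :=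
  ⟨fun n => L.getD n (LoopIn.const z), fun ε hε => by
    refine (finite_lt_nat L.length).subset fun n hn => ?_
    by_contra h
    simp only [mem_ofPred_eq, not_lt] at h
    simp only [mem_ofPred_eq, List.getD_eq_default _ _ h, LoopIn.diam_const,
      nonpos_iff_eq_zero, ENNReal.ofReal_eq_zero] at hn
    exact absurd hn (not_le.2 hε)⟩

end LoopSeq

/-- The space of loop soups in `D`: the quotient of `M(D)` by the vanishing of its pseudometric,
with its Borel sets. -/
def LoopSoup (D : Set ℂ) : Type := SeparationQuotient (LoopSeq D)

instance (D : Set ℂ) : EMetricSpace (LoopSoup D) :=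
  inferInstanceAs (EMetricSpace (SeparationQuotient (LoopSeq D)))

instance (D : Set ℂ) : MeasurableSpace (LoopSoup D) := borel _

instance (D : Set ℂ) : BorelSpace (LoopSoup D) := ⟨rfl⟩

/-- The loop soup made of a finite list of loops. -/
def LoopSoup.ofList {D : Set ℂ} (z : D) (L : List (LoopIn D)) : LoopSoup D :=
  SeparationQuotient.mk (LoopSeq.ofList z L)

/-! ### The random walk loop soup -/

/-- A closed path, viewed as a loop parametrized by the circle. -/
def loopOfPath {z : ℂ} (p : Path z z) : C(UnitAddCircle, ℂ) :=
  ⟨AddCircle.liftIco 1 0 p.extend,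
    AddCircle.liftIco_zero_continuous (by simp) p.continuous_extend.continuousOn⟩

theorem loopOfPath_mem_range {z : ℂ} (p : Path z z) (t : UnitAddCircle) :
    loopOfPath p t ∈ range p := by
  rw [← p.extend_range]
  exact mem_range_self _

namespace PlaneGraph

variable (Γ : PlaneGraph)

/-- The concatenation of the edges along the path with vertices `u`, those of the list, `v`. -/
def curve : (u : Γ.verts) → List Γ.verts → (v : Γ.verts) → Path (u : ℂ) (v : ℂ)
  | u, [], v => Γ.edge u v
  | u, x :: l, v => (Γ.edge u x).trans (curve x l v)

theorem range_curve_subset {D : Set ℂ} (u : Γ.verts) (l : List Γ.verts) (v : Γ.verts)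
    (h : List.IsChain (Γ.StepIn D) (u :: l ++ [v])) : range (Γ.curve u l v) ⊆ D := by
  induction l generalizing u with
  | nil =>
    simp only [List.cons_append, List.nil_append, List.isChain_cons_cons] at h
    exact h.1.2
  | cons x l ih =>
    simp only [List.cons_append, List.isChain_cons_cons] at h
    rw [curve, Path.trans_range]
    exact union_subset h.1.2 (ih x h.2)

/-- Unrooted discrete loops in `D`: closed paths of at least one step, along edges that stay in
`D`, up to the choice of the root.  The loop `(v₀, …, v_p)`, `v_p = v₀`, is represented by the
cyclic word `v₀ … v_{p-1}`. -/
def DiscreteLoop (D : Set ℂ) : Type :=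
  {c : Cycle Γ.verts // c ≠ Cycle.nil ∧ c.Chain (Γ.StepIn D)}

variable {Γ} {D : Set ℂ}

/-- A choice of a root of a discrete loop, as a word `v₀ … v_{p-1}`. -/
def DiscreteLoop.word (c : Γ.DiscreteLoop D) : List Γ.verts := Quotient.out c.1

theorem DiscreteLoop.coe_word (c : Γ.DiscreteLoop D) : (c.word : Cycle Γ.verts) = c.1 :=
  Quotient.out_eq _

theorem DiscreteLoop.word_ne_nil (c : Γ.DiscreteLoop D) : c.word ≠ [] := by
  intro h
  exact c.2.1 (by rw [← c.coe_word, h]; rfl)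

theorem isChain_of_cycleChain {r : Γ.verts → Γ.verts → Prop} (w : List Γ.verts) (hw : w ≠ [])
    (h : (w : Cycle Γ.verts).Chain r) : List.IsChain r (w.head hw :: w.tail ++ [w.head hw]) := by
  cases w with
  | nil => exact absurd rfl hw
  | cons a l => simpa using h

theorem DiscreteLoop.isChain_word (c : Γ.DiscreteLoop D) :
    List.IsChain (Γ.StepIn D)
      (c.word.head c.word_ne_nil :: c.word.tail ++ [c.word.head c.word_ne_nil]) :=
  isChain_of_cycleChain c.word c.word_ne_nil (by rw [c.coe_word]; exact c.2.2)

/-- The continuous loop that follows the edges of a discrete loop. -/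
def DiscreteLoop.toLoop (c : Γ.DiscreteLoop D) : LoopIn D :=
  ⟨loopOfPath (Γ.curve (c.word.head c.word_ne_nil) c.word.tail (c.word.head c.word_ne_nil)),
    fun t => Γ.range_curve_subset _ _ _ c.isChain_word (loopOfPath_mem_range _ t)⟩

variable (Γ) (D)

/-- The rooted loop measure of `(v₀, …, v_p)`, `v_p = v₀`, written `[v₀, …, v_{p-1}]`:
the product of the transition probabilities divided by `p`. -/
def rootedMass (l : List Γ.verts) : ℝ≥0 :=
  (List.zipWith Γ.q l (l.rotate 1)).prod / l.length

open scoped Classical in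
/-- The random walk loop measure of an unrooted loop: the sum over the distinct rooted loops in
the class. -/
def loopMass (c : Cycle Γ.verts) : ℝ≥0 := ∑ l ∈ c.lists.toFinset, Γ.rootedMass l

/-- The law of the multiplicities of the discrete loops in the random walk loop soup in `D`.  The
random walk loop measure is carried by a countable set, so that a Poisson point process with this
intensity consists of independent Poisson multiplicities. -/
def countLaw : Measure (Γ.DiscreteLoop D → ℕ) :=
  Measure.infinitePi fun c => poissonMeasure (Γ.loopMass c.1)

variable {Γ} {D}

open scoped Classical in
/-- The loop soup with the given multiplicities, which are almost surely finitely supported. -/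
def soup (hD : D.Nonempty) (N : Γ.DiscreteLoop D → ℕ) : LoopSoup D :=
  LoopSoup.ofList ⟨hD.some, hD.some_mem⟩ <|
    if h : N.support.Finite then
      (Finsupp.toMultiset (Finsupp.ofSupportFinite N h)).toList.map DiscreteLoop.toLoop
    else []

open scoped Classical in
/-- Keep the loops that visit a vertex of `T`. -/
def attachedTo (T : Set Γ.verts) (N : Γ.DiscreteLoop D → ℕ) : Γ.DiscreteLoop D → ℕ :=
  fun c => if ∃ u ∈ T, u ∈ c.1 then N c else 0

variable (Γ)

/-- The joint law of Wilson's algorithm and of an independent random walk loop soup in `D`. -/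
def jointLaw (D : Set ℂ) : Measure ((Γ.verts → ℕ → Γ.verts) × (Γ.DiscreteLoop D → ℕ)) :=
  Γ.wilsonLaw.prod (Γ.countLaw D)

/-- The random walk loop soup in `D`. -/
def rwls (hD : D.Nonempty) : (Γ.verts → ℕ → Γ.verts) × (Γ.DiscreteLoop D → ℕ) → LoopSoup D :=
  fun p => soup hD p.2

/-- The part of the random walk loop soup in `D` that is attached to the first `j` branches of
Wilson's algorithm. -/
def rwlsAttached (hD : D.Nonempty) (ord : List Γ.verts) (j : ℕ) :
    (Γ.verts → ℕ → Γ.verts) × (Γ.DiscreteLoop D → ℕ) → LoopSoup D :=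
  fun p => soup hD (attachedTo (Γ.firstBranches D ord p.1 j) p.2)

end PlaneGraph

end

noncomputable section

/-! ### Continuous logarithms in the plane -/

/-! The engine is a topological fact turned into a uniform probability bound. Chaining 13 rectangle
crossings of scale `ρ`, the walk from `v` makes, with probability at least `a ^ 13`, a tour that
surrounds the square of half-side `ρ` about `v` and stays in the ball of radius `7 ρ`
(`Crosses.tour`). Such a tour must meet every path of the graph which starts in the square and
leaves `D`, unless it leaves `D` itself (`Follows.meets`). Indeed, for `s` outside the simply
connected `D` there is a continuous `log (w - s)` on `D`; if the tour avoided the path, this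
logarithm could be carried along it to the starting point `u`, giving a continuous `log (w - u)` on
a curve that winds around `u`. The walk need not be reversible.

Every set sampled by Wilson's algorithm consists of vertices from which a path in the set leaves
`D`, because a branch ends on `∂D` or on earlier branches. Once the levels `Q_0, …, Q_i` are
sampled, such a path starts within `6⁻ⁱ` (in each coordinate) of every remaining vertex. By the tour
argument, repeated at successive exits from balls of radius `7 ρ` with `ρ = 6⁻ⁱ`, a walk goes to
distance `14 ρ m` with probability at most `(1 - a ^ 13) ^ m` (`Crosses.escape`). With `m = K i`
this beats the number of vertices of the next level, of order `36 ^ i`, so the failure probabilities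
sum to a geometric tail from scale `i₀` on. The scales stop at `6⁻ⁿ ≈ δ / δ₀`, where bounded density
controls the number of all the vertices (`wilsonLaw_not_laterWalksSmall_le`).

For the loops, consider those that avoid the sampled set `T` and cross an annulus between a small
ball `A` and the complement of a large ball `B`. Root such a loop at a vertex `y` where a passage
from `A` out of `B` ends. To close up, the walk from `y` must reach `A` again without being killed,
which has probability at most `s = (1 - a ^ 13) ^ m`, and then leave `B` at `y`. A Harnack
inequality for exit probabilities, which again comes from the tour and the maximum principle,
replaces the starting point in `A` by a fixed one, and the exit probabilities from there sum to at
most 1 over `y`. The mass is thus at most `2 s / a ^ 13` (`Crosses.tsum_loopMass_le`). A union bound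
over the cells of side `6⁻ⁱ` shows that with high probability all the loops that miss `T` are small,
and keeping or removing them is a coupling that bounds the Lévy–Prokhorov distance
(`levyProkhorovEDist_rwls_le`). -/

/-- Both functions are logarithms of `g` up to the factor `k`, so their difference is continuous
with values in a coset of `2πiℤ`, hence locally constant. -/
theorem log_sub_const_on_preconnected {X : Type*} [TopologicalSpace X] {s : Set X}
    (hs : IsPreconnected s) {l g : X → ℂ} (hl : ContinuousOn l s) (hg : ContinuousOn g s)
    (hlg : ∀ x ∈ s, Complex.exp (l x) = g x) {k : ℂ} (hk : ∀ x ∈ s, k * g x ∈ Complex.slitPlane)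
    {x y : X} (hx : x ∈ s) (hy : y ∈ s) :
    l x - Complex.log (k * g x) = l y - Complex.log (k * g y) := by
  have hc : ContinuousOn (fun x => l x - Complex.log (k * g x)) s :=
    hl.sub ((continuousOn_const.mul hg).clog hk)
  have hexp : ∀ x ∈ s, k * Complex.exp (l x - Complex.log (k * g x)) = 1 := by
    intro x hx
    have h0 := Complex.slitPlane_ne_zero (hk x hx)
    rw [Complex.exp_sub, Complex.exp_log h0, hlg x hx, mul_div_assoc', div_self h0]
  have hk0 : k ≠ 0 := by
    intro h
    have := hexp x hx
    simp [h] at this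
  refine hs.induction₂ (fun a b => l a - Complex.log (k * g a) = l b - Complex.log (k * g b))
    ?_ ?_ ?_ hx hy
  · intro a ha
    have h1 := Metric.continuousWithinAt_iff'.1 (hc a ha) (2 * Real.pi) (by positivity)
    filter_upwards [h1, self_mem_nhdsWithin] with b hb hbs
    have h2 : Complex.exp (l a - Complex.log (k * g a)) =
        Complex.exp (l b - Complex.log (k * g b)) :=
      mul_left_cancel₀ hk0 ((hexp a ha).trans (hexp b hbs).symm)
    obtain ⟨n, hn⟩ := Complex.exp_eq_exp_iff_exists_int.1 h2
    rw [hn] at hb ⊢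
    rw [dist_eq_norm] at hb
    have h3 : ‖(n : ℂ) * (2 * Real.pi * Complex.I)‖ < 2 * Real.pi := by
      rw [← norm_neg]
      refine lt_of_le_of_lt (le_of_eq ?_) hb
      congr 1; ring
    have h4 : ‖(n : ℂ) * (2 * Real.pi * Complex.I)‖ = |(n : ℝ)| * (2 * Real.pi) := by
      simp [abs_of_pos Real.pi_pos]
    rw [h4] at h3
    have h5 : |(n : ℝ)| < 1 := by
      by_contra h
      push Not at h
      nlinarith [Real.pi_pos]
    have h6 : |n| < 1 := by exact_mod_cast h5
    rw [Int.abs_lt_one_iff] at h6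
    simp [h6]
  · intro a b c _ _ _ h1 h2; exact h1.trans h2
  · intro a b _ _ h; exact h.symm

/-- In the closed first quadrant a backward quarter turn stays in the principal range of the
argument. -/
theorem arg_neg_I_mul {w : ℂ} (hw : w ≠ 0) (hr : 0 ≤ w.re) (hi : 0 ≤ w.im) :
    (-Complex.I * w).arg = w.arg - Real.pi / 2 := by
  have h1 : 0 ≤ w.arg := Complex.arg_nonneg_iff.2 hi
  have h2 : w.arg ≤ Real.pi / 2 := by
    have := Complex.abs_arg_le_pi_div_two_iff.2 hr
    exact (abs_le.1 this).2
  rw [Complex.arg_mul_eq_add_arg_iff (by simp) hw |>.2]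
  · simp; ring
  · simp only [Complex.arg_neg_I]
    constructor <;> linarith [Real.pi_pos]

theorem slit_of_re_nonneg {w : ℂ} (hw : w ≠ 0) (hr : 0 ≤ w.re) : w ∈ Complex.slitPlane := by
  rw [Complex.mem_slitPlane_iff]
  rcases hr.lt_or_eq with h | h
  · exact Or.inl h
  · right
    intro h'
    exact hw (Complex.ext h.symm h')

/-- A function with a continuous logarithm cannot run once around the origin. -/
theorem no_log_around {X : Type*} [TopologicalSpace X] {B R T L : Set X} {l g : X → ℂ}
    (hB : IsPreconnected B) (hR : IsPreconnected R) (hT : IsPreconnected T)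
    (hL : IsPreconnected L) (hl : ContinuousOn l (B ∪ R ∪ T ∪ L))
    (hg : ContinuousOn g (B ∪ R ∪ T ∪ L))
    (hlg : ∀ x ∈ B ∪ R ∪ T ∪ L, Complex.exp (l x) = g x)
    (gB : ∀ x ∈ B, (g x).im ≤ 0) (gR : ∀ x ∈ R, 0 ≤ (g x).re) (gT : ∀ x ∈ T, 0 ≤ (g x).im)
    (gL : ∀ x ∈ L, (g x).re ≤ 0) {p q₁ q₂ q₃ : X} (hp : p ∈ B ∩ L) (h1 : q₁ ∈ B ∩ R)
    (h2 : q₂ ∈ R ∩ T) (h3 : q₃ ∈ T ∩ L) : False := by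
  have g0 : ∀ x ∈ B ∪ R ∪ T ∪ L, g x ≠ 0 := fun x hx => by
    rw [← hlg x hx]; exact Complex.exp_ne_zero _
  have sB : B ⊆ B ∪ R ∪ T ∪ L := fun x hx => by simp [hx]
  have sR : R ⊆ B ∪ R ∪ T ∪ L := fun x hx => by simp [hx]
  have sT : T ⊆ B ∪ R ∪ T ∪ L := fun x hx => by simp [hx]
  have sL : L ⊆ B ∪ R ∪ T ∪ L := fun x hx => by simp [hx]
  have key : ∀ s ⊆ B ∪ R ∪ T ∪ L, IsPreconnected s → ∀ k : ℂ, k ≠ 0 →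
      (∀ x ∈ s, 0 ≤ (k * g x).re) → ∀ x ∈ s, ∀ y ∈ s,
      (l x).im - (k * g x).arg = (l y).im - (k * g y).arg := by
    intro s hs hc k hk h x hx y hy
    have := log_sub_const_on_preconnected hc (hl.mono hs) (hg.mono hs)
      (fun x hx => hlg x (hs hx)) (k := k)
      (fun x hx => slit_of_re_nonneg (mul_ne_zero hk (g0 x (hs hx))) (h x hx)) hx hy
    have := congrArg Complex.im this
    simpa [Complex.log_im] using this
  -- The factors `I, 1, -I, -1` rotate the four half-planes to the right one, where the principal
  -- logarithm is continuous.
  have e1 := key B sB hB Complex.I (by simp) (by simpa using gB) p hp.1 q₁ h1.1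
  have e2 := key R sR hR 1 (by simp) (by simpa using gR) q₁ h1.2 q₂ h2.1
  have e3 := key T sT hT (-Complex.I) (by simp) (by simpa using gT) q₂ h2.2 q₃ h3.1
  have e4 := key L sL hL (-1) (by simp) (by simpa using gL) q₃ h3.2 p hp.2
  -- At each corner the arguments used on the two adjacent sides differ by `π / 2`; added up, the
  -- equations say `2π = 0`.
  have a1 := arg_neg_I_mul (w := Complex.I * g q₁) (by simpa using g0 _ (sB h1.1))
    (by simpa using gB _ h1.1) (by simpa using gR _ h1.2)
  have a2 := arg_neg_I_mul (w := g q₂) (by simpa using g0 _ (sR h2.1))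
    (by simpa using gR _ h2.1) (by simpa using gT _ h2.2)
  have a3 := arg_neg_I_mul (w := -Complex.I * g q₃) (by simpa using g0 _ (sT h3.1))
    (by simpa using gT _ h3.1) (by simpa using gL _ h3.2)
  have a4 := arg_neg_I_mul (w := -1 * g p) (by simpa using g0 _ (sB hp.1))
    (by simpa using gL _ hp.2) (by simpa using gB _ hp.1)
  have b1 : -Complex.I * (Complex.I * g q₁) = 1 * g q₁ := by
    rw [← mul_assoc]; simp
  have b3 : -Complex.I * (-Complex.I * g q₃) = -1 * g q₃ := by
    rw [← mul_assoc]; simp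
  have b4 : -Complex.I * (-1 * g p) = Complex.I * g p := by ring
  rw [b1] at a1
  rw [b3] at a3
  rw [b4] at a4
  rw [one_mul] at a1 e2
  rw [one_mul] at e2
  linarith [Real.pi_pos]

/-- A curve crossing a rectangle horizontally meets every curve crossing it vertically. -/
theorem crossing_paths_meet {p₀ p₁ q₀ q₁ : ℂ} (a : Path p₀ p₁) (b : Path q₀ q₁) {x₀ x₁ y₀ y₁ : ℝ}
    (ha : ∀ z ∈ range a, y₀ ≤ z.im ∧ z.im ≤ y₁) (hb : ∀ z ∈ range b, x₀ ≤ z.re ∧ z.re ≤ x₁)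
    (ha0 : p₀.re ≤ x₀) (ha1 : x₁ ≤ p₁.re) (hb0 : q₀.im ≤ y₀) (hb1 : y₁ ≤ q₁.im) :
    (range a ∩ range b).Nonempty := by
  by_contra hne
  rw [not_nonempty_iff_eq_empty] at hne
  have hne : ∀ s t, a s ≠ b t := fun s t h => by
    have : a s ∈ range a ∩ range b := ⟨⟨s, rfl⟩, ⟨t, h.symm⟩⟩
    rw [hne] at this; exact this
  -- For disjoint curves `a(s) - b(t)` never vanishes and has a continuous logarithm on the plane,
  -- while its values on the lines `t = 1`, `s = 1`, `t = 0`, `s = 0` lie in four successive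
  -- half-planes.
  set g : ℝ × ℝ → ℂ := fun z => a.extend z.1 - b.extend z.2 with hg
  have hgc : Continuous g :=
    (a.continuous_extend.comp continuous_fst).sub (b.continuous_extend.comp continuous_snd)
  have hsc : IsSimplyConnected (univ : Set (ℝ × ℝ)) := by
    have : ContractibleSpace (univ : Set (ℝ × ℝ)) :=
      (Homeomorph.Set.univ (ℝ × ℝ)).contractibleSpace
    exact (inferInstance : SimplyConnectedSpace (univ : Set (ℝ × ℝ)))
  have ma : ∀ s, a.extend s ∈ range a := fun s => by
    rw [← a.extend_range]; exact mem_range_self _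
  have mb : ∀ s, b.extend s ∈ range b := fun s => by
    rw [← b.extend_range]; exact mem_range_self _
  obtain ⟨l, hl, hlg⟩ := Complex.exists_continuousOn_eqOn_exp_comp hsc isOpen_univ
    hgc.continuousOn (by
      rintro ⟨z, -, hz⟩
      obtain ⟨s, hs⟩ := ma z.1
      obtain ⟨t, ht⟩ := mb z.2
      exact hne s t (by rw [hs, ht]; exact sub_eq_zero.1 hz))
  have hI : IsPreconnected (univ : Set ℝ) := isPreconnected_univ
  refine no_log_around (X := ℝ × ℝ) (B := univ ×ˢ {1}) (R := {1} ×ˢ univ) (T := univ ×ˢ {0})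
    (L := {0} ×ˢ univ) (l := l) (g := g) (hI.prod isPreconnected_singleton)
    (isPreconnected_singleton.prod hI) (hI.prod isPreconnected_singleton)
    (isPreconnected_singleton.prod hI) (hl.mono (subset_univ _)) hgc.continuousOn
    (fun x _ => hlg (mem_univ x)) ?_ ?_ ?_ ?_
    (p := (0, 1)) (q₁ := (1, 1)) (q₂ := (1, 0)) (q₃ := (0, 0))
    (by simp) (by simp) (by simp) (by simp)
  · rintro ⟨s, t⟩ ⟨-, ht⟩
    rw [mem_singleton_iff] at ht
    subst ht
    have := (ha _ (ma s)).2
    simp [hg]; linarith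
  · rintro ⟨s, t⟩ ⟨ht, -⟩
    rw [mem_singleton_iff] at ht
    subst ht
    have := (hb _ (mb t)).2
    simp [hg]; linarith
  · rintro ⟨s, t⟩ ⟨-, ht⟩
    rw [mem_singleton_iff] at ht
    subst ht
    have := (ha _ (ma s)).1
    simp [hg]; linarith
  · rintro ⟨s, t⟩ ⟨ht, -⟩
    rw [mem_singleton_iff] at ht
    subst ht
    have := (hb _ (mb t)).1
    simp [hg]; linarith

/-- There is a continuous branch of `log (w - s)` for `w ∈ K`. -/
def HasLog (K : Set ℂ) (s : ℂ) : Prop :=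
  ∃ l : ℂ → ℂ, ContinuousOn l K ∧ ∀ w ∈ K, Complex.exp (l w) = w - s

theorem HasLog.mono {K K' : Set ℂ} {s : ℂ} (h : HasLog K s) (hK : K' ⊆ K) : HasLog K' s := by
  obtain ⟨l, hl, h⟩ := h
  exact ⟨l, hl.mono hK, fun w hw => h w (hK hw)⟩

theorem IsSimplyConnected.hasLog {D : Set ℂ} (hD : IsSimplyConnected D) (hDo : IsOpen D) {s : ℂ}
    (hs : s ∉ D) : HasLog D s := by
  obtain ⟨l, hl, h⟩ := Complex.exists_continuousOn_eqOn_exp_comp hD hDo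
    (g := fun w => w - s) (by fun_prop) (by
      rintro ⟨z, hz, h⟩
      exact hs (by rwa [← sub_eq_zero.1 h]))
  exact ⟨l, hl, fun w hw => h hw⟩

/-- Add to `log (w - s)` the principal logarithm of `(w - t) / (w - s)`, a number at distance less
than 1 from 1. -/
theorem HasLog.of_close {K : Set ℂ} {s t : ℂ} (h : HasLog K s)
    (hst : ∀ w ∈ K, ‖s - t‖ < ‖w - s‖) : HasLog K t := by
  obtain ⟨l, hl, h⟩ := h
  have hne : ∀ w ∈ K, w - s ≠ 0 := fun w hw h0 => by
    have := hst w hw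
    rw [h0, norm_zero] at this
    exact absurd this (not_lt.2 (norm_nonneg _))
  have hs : ∀ w ∈ K, (w - t) / (w - s) ∈ Complex.slitPlane := by
    intro w hw
    apply Complex.ball_one_subset_slitPlane
    rw [mem_ball_iff_norm]
    have : (w - t) / (w - s) - 1 = (s - t) / (w - s) := by
      field_simp [hne w hw]; ring
    rw [this, norm_div, div_lt_one (norm_pos_iff.2 (hne w hw))]
    exact hst w hw
  refine ⟨fun w => l w + Complex.log ((w - t) / (w - s)), ?_, ?_⟩
  · exact hl.add ((ContinuousOn.div (by fun_prop) (by fun_prop) hne).clog hs)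
  · intro w hw
    rw [Complex.exp_add, h w hw, Complex.exp_log (Complex.slitPlane_ne_zero (hs w hw)),
      mul_div_cancel₀ _ (hne w hw)]

/-- By `HasLog.of_close` the property is locally constant in the complement of `K`. This is how a
logarithm is carried along a path of the graph. -/
theorem HasLog.of_preconnected {K M : Set ℂ} (hK : IsClosed K) (hM : IsPreconnected M)
    (hd : Disjoint M K) {s t : ℂ} (hs : s ∈ M) (ht : t ∈ M) (h : HasLog K s) : HasLog K t := by
  refine (hM.induction₂ (fun a b => HasLog K a ↔ HasLog K b) ?_ ?_ ?_ hs ht).1 h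
  · intro a ha
    have haK : a ∈ Kᶜ := disjoint_left.1 hd ha
    obtain ⟨r, hr, hball⟩ := Metric.isOpen_iff.1 hK.isOpen_compl a haK
    -- Half the radius, so that `HasLog.of_close` applies both from `a` to `b` and from `b` to `a`.
    have : ∀ᶠ b in nhdsWithin a M, b ∈ Metric.ball a (r / 2) :=
      mem_nhdsWithin_of_mem_nhds (Metric.ball_mem_nhds a (by positivity))
    filter_upwards [this] with b hb
    rw [mem_ball_iff_norm] at hb
    have hw : ∀ w ∈ K, r ≤ ‖w - a‖ := fun w hw => by
      by_contra h
      exact hball (mem_ball_iff_norm.2 (not_le.1 h)) hw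
    constructor
    · refine fun h => h.of_close fun w hwK => ?_
      rw [norm_sub_rev]
      linarith [hw w hwK]
    · refine fun h => h.of_close fun w hwK => ?_
      have h1 : w - a = (w - b) + (b - a) := by ring
      have := norm_add_le (w - b) (b - a)
      rw [← h1] at this
      linarith [hw w hwK]
  · intro a b c _ _ _ h1 h2; exact h1.trans h2
  · intro a b _ _ h; exact h.symm

end

noncomputable section

namespace PlaneGraph

variable (Γ : PlaneGraph)

/-! ### Trajectories and tours around a square -/

/-- The trajectory of the walk between the times `m` and `n`. -/
def trail (x : ℕ → Γ.verts) (m n : ℕ) : Set ℂ :=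
  insert (x m : ℂ) (⋃ i ∈ Ico m n, range (Γ.edge (x i) (x (i + 1))))

variable {Γ} {x : ℕ → Γ.verts} {m n : ℕ}

theorem edge_zero_mem (u v : Γ.verts) : (u : ℂ) ∈ range (Γ.edge u v) := ⟨0, by simp⟩

theorem edge_one_mem (u v : Γ.verts) : (v : ℂ) ∈ range (Γ.edge u v) := ⟨1, by simp⟩

theorem trail_self : Γ.trail x m m = {(x m : ℂ)} := by simp [trail]

theorem trail_succ (h : m ≤ n) :
    Γ.trail x m (n + 1) = Γ.trail x m n ∪ range (Γ.edge (x n) (x (n + 1))) := by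
  ext z
  simp only [trail, mem_insert_iff, mem_iUnion, mem_union, mem_Ico, exists_prop]
  constructor
  · rintro (h1 | ⟨i, ⟨h1, h2⟩, h3⟩)
    · exact Or.inl (Or.inl h1)
    · rcases Nat.lt_succ_iff_lt_or_eq.1 h2 with h4 | rfl
      · exact Or.inl (Or.inr ⟨i, ⟨h1, h4⟩, h3⟩)
      · exact Or.inr h3
  · rintro ((h1 | ⟨i, ⟨h1, h2⟩, h3⟩) | h3)
    · exact Or.inl h1
    · exact Or.inr ⟨i, ⟨h1, h2.trans (Nat.lt_succ_self _)⟩, h3⟩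
    · exact Or.inr ⟨n, ⟨h, Nat.lt_succ_self _⟩, h3⟩

theorem edge_subset_trail {i : ℕ} (h1 : m ≤ i) (h2 : i < n) :
    range (Γ.edge (x i) (x (i + 1))) ⊆ Γ.trail x m n := by
  refine subset_trans ?_ (subset_insert _ _)
  exact subset_biUnion_of_mem (u := fun i => range (Γ.edge (x i) (x (i + 1)))) (mem_Ico.2 ⟨h1, h2⟩)

theorem vertex_mem_trail {i : ℕ} (h1 : m ≤ i) (h2 : i ≤ n) : (x i : ℂ) ∈ Γ.trail x m n := by
  rcases h1.eq_or_lt with rfl | h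
  · exact mem_insert _ _
  · obtain ⟨j, rfl⟩ : ∃ j, i = j + 1 := ⟨i - 1, by omega⟩
    exact edge_subset_trail (by omega) (by omega) (edge_one_mem _ _)

theorem trail_subset {m' n' : ℕ} {R : Set ℂ} (h : Γ.trail x m n ⊆ R) (h1 : m ≤ m') (h2 : m' ≤ n')
    (h3 : n' ≤ n) : Γ.trail x m' n' ⊆ R := by
  refine subset_trans (insert_subset (vertex_mem_trail h1 (h2.trans h3)) ?_) h
  exact iUnion₂_subset fun i hi => edge_subset_trail (h1.trans hi.1) (hi.2.trans_le h3)

theorem trail_subset_union {k : ℕ} (_h1 : m ≤ k) (_h2 : k ≤ n) :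
    Γ.trail x m n ⊆ Γ.trail x m k ∪ Γ.trail x k n := by
  refine insert_subset (Or.inl (mem_insert _ _)) (iUnion₂_subset fun i hi => ?_)
  rcases lt_or_ge i k with h | h
  · exact (edge_subset_trail hi.1 h).trans subset_union_left
  · exact (edge_subset_trail h hi.2).trans subset_union_right

theorem trail_subset_of_trail {R : Set ℂ} {k : ℕ} (h1 : m ≤ k) (h2 : k ≤ n)
    (h3 : Γ.trail x m k ⊆ R) (h4 : Γ.trail x k n ⊆ R) : Γ.trail x m n ⊆ R :=
  (trail_subset_union h1 h2).trans (union_subset h3 h4)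

theorem isCompact_trail : IsCompact (Γ.trail x m n) :=
  ((finite_Ico m n).isCompact_biUnion fun _ _ => isCompact_range (Path.continuous _)).insert _

theorem exists_path_trail (h : m ≤ n) :
    ∃ p : Path (x m : ℂ) (x n : ℂ), range p ⊆ Γ.trail x m n := by
  induction n, h using Nat.le_induction with
  | base => exact ⟨Path.refl _, by simp [trail_self]⟩
  | succ n h ih =>
    obtain ⟨p, hp⟩ := ih
    refine ⟨p.trans (Γ.edge _ _), ?_⟩
    rw [Path.trans_range, trail_succ h]
    exact union_subset_union_left _ hp

theorem isPreconnected_trail (h : m ≤ n) : IsPreconnected (Γ.trail x m n) := by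
  induction n, h using Nat.le_induction with
  | base => rw [trail_self]; exact isPreconnected_singleton
  | succ n h ih =>
    rw [trail_succ h]
    exact ih.union _ (vertex_mem_trail h le_rfl) (edge_zero_mem _ _)
      (isPreconnected_range (Path.continuous _))

theorem vertex_mem_edge {u v w : Γ.verts} (h : Γ.weight u v ≠ 0)
    (hw : (w : ℂ) ∈ range (Γ.edge u v)) : w = u ∨ w = v := by
  obtain ⟨t, ht⟩ := hw
  rcases eq_or_ne t 0 with rfl | h0
  · left; ext; rw [← ht]; simp
  rcases eq_or_ne t 1 with rfl | h1
  · right; ext; rw [← ht]; simp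
  · exact absurd (by rw [ht]; exact w.2)
      (Γ.edge_interior u v h t (unitInterval.pos_iff_ne_zero.2 h0)
        (unitInterval.lt_one_iff_ne_one.2 h1))

theorem vertex_of_mem_trail (hx : ∀ i, Γ.weight (x i) (x (i + 1)) ≠ 0) (hmn : m ≤ n) {w : Γ.verts}
    (hw : (w : ℂ) ∈ Γ.trail x m n) : ∃ i, m ≤ i ∧ i ≤ n ∧ x i = w := by
  simp only [trail, mem_insert_iff, mem_iUnion, mem_Ico, exists_prop] at hw
  rcases hw with h | ⟨i, ⟨h1, h2⟩, h3⟩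
  · exact ⟨m, le_rfl, hmn, Subtype.ext h.symm⟩
  · rcases vertex_mem_edge (hx i) h3 with h | h
    · exact ⟨i, h1, h2.le, h.symm⟩
    · exact ⟨i + 1, by omega, h2, h.symm⟩

/-- An edge that meets a trajectory in its interior is followed by it. -/
theorem edge_of_mem_trail (hx : ∀ i, Γ.weight (x i) (x (i + 1)) ≠ 0) {a b : Γ.verts}
    (hab : Γ.weight a b ≠ 0) {t : I} (h0 : 0 < t) (h1 : t < 1)
    (ht : Γ.edge a b t ∈ Γ.trail x m n) :
    ∃ i, m ≤ i ∧ i < n ∧ range (Γ.edge (x i) (x (i + 1))) = range (Γ.edge a b) := by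
  have hnv := Γ.edge_interior a b hab t h0 h1
  simp only [trail, mem_insert_iff, mem_iUnion, mem_Ico, exists_prop] at ht
  rcases ht with h | ⟨i, ⟨hi1, hi2⟩, s, hs⟩
  · exact absurd (h ▸ (x m).2) hnv
  · refine ⟨i, hi1, hi2, Γ.noncrossing _ _ _ _ (hx i) hab s t ?_ ?_ h0 h1 hs⟩
    · refine unitInterval.pos_iff_ne_zero.2 fun h => hnv ?_
      rw [← hs, h]; simp
    · refine unitInterval.lt_one_iff_ne_one.2 fun h => hnv ?_
      rw [← hs, h]; simp

/-- One step of a chain that stays in `S`. -/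
def ChainStep (Γ : PlaneGraph) (S : Set Γ.verts) (a b : Γ.verts) : Prop :=
  Γ.weight a b ≠ 0 ∧ b ∈ S

/-- From `u`, the graph contains a path with vertices in `S` and a last edge that leaves `D`. -/
def Exits (Γ : PlaneGraph) (D : Set ℂ) (S : Set Γ.verts) (u : Γ.verts) : Prop :=
  u ∈ S ∧ ∃ b b', Relation.ReflTransGen (Γ.ChainStep S) u b ∧ Γ.weight b b' ≠ 0 ∧
    ¬ range (Γ.edge b b') ⊆ D

theorem Exits.mono {D : Set ℂ} {S S' : Set Γ.verts} {u : Γ.verts} (h : Γ.Exits D S u)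
    (hS : S ⊆ S') : Γ.Exits D S' u := by
  obtain ⟨h0, b, b', h1, h2⟩ := h
  exact ⟨hS h0, b, b', Relation.ReflTransGen.mono (r := Γ.ChainStep S) (fun _ _ h => ⟨h.1, hS h.2⟩) _ _ h1, h2⟩

theorem mem_of_chain {S : Set Γ.verts} {u b : Γ.verts} (hu : u ∈ S)
    (h : Relation.ReflTransGen (Γ.ChainStep S) u b) : b ∈ S := by
  rcases Relation.ReflTransGen.cases_tail h with h | ⟨c, -, h⟩
  · exact h ▸ hu
  · exact h.2

/-- A trajectory in `D` which avoids a path of the graph that leaves `D` does not wind around its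
starting point. -/
theorem Exits.hasLog_trail {D : Set ℂ} (hD : ∀ s ∉ D, HasLog D s) {S : Set Γ.verts} {u : Γ.verts}
    (hu : Γ.Exits D S u) (hx : ∀ i, Γ.weight (x i) (x (i + 1)) ≠ 0) (hmn : m ≤ n)
    (hS : ∀ i, m ≤ i → i ≤ n → x i ∉ S) (hxD : Γ.trail x m n ⊆ D) : HasLog (Γ.trail x m n) u := by
  obtain ⟨huS, b, b', hub, hbb, hout⟩ := hu
  have hvert : ∀ w ∈ S, (w : ℂ) ∉ Γ.trail x m n := fun w hw h => by
    obtain ⟨i, h1, h2, rfl⟩ := vertex_of_mem_trail hx hmn h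
    exact hS i h1 h2 hw
  have hcl := (isCompact_trail (x := x) (m := m) (n := n)).isClosed
  have hbS : b ∈ S := mem_of_chain huS hub
  have hb : HasLog (Γ.trail x m n) b := by
    -- Start from a point of the last edge outside `D`, where a logarithm is available on all of
    -- `D`, and come back along the edge to `b`.
    obtain ⟨z, ⟨t, rfl⟩, hz⟩ := not_subset.1 hout
    have hzl := (hD _ hz).mono hxD
    have himg : IsPreconnected (Γ.edge b b' '' Icc 0 t) :=
      isPreconnected_Icc.image _ (Γ.edge b b').continuous.continuousOn
    refine HasLog.of_preconnected hcl himg ?_ ⟨t, ⟨unitInterval.nonneg', le_rfl⟩, rfl⟩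
      ⟨0, ⟨le_rfl, unitInterval.nonneg'⟩, by simp⟩ hzl
    rw [disjoint_left]
    rintro _ ⟨s, ⟨-, hst⟩, rfl⟩ hs
    rcases eq_or_ne s 0 with rfl | h0
    · rw [Path.source] at hs
      exact hvert b hbS hs
    rcases eq_or_ne s 1 with rfl | h1
    -- The far endpoint belongs to the arc only if it is the chosen point outside `D`, so it is not
    -- on the trajectory.
    · have : t = 1 := le_antisymm unitInterval.le_one' hst
      subst this
      exact hz (hxD hs)
    -- A trajectory meeting the interior of this edge would follow the whole edge and leave `D`.
    · obtain ⟨i, hi1, hi2, hr⟩ := edge_of_mem_trail hx hbb (unitInterval.pos_iff_ne_zero.2 h0)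
        (unitInterval.lt_one_iff_ne_one.2 h1) hs
      exact hout (hr ▸ (edge_subset_trail hi1 hi2).trans hxD)
  -- Now back along the chain from `b` to `u`: both ends of each edge are in `S`, so the trajectory
  -- can neither visit nor follow it.
  clear hbb hout
  revert hb
  induction hub with
  | refl => exact id
  | @tail c d hc hcd ih =>
    intro hd
    have hcS := mem_of_chain huS hc
    refine ih hcS (HasLog.of_preconnected hcl (isPreconnected_range (Γ.edge c d).continuous) ?_
      (edge_one_mem _ _) (edge_zero_mem _ _) hd)
    rw [disjoint_left]
    rintro _ ⟨s, rfl⟩ hs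
    rcases eq_or_ne s 0 with rfl | h0
    · rw [Path.source] at hs
      exact hvert c hcS hs
    rcases eq_or_ne s 1 with rfl | h1
    · rw [Path.target] at hs
      exact hvert d hcd.2 hs
    · obtain ⟨i, hi1, hi2, hr⟩ := edge_of_mem_trail hx hcd.1 (unitInterval.pos_iff_ne_zero.2 h0)
        (unitInterval.lt_one_iff_ne_one.2 h1) hs
      refine hvert c hcS (edge_subset_trail hi1 hi2 ?_)
      rw [hr]; exact edge_zero_mem _ _

/-- The rectangle at distance `ρ / 2` around the horizontal or vertical segment from `p` to
`p'`. -/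
def hull (ρ : ℝ) (p p' : ℂ) : Set ℂ :=
  {z | min p.re p'.re - ρ / 2 ≤ z.re ∧ z.re ≤ max p.re p'.re + ρ / 2 ∧
    min p.im p'.im - ρ / 2 ≤ z.im ∧ z.im ≤ max p.im p'.im + ρ / 2}

/-- The walk follows the rectangles that join the first `k` consecutive points of `ps`. -/
def Follows (ρ : ℝ) (ps : ℕ → ℂ) (k : ℕ) (x : ℕ → Γ.verts) : Prop :=
  ∃ t : ℕ → ℕ, Monotone t ∧ t 0 = 0 ∧ ∀ i < k, (x (t (i + 1)) : ℂ) ∈ Metric.ball (ps (i + 1)) (ρ / 4) ∧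
    Γ.trail x (t i) (t (i + 1)) ⊆ hull ρ (ps i) (ps (i + 1))

/-- A lattice tour around the origin: it goes to the left, then once around, and ends by crossing
its beginning. -/
def tour : ℕ → ℂ
  | 0 => ⟨0, 0⟩ | 1 => ⟨0, -1⟩ | 2 => ⟨-1, -1⟩ | 3 => ⟨-2, -1⟩ | 4 => ⟨-1, -1⟩ | 5 => ⟨0, -1⟩
  | 6 => ⟨1, -1⟩ | 7 => ⟨1, 0⟩ | 8 => ⟨1, 1⟩ | 9 => ⟨0, 1⟩ | 10 => ⟨-1, 1⟩ | 11 => ⟨-1, 0⟩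
  | 12 => ⟨-1, -1⟩ | _ => ⟨-1, -2⟩

/-- The tour around `v` at scale `ρ`. -/
def tourAt (v : ℂ) (ρ : ℝ) (k : ℕ) : ℂ := v + (2 * ρ : ℝ) * tour k

theorem re_tourAt (v : ℂ) (ρ : ℝ) (k : ℕ) : (tourAt v ρ k).re = v.re + 2 * ρ * (tour k).re := by
  simp [tourAt, Complex.mul_re]

theorem im_tourAt (v : ℂ) (ρ : ℝ) (k : ℕ) : (tourAt v ρ k).im = v.im + 2 * ρ * (tour k).im := by
  simp [tourAt, Complex.mul_im]

/-- Between `t 3` and `t 13` the trajectory consists of a bottom, a right, a top and a left piece,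
each beyond the corresponding side of the square of half-side `3 / 2 * ρ`. The end of the left piece
crosses the beginning of the bottom piece at `p`, which closes the circuit, and `no_log_around`
applies. -/
theorem Follows.tour {v : ℂ} {ρ : ℝ} (hρ : 0 < ρ) (h : Follows ρ (tourAt v ρ) 13 x) :
    ∃ m n p, m ≤ n ∧ (∀ i j, i ≤ j → j ≤ n → Γ.trail x i j ⊆ Metric.ball v (7 * ρ)) ∧
      p ∈ Γ.trail x m n ∧
      (∀ w ∈ Γ.trail x m n, 3 / 2 * ρ ≤ |w.re - v.re| ∨ 3 / 2 * ρ ≤ |w.im - v.im|) ∧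
      ∀ u : ℂ, |u.re - v.re| ≤ ρ → |u.im - v.im| ≤ ρ → ¬ HasLog (Γ.trail x m n) u := by
  obtain ⟨t, htm, ht0, ht⟩ := h
  have hpos : ∀ i < 13, |(x (t (i + 1)) : ℂ).re - (v.re + 2 * ρ * (PlaneGraph.tour (i + 1)).re)| < ρ / 4 ∧
      |(x (t (i + 1)) : ℂ).im - (v.im + 2 * ρ * (PlaneGraph.tour (i + 1)).im)| < ρ / 4 := by
    intro i hi
    have := mem_ball_iff_norm.1 (ht i hi).1
    rw [← re_tourAt, ← im_tourAt, ← Complex.sub_re, ← Complex.sub_im]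
    exact ⟨(Complex.abs_re_le_norm _).trans_lt this, (Complex.abs_im_le_norm _).trans_lt this⟩
  have hle : ∀ i j, i ≤ j → t i ≤ t j := fun i j h => htm h
  have hle : ∀ i j, i ≤ j → t i ≤ t j := fun i j h => htm h
  have seg : ∀ (i j : ℕ) (R : Set ℂ), i < j → j ≤ 13 →
      (∀ k, i ≤ k → k < j → Γ.trail x (t k) (t (k + 1)) ⊆ R) → Γ.trail x (t i) (t j) ⊆ R := by
    intro i j R hlt hj hR
    induction j, hlt using Nat.le_induction with
    | base => exact hR i le_rfl (Nat.lt_succ_self _)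
    | succ j hj' ih =>
      exact trail_subset_of_trail (hle _ _ (Nat.le_of_lt hj')) (hle _ _ (by omega))
        (ih (by omega) fun k h1 h2 => hR k h1 (by omega)) (hR j (Nat.le_of_lt hj') (by omega))
  -- Half-planes that contain a piece of the tour: the bound on the lattice points, loosened by the
  -- half-width `ρ / 2` of the rectangles.
  have lre : ∀ (L : ℝ) (i j : ℕ), i < j → j ≤ 13 → (∀ k, i ≤ k → k ≤ j → L ≤ (PlaneGraph.tour k).re) →
      Γ.trail x (t i) (t j) ⊆ {w | v.re + 2 * ρ * L - ρ / 2 ≤ w.re} := by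
    intro L i j hij hj hL
    refine seg i j _ hij hj fun k h1 h2 => (ht k (by omega)).2.trans fun w hw => ?_
    have h3 := hw.1
    rw [re_tourAt, re_tourAt] at h3
    have h4 := mul_le_mul_of_nonneg_left (hL k h1 h2.le) (by positivity : 0 ≤ 2 * ρ)
    have h5 := mul_le_mul_of_nonneg_left (hL (k + 1) (by omega) h2) (by positivity : 0 ≤ 2 * ρ)
    have h6 := le_min (add_le_add (le_refl v.re) h4) (add_le_add (le_refl v.re) h5)
    simp only [mem_ofPred_eq]
    linarith
  have lim : ∀ (L : ℝ) (i j : ℕ), i < j → j ≤ 13 → (∀ k, i ≤ k → k ≤ j → L ≤ (PlaneGraph.tour k).im) →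
      Γ.trail x (t i) (t j) ⊆ {w | v.im + 2 * ρ * L - ρ / 2 ≤ w.im} := by
    intro L i j hij hj hL
    refine seg i j _ hij hj fun k h1 h2 => (ht k (by omega)).2.trans fun w hw => ?_
    have h3 := hw.2.2.1
    rw [im_tourAt, im_tourAt] at h3
    have h4 := mul_le_mul_of_nonneg_left (hL k h1 h2.le) (by positivity : 0 ≤ 2 * ρ)
    have h5 := mul_le_mul_of_nonneg_left (hL (k + 1) (by omega) h2) (by positivity : 0 ≤ 2 * ρ)
    have h6 := le_min (add_le_add (le_refl v.im) h4) (add_le_add (le_refl v.im) h5)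
    simp only [mem_ofPred_eq]
    linarith
  have ure : ∀ (L : ℝ) (i j : ℕ), i < j → j ≤ 13 → (∀ k, i ≤ k → k ≤ j → (PlaneGraph.tour k).re ≤ L) →
      Γ.trail x (t i) (t j) ⊆ {w | w.re ≤ v.re + 2 * ρ * L + ρ / 2} := by
    intro L i j hij hj hL
    refine seg i j _ hij hj fun k h1 h2 => (ht k (by omega)).2.trans fun w hw => ?_
    have h3 := hw.2.1
    rw [re_tourAt, re_tourAt] at h3
    have h4 := mul_le_mul_of_nonneg_left (hL k h1 h2.le) (by positivity : 0 ≤ 2 * ρ)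
    have h5 := mul_le_mul_of_nonneg_left (hL (k + 1) (by omega) h2) (by positivity : 0 ≤ 2 * ρ)
    have h6 := max_le (add_le_add (le_refl v.re) h4) (add_le_add (le_refl v.re) h5)
    simp only [mem_ofPred_eq]
    linarith
  have uim : ∀ (L : ℝ) (i j : ℕ), i < j → j ≤ 13 → (∀ k, i ≤ k → k ≤ j → (PlaneGraph.tour k).im ≤ L) →
      Γ.trail x (t i) (t j) ⊆ {w | w.im ≤ v.im + 2 * ρ * L + ρ / 2} := by
    intro L i j hij hj hL
    refine seg i j _ hij hj fun k h1 h2 => (ht k (by omega)).2.trans fun w hw => ?_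
    have h3 := hw.2.2.2
    rw [im_tourAt, im_tourAt] at h3
    have h4 := mul_le_mul_of_nonneg_left (hL k h1 h2.le) (by positivity : 0 ≤ 2 * ρ)
    have h5 := mul_le_mul_of_nonneg_left (hL (k + 1) (by omega) h2) (by positivity : 0 ≤ 2 * ρ)
    have h6 := max_le (add_le_add (le_refl v.im) h4) (add_le_add (le_refl v.im) h5)
    simp only [mem_ofPred_eq]
    linarith
  have bot := uim (-1) 3 6 (by norm_num) (by norm_num)
    (by intro k h1 h2; interval_cases k <;> norm_num [PlaneGraph.tour])
  have rig := lre 1 6 8 (by norm_num) (by norm_num)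
    (by intro k h1 h2; interval_cases k <;> norm_num [PlaneGraph.tour])
  have top := lim 1 8 10 (by norm_num) (by norm_num)
    (by intro k h1 h2; interval_cases k <;> norm_num [PlaneGraph.tour])
  have lef := ure (-1) 10 13 (by norm_num) (by norm_num)
    (by intro k h1 h2; interval_cases k <;> norm_num [PlaneGraph.tour])
  have a1 := uim (-1) 3 5 (by norm_num) (by norm_num)
    (by intro k h1 h2; interval_cases k <;> norm_num [PlaneGraph.tour])
  have a2 := lim (-1) 3 5 (by norm_num) (by norm_num)
    (by intro k h1 h2; interval_cases k <;> norm_num [PlaneGraph.tour])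
  have c1 := ure (-1) 11 13 (by norm_num) (by norm_num)
    (by intro k h1 h2; interval_cases k <;> norm_num [PlaneGraph.tour])
  have c2 := lre (-1) 11 13 (by norm_num) (by norm_num)
    (by intro k h1 h2; interval_cases k <;> norm_num [PlaneGraph.tour])
  have w1 := uim 1 0 13 (by norm_num) (by norm_num)
    (by intro k h1 h2; interval_cases k <;> norm_num [PlaneGraph.tour])
  have w2 := lim (-2) 0 13 (by norm_num) (by norm_num)
    (by intro k h1 h2; interval_cases k <;> norm_num [PlaneGraph.tour])
  have w3 := ure 1 0 13 (by norm_num) (by norm_num)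
    (by intro k h1 h2; interval_cases k <;> norm_num [PlaneGraph.tour])
  have w4 := lre (-2) 0 13 (by norm_num) (by norm_num)
    (by intro k h1 h2; interval_cases k <;> norm_num [PlaneGraph.tour])
  have p3 := hpos 2 (by norm_num)
  have p5 := hpos 4 (by norm_num)
  have p11 := hpos 10 (by norm_num)
  have p13 := hpos 12 (by norm_num)
  norm_num [PlaneGraph.tour, abs_lt] at p3 p5 p11 p13
  have hdec : Γ.trail x (t 3) (t 13) ⊆ Γ.trail x (t 3) (t 6) ∪ Γ.trail x (t 6) (t 8) ∪
      Γ.trail x (t 8) (t 10) ∪ Γ.trail x (t 10) (t 13) := by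
    refine (trail_subset_union (hle 3 10 (by norm_num)) (hle 10 13 (by norm_num))).trans
      (union_subset_union_left _ ?_)
    refine (trail_subset_union (hle 3 8 (by norm_num)) (hle 8 10 (by norm_num))).trans
      (union_subset_union_left _ ?_)
    exact trail_subset_union (hle 3 6 (by norm_num)) (hle 6 8 (by norm_num))
  obtain ⟨a, ha⟩ := exists_path_trail (x := x) (hle 3 5 (by norm_num))
  obtain ⟨b, hb⟩ := exists_path_trail (x := x) (hle 11 13 (by norm_num))
  -- The square of side `ρ` about the lattice point `(-1, -1)`: steps 3 to 5 run along its row,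
  -- steps 11 to 13 down its column. The second curve is reversed to go upwards.
  obtain ⟨p, hpa, hpb⟩ := crossing_paths_meet a b.symm (x₀ := v.re - 5 / 2 * ρ)
    (x₁ := v.re - 3 / 2 * ρ) (y₀ := v.im - 5 / 2 * ρ) (y₁ := v.im - 3 / 2 * ρ)
    (fun z hz => by
      have h1 := a1 (ha hz)
      have h2 := a2 (ha hz)
      simp only [mem_ofPred_eq] at h1 h2
      constructor <;> linarith)
    (fun z hz => by
      rw [Path.symm_range] at hz
      have h1 := c1 (hb hz)
      have h2 := c2 (hb hz)
      simp only [mem_ofPred_eq] at h1 h2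
      constructor <;> linarith)
    (by linarith) (by linarith) (by linarith) (by linarith)
  rw [Path.symm_range] at hpb
  have sub36 : Γ.trail x (t 3) (t 6) ⊆ Γ.trail x (t 3) (t 13) :=
    trail_subset subset_rfl le_rfl (hle 3 6 (by norm_num)) (hle 6 13 (by norm_num))
  have sub68 : Γ.trail x (t 6) (t 8) ⊆ Γ.trail x (t 3) (t 13) :=
    trail_subset subset_rfl (hle 3 6 (by norm_num)) (hle 6 8 (by norm_num)) (hle 8 13 (by norm_num))
  have sub8 : Γ.trail x (t 8) (t 10) ⊆ Γ.trail x (t 3) (t 13) :=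
    trail_subset subset_rfl (hle 3 8 (by norm_num)) (hle 8 10 (by norm_num))
      (hle 10 13 (by norm_num))
  have sub10 : Γ.trail x (t 10) (t 13) ⊆ Γ.trail x (t 3) (t 13) :=
    trail_subset subset_rfl (hle 3 10 (by norm_num)) (hle 10 13 (by norm_num)) le_rfl
  have hp3 : p ∈ Γ.trail x (t 3) (t 6) :=
    trail_subset subset_rfl le_rfl (hle 3 5 (by norm_num)) (hle 5 6 (by norm_num)) (ha hpa)
  have hp10 : p ∈ Γ.trail x (t 10) (t 13) :=
    trail_subset subset_rfl (hle 10 11 (by norm_num)) (hle 11 13 (by norm_num)) le_rfl (hb hpb)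
  refine ⟨t 3, t 13, p, hle 3 13 (by norm_num), ?_, sub36 hp3, ?_, ?_⟩
  · intro i j hij hj
    refine trail_subset (m := t 0) (n := t 13) ?_ (by omega) hij hj
    intro w hw
    have h1 := w1 hw
    have h2 := w2 hw
    have h3 := w3 hw
    have h4 := w4 hw
    simp only [mem_ofPred_eq] at h1 h2 h3 h4
    -- Both coordinates differ by at most `9 / 2 * ρ`, and `2 * (9 / 2) ^ 2 < 7 ^ 2`.
    rw [mem_ball_iff_norm]
    refine lt_of_pow_lt_pow_left₀ 2 (by positivity) ?_
    rw [Complex.sq_norm, Complex.normSq_apply, Complex.sub_re, Complex.sub_im]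
    have e1 : (w.re - v.re) * (w.re - v.re) ≤ (9 / 2 * ρ) ^ 2 := by
      rw [← sq]; exact sq_le_sq' (by linarith) (by linarith)
    have e2 : (w.im - v.im) * (w.im - v.im) ≤ (9 / 2 * ρ) ^ 2 := by
      rw [← sq]; exact sq_le_sq' (by linarith) (by linarith)
    nlinarith
  · intro w hw
    rcases hdec hw with ((h | h) | h) | h
    · have := bot h
      simp only [mem_ofPred_eq] at this
      exact Or.inr (le_abs.2 (Or.inr (by linarith)))
    · have := rig h
      simp only [mem_ofPred_eq] at this
      exact Or.inl (le_abs.2 (Or.inl (by linarith)))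
    · have := top h
      simp only [mem_ofPred_eq] at this
      exact Or.inr (le_abs.2 (Or.inl (by linarith)))
    · have := lef h
      simp only [mem_ofPred_eq] at this
      exact Or.inl (le_abs.2 (Or.inr (by linarith)))
  · rintro u hu1 hu2 ⟨l, hl, hlu⟩
    rw [abs_le] at hu1 hu2
    have hsub := union_subset (union_subset (union_subset sub36 sub68) sub8) sub10
    refine no_log_around (isPreconnected_trail (hle 3 6 (by norm_num)))
      (isPreconnected_trail (hle 6 8 (by norm_num))) (isPreconnected_trail (hle 8 10 (by norm_num)))
      (isPreconnected_trail (hle 10 13 (by norm_num))) (hl.mono hsub) (g := fun w => w - u)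
      (by fun_prop) (fun w hw => hlu w (hsub hw)) ?_ ?_ ?_ ?_ (p := p) (q₁ := x (t 6))
      (q₂ := x (t 8)) (q₃ := x (t 10)) ⟨hp3, hp10⟩
      ⟨vertex_mem_trail (hle 3 6 (by norm_num)) le_rfl,
        vertex_mem_trail le_rfl (hle 6 8 (by norm_num))⟩
      ⟨vertex_mem_trail (hle 6 8 (by norm_num)) le_rfl,
        vertex_mem_trail le_rfl (hle 8 10 (by norm_num))⟩
      ⟨vertex_mem_trail (hle 8 10 (by norm_num)) le_rfl,
        vertex_mem_trail le_rfl (hle 10 13 (by norm_num))⟩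
    · intro w hw
      have := bot hw
      simp only [mem_ofPred_eq] at this
      simp only [Complex.sub_im]; linarith
    · intro w hw
      have := rig hw
      simp only [mem_ofPred_eq] at this
      simp only [Complex.sub_re]; linarith
    · intro w hw
      have := top hw
      simp only [mem_ofPred_eq] at this
      simp only [Complex.sub_im]; linarith
    · intro w hw
      have := lef hw
      simp only [mem_ofPred_eq] at this
      simp only [Complex.sub_re]; linarith

/-- A tour around `v` meets every path of the graph which starts near `v` and leaves `D`, or
leaves `D` itself. -/
theorem Follows.meets {v : ℂ} {ρ : ℝ} (hρ : 0 < ρ) (h : Follows ρ (tourAt v ρ) 13 x)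
    (hx : ∀ i, Γ.weight (x i) (x (i + 1)) ≠ 0) :
    ∃ N, (∀ i j, i ≤ j → j ≤ N → Γ.trail x i j ⊆ Metric.ball v (7 * ρ)) ∧
      ∀ (D : Set ℂ) (_ : ∀ s ∉ D, HasLog D s) (S : Set Γ.verts) (u : Γ.verts), Γ.Exits D S u →
        |(u : ℂ).re - v.re| ≤ ρ → |(u : ℂ).im - v.im| ≤ ρ →
        (∃ i ≤ N, x i ∈ S ∧ (x i : ℂ) ≠ v) ∨
          ∃ i < N, ¬ range (Γ.edge (x i) (x (i + 1))) ⊆ D := by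
  obtain ⟨m, n, p, hmn, h1, hp, h2, h3⟩ := h.tour hρ
  refine ⟨n, h1, fun D hD S u hu hu1 hu2 => ?_⟩
  by_contra hcon
  push Not at hcon
  obtain ⟨hc1, hc2⟩ := hcon
  have hne : ∀ w ∈ Γ.trail x m n, w ≠ v := by
    rintro w hw rfl
    have := h2 w hw
    simp only [sub_self, abs_zero] at this
    rcases this with h | h <;> linarith
  -- One step is needed to know that `x m` is in `D`; a trajectory reduced to a point has a
  -- logarithm anyway.
  by_cases hlt : m < n
  · refine h3 u hu1 hu2 (hu.hasLog_trail hD hx hmn (fun i hi1 hi2 hi => ?_) ?_)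
    · exact hne _ (vertex_mem_trail hi1 hi2) (hc1 i hi2 hi)
    · refine insert_subset ?_ (iUnion₂_subset fun i hi => hc2 i hi.2)
      exact hc2 m hlt (edge_zero_mem _ _)
  · obtain rfl : m = n := by omega
    refine h3 u hu1 hu2 ?_
    rw [trail_self]
    refine ⟨fun w => Complex.log (w - u), by simp, fun w hw => ?_⟩
    rw [Complex.exp_log]
    intro h0
    rw [mem_singleton_iff] at hw
    subst hw
    have h4 := h2 _ (vertex_mem_trail (x := x) (le_refl m) le_rfl)
    rw [sub_eq_zero] at h0
    rw [h0] at h4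
    rcases h4 with h | h <;> linarith

end PlaneGraph

end

noncomputable section

/-! ### The Markov property -/

/-- Only the fibres have to be measurable: apply additivity to the restriction of `μ` to the
arbitrary set `A`. -/
theorem measure_eq_tsum_fiber {α β : Type*} [MeasurableSpace α] [MeasurableSpace β] [Countable β]
    [MeasurableSingletonClass β] (μ : Measure α) {f : α → β} (hf : Measurable f) (A : Set α) :
    μ A = ∑' b, μ (A ∩ f ⁻¹' {b}) := by
  have h : (μ.restrict A) univ = ∑' b, (μ.restrict A) (f ⁻¹' {b}) := by
    rw [← measure_iUnion]
    · congr 1; ext x; simp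
    · intro a b hab
      exact Disjoint.preimage _ (by simpa using hab)
    · exact fun b => hf (measurableSet_singleton b)
  rw [Measure.restrict_apply_univ] at h
  rw [h]
  refine tsum_congr fun b => ?_
  rw [Measure.restrict_apply (hf (measurableSet_singleton b)), inter_comm]

section Sequences

variable {V : Type*}

/-- The sequences that agree with `w` up to time `n`. -/
def cyl (n : ℕ) (w : ℕ → V) : Set (ℕ → V) := {x | ∀ i ≤ n, x i = w i}

/-- The sequence after time `n`. -/
def shiftSeq (n : ℕ) (x : ℕ → V) : ℕ → V := fun i => x (n + i)

/-- A property of sequences that depends on the terms up to `n` only. -/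
def DependsUpTo (n : ℕ) (φ : (ℕ → V) → Prop) : Prop :=
  ∀ ⦃x y⦄, (∀ i ≤ n, x i = y i) → φ x → φ y

theorem DependsUpTo.iff {n : ℕ} {φ : (ℕ → V) → Prop} (h : DependsUpTo n φ) {x y : ℕ → V}
    (hxy : ∀ i ≤ n, x i = y i) : φ x ↔ φ y :=
  ⟨h hxy, h fun i hi => (hxy i hi).symm⟩

theorem measurable_shiftSeq [MeasurableSpace V] (n : ℕ) : Measurable (shiftSeq (V := V) n) := by
  unfold shiftSeq; fun_prop

variable [Countable V] [MeasurableSpace V] [DiscreteMeasurableSpace V]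

theorem DependsUpTo.measurableSet {n : ℕ} {φ : (ℕ → V) → Prop} (h : DependsUpTo n φ) :
    MeasurableSet {x | φ x} := by
  have hf : Measurable fun (x : ℕ → V) (i : Fin (n + 1)) => x i := by fun_prop
  have : {x | φ x} = (fun (x : ℕ → V) (i : Fin (n + 1)) => x i) ⁻¹'
      ((fun (x : ℕ → V) (i : Fin (n + 1)) => x i) '' {x | φ x}) := by
    refine subset_antisymm (subset_preimage_image _ _) ?_
    rintro x ⟨y, hy, hxy⟩
    exact h (fun i hi => congrFun hxy ⟨i, Nat.lt_succ_of_le hi⟩) hy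
  rw [this]
  exact hf (Set.to_countable _).measurableSet

theorem measurableSet_cyl (n : ℕ) (w : ℕ → V) : MeasurableSet (cyl n w) :=
  DependsUpTo.measurableSet (n := n) (φ := fun x => ∀ i ≤ n, x i = w i)
    fun _ _ h hx i hi => (h i hi).symm.trans (hx i hi)

/-- Cylinders are the singletons of the countable spaces of initial segments, and the laws of these
segments determine the law of the sequence. -/
theorem measure_ext_cyl {μ ν : Measure (ℕ → V)} [IsFiniteMeasure μ]
    (h : ∀ n w, μ (cyl n w) = ν (cyl n w)) : μ = ν := by
  have key : ∀ n, μ.map (Preorder.frestrictLe (π := fun _ => V) n) =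
      ν.map (Preorder.frestrictLe (π := fun _ => V) n) := by
    intro n
    refine Measure.ext_of_singleton fun y => ?_
    rw [Measure.map_apply (by fun_prop) (measurableSet_singleton _),
      Measure.map_apply (by fun_prop) (measurableSet_singleton _)]
    have : Preorder.frestrictLe (π := fun _ => V) n ⁻¹' {y} =
        cyl n fun i => y ⟨min i n, by simp⟩ := by
      ext x
      simp only [mem_preimage, mem_singleton_iff, cyl, mem_ofPred_eq]
      constructor
      · rintro rfl i hi
        simp [Preorder.frestrictLe, min_eq_left hi]
      · intro hx
        ext ⟨i, hi⟩
        have hi' := Finset.mem_Iic.1 hi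
        have := hx i hi'
        simp only [min_eq_left hi'] at this
        exact this
    rw [this, h]
  have hp : IsProjectiveLimit μ fun J : Finset ℕ => μ.map J.restrict := fun _ => rfl
  refine hp.unique ?_
  refine (isProjectiveLimit_nat_iff (X := fun _ => V) (fun I J hIJ => ?_) ν).2 fun n => ?_
  · rw [Measure.map_map (by fun_prop) (by fun_prop)]
    rfl
  · exact (key n).symm

end Sequences

namespace PlaneGraph

variable (Γ : PlaneGraph)

instance : DiscreteMeasurableSpace Γ.verts where
  forall_measurableSet s := (Set.to_countable s).measurableSet

theorem walkLaw_cyl_zero (v : Γ.verts) (w : ℕ → Γ.verts) :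
    Γ.walkLaw v (cyl 0 w) = if w 0 = v then 1 else 0 := by
  have h : Measurable fun x : ℕ → Γ.verts => x 0 := measurable_pi_apply 0
  have hm : (Γ.walkLaw v).map (fun x => x 0) = Measure.dirac v := by
    have h2 : (fun x : ℕ → Γ.verts => x 0) = (fun y : (Finset.Iic 0 → Γ.verts) => y ⟨0, by simp⟩) ∘
        Preorder.frestrictLe (π := fun _ => Γ.verts) 0 := rfl
    rw [h2, ← Measure.map_map (by fun_prop) (by fun_prop), walkLaw, Kernel.trajMeasure,
      Measure.map_comp _ _ (by fun_prop), Kernel.traj_map_frestrictLe, Kernel.partialTraj_self,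
      Measure.id_comp, Measure.map_map (by fun_prop) (by fun_prop)]
    exact Measure.map_id
  have : cyl 0 w = (fun x : ℕ → Γ.verts => x 0) ⁻¹' {w 0} := by
    ext x; simp [cyl]
  rw [this, ← Measure.map_apply h (measurableSet_singleton _), hm,
    Measure.dirac_apply' _ (measurableSet_singleton _)]
  simp [indicator, eq_comm]

theorem walkLaw_cyl_succ (v : Γ.verts) (n : ℕ) (w : ℕ → Γ.verts) :
    Γ.walkLaw v (cyl (n + 1) w) = Γ.walkLaw v (cyl n w) * Γ.jump (w n) (w (n + 1)) := by
  let κ : (n : ℕ) → Kernel ((i : Finset.Iic n) → Γ.verts) Γ.verts := fun n =>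
    Γ.stepKernel.comap (fun x : ((i : Finset.Iic n) → Γ.verts) => x ⟨n, by simp⟩)
      (measurable_pi_apply _)
  have h := Kernel.map_frestrictLe_trajMeasure_compProd_eq_map_trajMeasure
    (X := fun _ => Γ.verts) (μ₀ := Measure.dirac v) (κ := κ) (a := n)
  have hw : Kernel.trajMeasure (X := fun _ => Γ.verts) (Measure.dirac v) κ = Γ.walkLaw v := rfl
  rw [hw] at h
  set y : (Finset.Iic n → Γ.verts) := fun i => w i with hy
  have h1 : ((Γ.walkLaw v).map (Preorder.frestrictLe (π := fun _ => Γ.verts) n) ⊗ₘ κ n)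
      ({y} ×ˢ {w (n + 1)}) = Γ.walkLaw v (cyl n w) * Γ.jump (w n) (w (n + 1)) := by
    rw [Measure.compProd_apply_prod (measurableSet_singleton _) (measurableSet_singleton _),
      lintegral_singleton, Measure.map_apply (by fun_prop) (measurableSet_singleton _), mul_comm]
    congr 1
    · congr 1
      ext x
      simp only [mem_preimage, mem_singleton_iff, cyl, mem_ofPred_eq, funext_iff, hy]
      exact ⟨fun h i hi => h ⟨i, Finset.mem_Iic.2 hi⟩, fun h i => h i (Finset.mem_Iic.1 i.2)⟩
    · exact PMF.toMeasure_apply_singleton _ _ (measurableSet_singleton _)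
  rw [← h1, h, Measure.map_apply (by fun_prop)
    ((measurableSet_singleton _).prod (measurableSet_singleton _))]
  congr 1
  ext x
  simp only [mem_preimage, mem_prod, mem_singleton_iff, cyl, mem_ofPred_eq, funext_iff, hy]
  constructor
  · exact fun h => ⟨fun i => h i ((Finset.mem_Iic.1 i.2).trans (Nat.le_succ n)), h _ le_rfl⟩
  · rintro ⟨h1, h2⟩ i hi
    rcases Nat.le_succ_iff.1 hi with hi | rfl
    · exact h1 ⟨i, Finset.mem_Iic.2 hi⟩
    · exact h2

theorem walkLaw_cyl (v : Γ.verts) (n : ℕ) (w : ℕ → Γ.verts) :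
    Γ.walkLaw v (cyl n w) =
      (if w 0 = v then 1 else 0) * ∏ i ∈ Finset.range n, Γ.jump (w i) (w (i + 1)) := by
  induction n with
  | zero => simp [walkLaw_cyl_zero]
  | succ n ih => rw [walkLaw_cyl_succ, ih, Finset.prod_range_succ, mul_assoc]

/-- The Markov property: after a given initial segment, the walk starts afresh. -/
theorem walkLaw_markov (v : Γ.verts) (n : ℕ) (w : ℕ → Γ.verts) {E : Set (ℕ → Γ.verts)}
    (hE : MeasurableSet E) :
    Γ.walkLaw v (cyl n w ∩ shiftSeq n ⁻¹' E) =
      Γ.walkLaw v (cyl n w) * Γ.walkLaw (w n) E := by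
  have hms := measurable_shiftSeq (V := Γ.verts) n
  suffices h : ((Γ.walkLaw v).restrict (cyl n w)).map (shiftSeq n) =
      Γ.walkLaw v (cyl n w) • Γ.walkLaw (w n) by
    have := congrArg (fun μ => μ E) h
    simpa [Measure.map_apply hms hE, Measure.restrict_apply (hms hE), inter_comm] using this
  refine measure_ext_cyl fun m y => ?_
  rw [Measure.map_apply hms (measurableSet_cyl _ _),
    Measure.restrict_apply (hms (measurableSet_cyl _ _)), Measure.smul_apply, smul_eq_mul]
  by_cases h0 : y 0 = w n
  -- Glue `w` and `y`, which agree at time `n`; the weight of the glued cylinder factorizes.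
  · set z : ℕ → Γ.verts := fun i => if i ≤ n then w i else y (i - n) with hz
    have hz1 : ∀ i ≤ n, z i = w i := fun i hi => by simp [hz, hi]
    have hz2 : ∀ i, z (n + i) = y i := fun i => by
      rcases Nat.eq_zero_or_pos i with rfl | hi
      · simp [hz, h0]
      · simp [hz, show ¬ n + i ≤ n by omega]
    have hc : shiftSeq n ⁻¹' cyl m y ∩ cyl n w = cyl (n + m) z := by
      ext x
      simp only [mem_inter_iff, mem_preimage, cyl, shiftSeq, mem_ofPred_eq]
      constructor
      · rintro ⟨h1, h2⟩ i hi
        rcases le_or_gt i n with h | h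
        · rw [h2 i h, hz1 i h]
        · obtain ⟨k, rfl⟩ := Nat.exists_eq_add_of_lt h
          rw [add_assoc, h1 (k + 1) (by omega), hz2]
      · intro h
        exact ⟨fun i hi => by rw [h _ (by omega), hz2],
          fun i hi => by rw [h i (by omega), hz1 i hi]⟩
    rw [hc, walkLaw_cyl, walkLaw_cyl, walkLaw_cyl, Finset.prod_range_add, hz1 0 (by simp), mul_assoc]
    rw [if_pos h0, one_mul]
    congr 2
    · refine Finset.prod_congr rfl fun i hi => ?_
      rw [Finset.mem_range] at hi
      rw [hz1 i hi.le, hz1 (i + 1) hi]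
    · refine Finset.prod_congr rfl fun i hi => ?_
      rw [hz2, add_assoc, hz2]
  · have hc : shiftSeq n ⁻¹' cyl m y ∩ cyl n w = ∅ := by
      ext x
      simp only [mem_inter_iff, mem_preimage, cyl, shiftSeq, mem_ofPred_eq, mem_empty_iff_false,
        iff_false, not_and]
      intro h1 h2
      exact h0 (by rw [← h1 0 (by simp), ← h2 n le_rfl]; rfl)
    rw [hc, measure_empty, Γ.walkLaw_cyl (w n) m y, if_neg h0, zero_mul, mul_zero]

theorem walkLaw_start (v : Γ.verts) : ∀ᵐ x ∂Γ.walkLaw v, x 0 = v := by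
  have h := Γ.walkLaw_cyl_zero v fun _ => v
  rw [if_pos rfl] at h
  have h2 := (prob_compl_eq_zero_iff (measurableSet_cyl 0 fun _ => v)).2 h
  refine measure_mono_null (fun x hx => ?_) h2
  simpa [cyl] using hx

theorem walkLaw_first_step (v : Γ.verts) {E : Set (ℕ → Γ.verts)} (hE : MeasurableSet E) :
    Γ.walkLaw v (shiftSeq 1 ⁻¹' E) = ∑' u, Γ.jump v u * Γ.walkLaw u E := by
  have hf : Measurable fun x : ℕ → Γ.verts => x 1 := measurable_pi_apply 1
  rw [measure_eq_tsum_fiber _ hf]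
  refine tsum_congr fun u => ?_
  set w : ℕ → Γ.verts := fun i => if i = 0 then v else u with hw
  have h1 : Γ.walkLaw v (shiftSeq 1 ⁻¹' E ∩ (fun x => x 1) ⁻¹' {u}) =
      Γ.walkLaw v (cyl 1 w ∩ shiftSeq 1 ⁻¹' E) := by
    refine measure_congr ?_
    filter_upwards [Γ.walkLaw_start v] with x hx
    refine propext ⟨fun h => ⟨fun i hi => ?_, h.1⟩, fun h => ⟨h.2, ?_⟩⟩
    · rcases Nat.le_one_iff_eq_zero_or_eq_one.1 hi with rfl | rfl
      · simpa [hw] using hx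
      · simpa [hw] using h.2
    · simpa [hw] using h.1 1 le_rfl
  rw [h1, walkLaw_markov _ _ _ _ hE, walkLaw_cyl]
  simp [hw]

/-- A given initial segment decides `φ`: either it satisfies `φ` and `walkLaw_markov` applies, or
both events are empty. Summing over the segments yields the Markov property as an upper and as a
lower bound. -/
theorem walkLaw_fiber (v : Γ.verts) (n : ℕ) {φ : (ℕ → Γ.verts) → Prop} (hφ : DependsUpTo n φ)
    {E : Γ.verts → Set (ℕ → Γ.verts)} (hE : ∀ u, MeasurableSet (E u)) (y : Fin (n + 1) → Γ.verts) :
    (∃ x₀, φ x₀ ∧ Γ.walkLaw v ({x | φ x ∧ shiftSeq n x ∈ E (x n)} ∩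
          (fun (x : ℕ → Γ.verts) (i : Fin (n + 1)) => x i) ⁻¹' {y}) =
        Γ.walkLaw v ({x | φ x} ∩ (fun (x : ℕ → Γ.verts) (i : Fin (n + 1)) => x i) ⁻¹' {y}) *
          Γ.walkLaw (x₀ n) (E (x₀ n))) ∨
      Γ.walkLaw v ({x | φ x ∧ shiftSeq n x ∈ E (x n)} ∩
          (fun (x : ℕ → Γ.verts) (i : Fin (n + 1)) => x i) ⁻¹' {y}) = 0 ∧
        Γ.walkLaw v ({x | φ x} ∩ (fun (x : ℕ → Γ.verts) (i : Fin (n + 1)) => x i) ⁻¹' {y}) = 0 := by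
  have hy : ∀ x x' : ℕ → Γ.verts, (fun i : Fin (n + 1) => x i) = y →
      (fun i : Fin (n + 1) => x' i) = y → ∀ i ≤ n, x i = x' i := fun x x' h h' i hi =>
    congrFun (h.trans h'.symm) ⟨i, Nat.lt_succ_of_le hi⟩
  by_cases h : ∃ x₀, φ x₀ ∧ (fun i : Fin (n + 1) => x₀ i) = y
  · obtain ⟨x₀, h0, h1⟩ := h
    refine Or.inl ⟨x₀, h0, ?_⟩
    have e1 : {x | φ x} ∩ (fun (x : ℕ → Γ.verts) (i : Fin (n + 1)) => x i) ⁻¹' {y} = cyl n x₀ := by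
      ext x
      refine ⟨fun h => hy x x₀ h.2 h1, fun h => ⟨(hφ.iff h).2 h0, ?_⟩⟩
      rw [mem_preimage, mem_singleton_iff, ← h1]
      exact funext fun i => h i (Nat.le_of_lt_succ i.2)
    have e2 : {x | φ x ∧ shiftSeq n x ∈ E (x n)} ∩
        (fun (x : ℕ → Γ.verts) (i : Fin (n + 1)) => x i) ⁻¹' {y} =
        cyl n x₀ ∩ shiftSeq n ⁻¹' E (x₀ n) := by
      rw [← e1]
      ext x
      constructor
      · rintro ⟨⟨h2, h3⟩, h4⟩
        refine ⟨⟨h2, h4⟩, ?_⟩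
        rw [mem_preimage, ← hy x x₀ h4 h1 n le_rfl]
        exact h3
      · rintro ⟨⟨h2, h4⟩, h3⟩
        rw [mem_preimage, ← hy x x₀ h4 h1 n le_rfl] at h3
        exact ⟨⟨h2, h3⟩, h4⟩
    rw [e1, e2, walkLaw_markov _ _ _ _ (hE _)]
  · push Not at h
    have e : {x | φ x} ∩ (fun (x : ℕ → Γ.verts) (i : Fin (n + 1)) => x i) ⁻¹' {y} = ∅ := by
      ext x
      simp only [mem_inter_iff, mem_ofPred_eq, mem_preimage, mem_singleton_iff,
        mem_empty_iff_false, iff_false, not_and]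
      exact fun hx => h x hx
    refine Or.inr ⟨measure_mono_null ?_ (measure_empty (μ := Γ.walkLaw v)), by rw [e, measure_empty]⟩
    rw [← e]
    exact inter_subset_inter_left _ fun x hx => hx.1

theorem walkLaw_markovAt_le (v : Γ.verts) (n : ℕ) {φ : (ℕ → Γ.verts) → Prop} (hφ : DependsUpTo n φ)
    {E : Γ.verts → Set (ℕ → Γ.verts)} (hE : ∀ u, MeasurableSet (E u)) {c : ℝ≥0∞}
    (h : ∀ x, φ x → Γ.walkLaw (x n) (E (x n)) ≤ c) :
    Γ.walkLaw v {x | φ x ∧ shiftSeq n x ∈ E (x n)} ≤ Γ.walkLaw v {x | φ x} * c := by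
  have hf : Measurable fun (x : ℕ → Γ.verts) (i : Fin (n + 1)) => x i := by fun_prop
  rw [measure_eq_tsum_fiber (Γ.walkLaw v) hf, measure_eq_tsum_fiber (Γ.walkLaw v) hf {x | φ x},
    ← ENNReal.tsum_mul_right]
  refine ENNReal.tsum_le_tsum fun y => ?_
  rcases Γ.walkLaw_fiber v n hφ hE y with ⟨x₀, h0, h1⟩ | ⟨h0, h1⟩
  · rw [h1]
    exact mul_le_mul' le_rfl (h x₀ h0)
  · rw [h0]; exact zero_le

theorem le_walkLaw_markovAt (v : Γ.verts) (n : ℕ) {φ : (ℕ → Γ.verts) → Prop} (hφ : DependsUpTo n φ)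
    {E : Γ.verts → Set (ℕ → Γ.verts)} (hE : ∀ u, MeasurableSet (E u)) {c : ℝ≥0∞}
    (h : ∀ x, φ x → c ≤ Γ.walkLaw (x n) (E (x n))) :
    Γ.walkLaw v {x | φ x} * c ≤ Γ.walkLaw v {x | φ x ∧ shiftSeq n x ∈ E (x n)} := by
  have hf : Measurable fun (x : ℕ → Γ.verts) (i : Fin (n + 1)) => x i := by fun_prop
  rw [measure_eq_tsum_fiber (Γ.walkLaw v) hf {x | φ x ∧ _},
    measure_eq_tsum_fiber (Γ.walkLaw v) hf {x | φ x}, ← ENNReal.tsum_mul_right]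
  refine ENNReal.tsum_le_tsum fun y => ?_
  rcases Γ.walkLaw_fiber v n hφ hE y with ⟨x₀, h0, h1⟩ | ⟨h0, h1⟩
  · rw [h1]
    exact mul_le_mul' le_rfl (h x₀ h0)
  · rw [h1, zero_mul]; exact zero_le

/-- `n` is the first time at which the property `φ` holds. -/
def FirstTime (φ : ℕ → (ℕ → Γ.verts) → Prop) (n : ℕ) (x : ℕ → Γ.verts) : Prop :=
  φ n x ∧ ∀ m < n, ¬ φ m x

variable {Γ}

theorem dependsUpTo_firstTime {φ : ℕ → (ℕ → Γ.verts) → Prop} (hφ : ∀ n, DependsUpTo n (φ n))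
    (n : ℕ) : DependsUpTo n (Γ.FirstTime φ n) := by
  rintro x y h ⟨h1, h2⟩
  refine ⟨hφ n h h1, fun m hm h3 => h2 m hm ?_⟩
  exact hφ m (fun i hi => (h i (hi.trans hm.le)).symm) h3

theorem exists_firstTime {φ : ℕ → (ℕ → Γ.verts) → Prop} {x : ℕ → Γ.verts} (h : ∃ n, φ n x) :
    ∃ n, Γ.FirstTime φ n x := by
  classical
  exact ⟨Nat.find h, Nat.find_spec h, fun m hm => Nat.find_min h hm⟩

theorem measurableSet_exists {φ : ℕ → (ℕ → Γ.verts) → Prop} (hφ : ∀ n, DependsUpTo n (φ n)) :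
    MeasurableSet {x | ∃ n, φ n x} := by
  have : {x | ∃ n, φ n x} = ⋃ n, {x | φ n x} := by ext; simp
  rw [this]
  exact MeasurableSet.iUnion fun n => (hφ n).measurableSet

theorem measurableSet_markovAt {n : ℕ} {φ : (ℕ → Γ.verts) → Prop} (hφ : DependsUpTo n φ)
    {E : Γ.verts → Set (ℕ → Γ.verts)} (hE : ∀ u, MeasurableSet (E u)) :
    MeasurableSet {x | φ x ∧ shiftSeq n x ∈ E (x n)} := by
  have : {x | φ x ∧ shiftSeq n x ∈ E (x n)} =
      {x | φ x} ∩ ⋃ u, ((fun x : ℕ → Γ.verts => x n) ⁻¹' {u} ∩ shiftSeq n ⁻¹' E u) := by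
    ext x
    simp only [mem_ofPred_eq, mem_inter_iff, mem_iUnion, mem_preimage, mem_singleton_iff,
      exists_eq_left']
  rw [this]
  refine hφ.measurableSet.inter (MeasurableSet.iUnion fun u => ?_)
  exact (measurable_pi_apply n (measurableSet_singleton u)).inter (measurable_shiftSeq n (hE u))

theorem pairwise_firstTime (φ : ℕ → (ℕ → Γ.verts) → Prop) (A : ℕ → Set (ℕ → Γ.verts)) :
    Pairwise fun m n => Disjoint {x | Γ.FirstTime φ m x ∧ x ∈ A m}
      {x | Γ.FirstTime φ n x ∧ x ∈ A n} := by
  intro m n hmn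
  rw [disjoint_left]
  rintro x ⟨⟨h1, h2⟩, -⟩ ⟨⟨h3, h4⟩, -⟩
  rcases lt_or_gt_of_ne hmn with h | h
  · exact h4 m h h1
  · exact h2 n h h3

variable (Γ)

theorem walkLaw_exists_eq (v : Γ.verts) {φ : ℕ → (ℕ → Γ.verts) → Prop}
    (hφ : ∀ n, DependsUpTo n (φ n)) :
    Γ.walkLaw v {x | ∃ n, φ n x} = ∑' n, Γ.walkLaw v {x | Γ.FirstTime φ n x} := by
  rw [← measure_iUnion]
  · congr 1
    ext x
    simp only [mem_ofPred_eq, mem_iUnion]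
    exact ⟨exists_firstTime, fun ⟨n, h⟩ => ⟨n, h.1⟩⟩
  · simpa using! pairwise_firstTime φ fun _ => univ
  · exact fun n => (dependsUpTo_firstTime hφ n).measurableSet

/-- The strong Markov property, as an upper bound. -/
theorem walkLaw_firstTime_le (v : Γ.verts) {φ : ℕ → (ℕ → Γ.verts) → Prop}
    (hφ : ∀ n, DependsUpTo n (φ n)) {E : Γ.verts → Set (ℕ → Γ.verts)}
    (hE : ∀ u, MeasurableSet (E u)) {c : ℝ≥0∞}
    (h : ∀ n x, φ n x → Γ.walkLaw (x n) (E (x n)) ≤ c) :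
    Γ.walkLaw v {x | ∃ n, Γ.FirstTime φ n x ∧ shiftSeq n x ∈ E (x n)} ≤
      Γ.walkLaw v {x | ∃ n, φ n x} * c := by
  rw [walkLaw_exists_eq _ _ hφ, ← ENNReal.tsum_mul_right]
  have : {x | ∃ n, Γ.FirstTime φ n x ∧ shiftSeq n x ∈ E (x n)} =
      ⋃ n, {x | Γ.FirstTime φ n x ∧ shiftSeq n x ∈ E (x n)} := by ext; simp
  rw [this]
  refine (measure_iUnion_le _).trans (ENNReal.tsum_le_tsum fun n => ?_)
  exact Γ.walkLaw_markovAt_le v n (dependsUpTo_firstTime hφ n) hE fun x hx => h n x hx.1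

/-- The strong Markov property, as a lower bound. -/
theorem le_walkLaw_firstTime (v : Γ.verts) {φ : ℕ → (ℕ → Γ.verts) → Prop}
    (hφ : ∀ n, DependsUpTo n (φ n)) {E : Γ.verts → Set (ℕ → Γ.verts)}
    (hE : ∀ u, MeasurableSet (E u)) {c : ℝ≥0∞}
    (h : ∀ n x, φ n x → c ≤ Γ.walkLaw (x n) (E (x n))) :
    Γ.walkLaw v {x | ∃ n, φ n x} * c ≤
      Γ.walkLaw v {x | ∃ n, Γ.FirstTime φ n x ∧ shiftSeq n x ∈ E (x n)} := by
  rw [walkLaw_exists_eq _ _ hφ, ← ENNReal.tsum_mul_right]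
  have : {x | ∃ n, Γ.FirstTime φ n x ∧ shiftSeq n x ∈ E (x n)} =
      ⋃ n, {x | Γ.FirstTime φ n x ∧ shiftSeq n x ∈ E (x n)} := by ext; simp
  rw [this, measure_iUnion]
  · refine ENNReal.tsum_le_tsum fun n => ?_
    exact Γ.le_walkLaw_markovAt v n (dependsUpTo_firstTime hφ n) hE fun x hx => h n x hx.1
  · exact pairwise_firstTime φ fun n => {x | shiftSeq n x ∈ E (x n)}
  · exact fun n => measurableSet_markovAt (dependsUpTo_firstTime hφ n) hE

theorem jump_apply (u w : Γ.verts) : Γ.jump u w = Γ.weight u w * (Γ.rate u)⁻¹ :=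
  PMF.normalize_apply (Γ.rate_ne_zero u) (Γ.rate_ne_top u) w

theorem jump_ne_zero {u w : Γ.verts} : Γ.jump u w ≠ 0 ↔ Γ.weight u w ≠ 0 := by
  rw [jump_apply]
  simp [Γ.rate_ne_top u]

/-- Almost surely, all the steps of the walk follow edges. -/
theorem walkLaw_edges (v : Γ.verts) :
    ∀ᵐ x ∂Γ.walkLaw v, ∀ n, Γ.weight (x n) (x (n + 1)) ≠ 0 := by
  rw [ae_all_iff]
  intro n
  have h1 : ∀ u : Γ.verts, MeasurableSet {x : ℕ → Γ.verts | Γ.weight (x 0) (x 1) = 0} := fun u =>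
    DependsUpTo.measurableSet (n := 1) fun x y h hx => by
      rw [← h 0 (by simp), ← h 1 le_rfl]; exact hx
  have h2 := Γ.walkLaw_markovAt_le v n (φ := fun _ => True) (by intro _ _ _ _; trivial)
    (E := fun _ => {x : ℕ → Γ.verts | Γ.weight (x 0) (x 1) = 0}) h1 (c := 0) ?_
  · rw [mul_zero, nonpos_iff_eq_zero] at h2
    refine measure_mono_null (fun x hx => ?_) h2
    simpa [shiftSeq] using hx
  · intro x _
    set u := x n
    rw [nonpos_iff_eq_zero]
    have h3 : MeasurableSet {y : ℕ → Γ.verts | Γ.weight u (y 0) = 0} :=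
      DependsUpTo.measurableSet (n := 0) fun x y h hx => by rw [← h 0 le_rfl]; exact hx
    have h4 := Γ.walkLaw_first_step u h3
    have h5 : ∑' w, Γ.jump u w * Γ.walkLaw w {y : ℕ → Γ.verts | Γ.weight u (y 0) = 0} = 0 := by
      refine ENNReal.tsum_eq_zero.2 fun w => ?_
      by_cases hw : Γ.weight u w = 0
      · rw [jump_apply]
        simp [hw]
      · have : Γ.walkLaw w {y : ℕ → Γ.verts | Γ.weight u (y 0) = 0} = 0 := by
          refine measure_mono_null (fun y hy => ?_) (Γ.walkLaw_start w)
          rintro (h : y 0 = w)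
          simp only [mem_ofPred_eq] at hy
          rw [h] at hy
          exact hw hy
        rw [this, mul_zero]
    rw [h5] at h4
    have h6 : Γ.walkLaw u {x : ℕ → Γ.verts | ¬ x 0 = u} = 0 := Γ.walkLaw_start u
    refine measure_mono_null (fun y hy => ?_) (measure_union_null h4 h6)
    by_cases h0 : y 0 = u
    · left
      simp only [mem_ofPred_eq, mem_preimage, shiftSeq] at hy ⊢
      rw [h0] at hy
      exact hy
    · exact Or.inr h0

end PlaneGraph

end

noncomputable section

theorem hasLog_ball {z s : ℂ} {r : ℝ} (hs : s ∉ Metric.ball z r) : HasLog (Metric.ball z r) s := by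
  rcases le_or_gt r 0 with h | h
  · rw [Metric.ball_eq_empty.2 h]
    exact ⟨0, by simp, by simp⟩
  · have : ContractibleSpace (Metric.ball z r) :=
      (convex_ball z r).contractibleSpace ⟨z, Metric.mem_ball_self h⟩
    exact IsSimplyConnected.hasLog (inferInstance : SimplyConnectedSpace (Metric.ball z r))
      Metric.isOpen_ball hs

namespace PlaneGraph

variable (Γ : PlaneGraph)

/-! ### Crossings of rectangles at a given scale -/

/-- The four unit steps. -/
def UnitStep (d : ℂ) : Prop := d = 1 ∨ d = -1 ∨ d = Complex.I ∨ d = -Complex.I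

/-- At scale `ρ`, rectangles are crossed with probability at least `a`. -/
def Crosses (ρ : ℝ) (a : ℝ≥0∞) : Prop :=
  ∀ p d : ℂ, UnitStep d → ∀ v : Γ.verts, (v : ℂ) ∈ Metric.ball p (ρ / 4) →
    a ≤ Γ.walkLaw v {x | Γ.HitsBeforeExit x (Metric.ball (p + (2 * ρ : ℝ) * d) (ρ / 4))
      (hull ρ p (p + (2 * ρ : ℝ) * d))}

variable {Γ}

theorem HitsBeforeExit.mono {x : ℕ → Γ.verts} {B B' R R' : Set ℂ} (h : Γ.HitsBeforeExit x B R)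
    (hB : B ⊆ B') (hR : R ⊆ R') : Γ.HitsBeforeExit x B' R' := by
  obtain ⟨n, h1, h2, h3⟩ := h
  exact ⟨n, hB h1, fun i hi => hR (h2 i hi), fun i hi => (h3 i hi).trans hR⟩

theorem mem_place_ball {ρ : ℝ} (hρ : 0 < ρ) {z w c v : ℂ} {r : ℝ} (hc : (ρ : ℂ) * w + z = c) :
    v ∈ place ρ z (Metric.ball w r) ↔ v ∈ Metric.ball c (ρ * r) := by
  have h0 : (ρ : ℂ) ≠ 0 := by exact_mod_cast hρ.ne'
  subst hc
  constructor
  · rintro ⟨s, hs, rfl⟩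
    rw [mem_ball_iff_norm] at hs ⊢
    have : (fun s => (ρ : ℂ) * s + z) s - ((ρ : ℂ) * w + z) = ρ * (s - w) := by ring
    rw [this, norm_mul, Complex.norm_real, Real.norm_of_nonneg hρ.le]
    exact mul_lt_mul_of_pos_left hs hρ
  · intro hv
    refine ⟨(v - z) / ρ, ?_, by simp only; field_simp; ring⟩
    rw [mem_ball_iff_norm] at hv ⊢
    have : v - ((ρ : ℂ) * w + z) = ρ * ((v - z) / ρ - w) := by field_simp; ring
    rw [this, norm_mul, Complex.norm_real, Real.norm_of_nonneg hρ.le] at hv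
    exact lt_of_mul_lt_mul_left hv hρ.le

theorem place_rect_subset {ρ : ℝ} (hρ : 0 < ρ) {z p p' : ℂ} {a b : ℝ}
    (h1 : min p.re p'.re - ρ / 2 = z.re) (h2 : z.re + ρ * a = max p.re p'.re + ρ / 2)
    (h3 : min p.im p'.im - ρ / 2 = z.im) (h4 : z.im + ρ * b = max p.im p'.im + ρ / 2) :
    place ρ z (Icc 0 a ×ℂ Icc 0 b) ⊆ hull ρ p p' := by
  rintro _ ⟨s, hs, rfl⟩
  rw [Complex.mem_reProdIm] at hs
  obtain ⟨⟨s1, s2⟩, s3, s4⟩ := hs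
  have e1 : ((ρ : ℂ) * s + z).re = ρ * s.re + z.re := by simp
  have e2 : ((ρ : ℂ) * s + z).im = ρ * s.im + z.im := by simp
  simp only [hull, mem_ofPred_eq, e1, e2]
  have := mul_nonneg hρ.le s1
  have := mul_nonneg hρ.le s3
  have := mul_le_mul_of_nonneg_left s2 hρ.le
  have := mul_le_mul_of_nonneg_left s4 hρ.le
  refine ⟨?_, ?_, ?_, ?_⟩ <;> linarith

theorem crosses_step {δ δ₀ α₀ ρ : ℝ} (hδ : 0 < δ) (hρ : δ / δ₀ ≤ ρ) (hδ₀ : 0 < δ₀)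
    {S B R : Set ℂ} (h : Γ.CrossingFrom δ δ₀ α₀ S B R) {z : ℂ} {B' R' : Set ℂ} {v : Γ.verts}
    (hv : (v : ℂ) ∈ place ρ z S) (hB : place ρ z B ⊆ B') (hR : place ρ z R ⊆ R') :
    ENNReal.ofReal α₀ ≤ Γ.walkLaw v {x | Γ.HitsBeforeExit x B' R'} := by
  have hl : 1 / δ₀ ≤ ρ / δ := by
    rw [div_le_div_iff₀ hδ₀ hδ]
    rw [div_le_iff₀ hδ₀] at hρ
    linarith
  have e : ρ / δ * δ = ρ := div_mul_cancel₀ _ hδ.ne'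
  have := h z (ρ / δ) hl v (by rwa [e])
  rw [e] at this
  exact this.le.trans (measure_mono fun x hx => hx.mono hB hR)

/-- With `l = ρ / δ`, a suitable lower left corner `z` puts the two balls of each of the four
crossings at `p` and `p + 2ρd`, and `l ≥ 1 / δ₀` becomes `δ / δ₀ ≤ ρ`. -/
theorem UniformCrossing.crosses {δ δ₀ α₀ ρ : ℝ} (h : Γ.UniformCrossing δ δ₀ α₀) (hδ : 0 < δ)
    (hδ₀ : 0 < δ₀) (hρ : δ / δ₀ ≤ ρ) : Γ.Crosses ρ (ENNReal.ofReal α₀) := by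
  obtain ⟨h1, h2, h3, h4⟩ := h
  have hρ0 : 0 < ρ := (div_pos hδ hδ₀).trans_le hρ
  rintro p d hd v hv
  have q : ρ / 4 = ρ * (1 / 4) := by ring
  rw [q] at hv ⊢
  have m1 : p.re ≤ p.re + 2 * ρ := by linarith
  have m2 : p.re - 2 * ρ ≤ p.re := by linarith
  have m3 : p.im ≤ p.im + 2 * ρ := by linarith
  have m4 : p.im - 2 * ρ ≤ p.im := by linarith
  rcases hd with rfl | rfl | rfl | rfl
  · have r1 : (p + (2 * ρ : ℝ) * 1).re = p.re + 2 * ρ := by simp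
    have r2 : (p + (2 * ρ : ℝ) * 1).im = p.im := by simp
    refine crosses_step hδ hρ hδ₀ h1 (z := ⟨p.re - ρ / 2, p.im - ρ / 2⟩)
      ((mem_place_ball hρ0 ?_).2 hv) (fun w hw => (mem_place_ball hρ0 ?_).1 hw)
      (place_rect_subset hρ0 ?_ ?_ ?_ ?_)
    · apply Complex.ext <;> simp <;> ring
    · apply Complex.ext <;> simp <;> ring
    · rw [r1, min_eq_left m1]
    · rw [r1, max_eq_right m1]; ring
    · rw [r2, min_self]
    · rw [r2, max_self]; ring
  · have r1 : (p + (2 * ρ : ℝ) * (-1)).re = p.re - 2 * ρ := by simp; ring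
    have r2 : (p + (2 * ρ : ℝ) * (-1)).im = p.im := by simp
    refine crosses_step hδ hρ hδ₀ h2 (z := ⟨p.re - 5 * ρ / 2, p.im - ρ / 2⟩)
      ((mem_place_ball hρ0 ?_).2 hv) (fun w hw => (mem_place_ball hρ0 ?_).1 hw)
      (place_rect_subset hρ0 ?_ ?_ ?_ ?_)
    · apply Complex.ext <;> simp <;> ring
    · apply Complex.ext <;> simp <;> ring
    · rw [r1, min_eq_right m2]; ring
    · rw [r1, max_eq_left m2]; ring
    · rw [r2, min_self]
    · rw [r2, max_self]; ring
  · have r1 : (p + (2 * ρ : ℝ) * Complex.I).re = p.re := by simp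
    have r2 : (p + (2 * ρ : ℝ) * Complex.I).im = p.im + 2 * ρ := by simp
    refine crosses_step hδ hρ hδ₀ h3 (z := ⟨p.re - ρ / 2, p.im - ρ / 2⟩)
      ((mem_place_ball hρ0 ?_).2 hv) (fun w hw => (mem_place_ball hρ0 ?_).1 hw)
      (place_rect_subset hρ0 ?_ ?_ ?_ ?_)
    · apply Complex.ext <;> simp <;> ring
    · apply Complex.ext <;> simp <;> ring
    · rw [r1, min_self]
    · rw [r1, max_self]; ring
    · rw [r2, min_eq_left m3]
    · rw [r2, max_eq_right m3]; ring
  · have r1 : (p + (2 * ρ : ℝ) * (-Complex.I)).re = p.re := by simp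
    have r2 : (p + (2 * ρ : ℝ) * (-Complex.I)).im = p.im - 2 * ρ := by simp; ring
    refine crosses_step hδ hρ hδ₀ h4 (z := ⟨p.re - ρ / 2, p.im - 5 * ρ / 2⟩)
      ((mem_place_ball hρ0 ?_).2 hv) (fun w hw => (mem_place_ball hρ0 ?_).1 hw)
      (place_rect_subset hρ0 ?_ ?_ ?_ ?_)
    · apply Complex.ext <;> simp <;> ring
    · apply Complex.ext <;> simp <;> ring
    · rw [r1, min_self]
    · rw [r1, max_self]; ring
    · rw [r2, min_eq_right m4]; ring
    · rw [r2, max_eq_left m4]; ring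

/-! ### Following a sequence of rectangles -/

theorem trail_congr {x y : ℕ → Γ.verts} {m n : ℕ} (hmn : m ≤ n) (h : ∀ i ≤ n, x i = y i) :
    Γ.trail x m n = Γ.trail y m n := by
  unfold trail
  rw [h m hmn]
  congr 1
  refine iUnion₂_congr fun i hi => ?_
  rw [h i hi.2.le, h (i + 1) hi.2]

theorem trail_shift (x : ℕ → Γ.verts) (k m n : ℕ) :
    Γ.trail (shiftSeq k x) m n = Γ.trail x (k + m) (k + n) := by
  unfold trail shiftSeq
  congr 1
  ext z
  simp only [mem_iUnion, exists_prop, mem_Ico]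
  constructor
  · rintro ⟨i, ⟨h1, h2⟩, h3⟩
    exact ⟨k + i, ⟨by omega, by omega⟩, h3⟩
  · rintro ⟨i, ⟨h1, h2⟩, h3⟩
    obtain ⟨j, rfl⟩ := Nat.exists_eq_add_of_le (show k ≤ i by omega)
    exact ⟨j, ⟨by omega, by omega⟩, h3⟩

theorem measurableSet_follows (ρ : ℝ) (ps : ℕ → ℂ) (k : ℕ) :
    MeasurableSet {x : ℕ → Γ.verts | Follows ρ ps k x} := by
  -- Bounding the last time by `N` makes the property depend on finitely many terms.
  have : {x : ℕ → Γ.verts | Follows ρ ps k x} = {x | ∃ N, ∃ t : ℕ → ℕ, Monotone t ∧ t 0 = 0 ∧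
      t k ≤ N ∧ ∀ i < k, (x (t (i + 1)) : ℂ) ∈ Metric.ball (ps (i + 1)) (ρ / 4) ∧
        Γ.trail x (t i) (t (i + 1)) ⊆ hull ρ (ps i) (ps (i + 1))} := by
    ext x
    constructor
    · rintro ⟨t, h1, h2, h3⟩
      exact ⟨t k, t, h1, h2, le_rfl, h3⟩
    · rintro ⟨N, t, h1, h2, -, h3⟩
      exact ⟨t, h1, h2, h3⟩
  rw [this]
  refine measurableSet_exists fun N x y hxy => ?_
  rintro ⟨t, h1, h2, h3, h4⟩
  refine ⟨t, h1, h2, h3, fun i hi => ?_⟩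
  have hN : t (i + 1) ≤ N := (h1 hi).trans h3
  rw [← hxy _ hN, ← trail_congr (h1 (Nat.le_succ i)) fun j hj => hxy j (hj.trans hN)]
  exact h4 i hi

theorem dependsUpTo_hits (B R : Set ℂ) (n : ℕ) : DependsUpTo n fun x : ℕ → Γ.verts =>
    (x n : ℂ) ∈ B ∧ (∀ i ≤ n, (x i : ℂ) ∈ R) ∧ ∀ i < n, range (Γ.edge (x i) (x (i + 1))) ⊆ R := by
  rintro x y h ⟨h1, h2, h3⟩
  refine ⟨h n le_rfl ▸ h1, fun i hi => h i hi ▸ h2 i hi, fun i hi => ?_⟩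
  rw [← h i hi.le, ← h (i + 1) hi]
  exact h3 i hi

/-- The ball in which one crossing ends is the ball from which the next may start, so the strong
Markov property multiplies the bounds. -/
theorem Crosses.follows {ρ : ℝ} {a : ℝ≥0∞} (h : Γ.Crosses ρ a) (k : ℕ) (ps ds : ℕ → ℂ)
    (hds : ∀ i < k, UnitStep (ds i)) (hps : ∀ i < k, ps (i + 1) = ps i + (2 * ρ : ℝ) * ds i)
    (v : Γ.verts) (hv : (v : ℂ) ∈ Metric.ball (ps 0) (ρ / 4)) :
    a ^ k ≤ Γ.walkLaw v {x | Follows ρ ps k x} := by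
  induction k generalizing ps ds v with
  | zero =>
    have : {x : ℕ → Γ.verts | Follows ρ ps 0 x} = univ := by
      refine eq_univ_of_forall fun x => ⟨fun _ => 0, monotone_const, rfl, fun i hi => ?_⟩
      exact absurd hi (Nat.not_lt_zero _)
    rw [this, measure_univ, pow_zero]
  | succ k ih =>
    have h1 := h (ps 0) (ds 0) (hds 0 (Nat.succ_pos _)) v hv
    rw [← hps 0 (Nat.succ_pos _)] at h1
    have h2 := Γ.le_walkLaw_firstTime v (dependsUpTo_hits (Metric.ball (ps 1) (ρ / 4))
        (hull ρ (ps 0) (ps 1)))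
      (E := fun _ => {x | Follows ρ (fun i => ps (i + 1)) k x})
      (fun _ => measurableSet_follows _ _ _) (c := a ^ k)
      (fun n x hx => ih (fun i => ps (i + 1)) (fun i => ds (i + 1)) (fun i hi => hds _ (by omega))
        (fun i hi => hps _ (by omega)) _ hx.1)
    rw [pow_succ']
    refine (mul_le_mul' h1 le_rfl).trans (h2.trans (measure_mono ?_))
    rintro x ⟨n, ⟨⟨h3, h4, h5⟩, -⟩, t, t1, t2, t3⟩
    refine ⟨fun i => if i = 0 then 0 else n + t (i - 1), ?_, rfl, fun i hi => ?_⟩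
    · intro i j hij
      simp only
      rcases Nat.eq_zero_or_pos i with rfl | hi
      · simp
      · rw [if_neg hi.ne', if_neg (by omega)]
        exact Nat.add_le_add_left (t1 (by omega)) n
    · rcases Nat.eq_zero_or_pos i with rfl | hi0
      · simp only [zero_add, one_ne_zero, if_false, if_true, Nat.sub_self, t2, add_zero]
        exact ⟨h3, insert_subset (h4 0 (Nat.zero_le _)) (iUnion₂_subset fun j hj => h5 j hj.2)⟩
      · have := t3 (i - 1) (by omega)
        rw [trail_shift] at this
        simp only [Nat.succ_ne_zero, if_false, hi0.ne', shiftSeq, show i - 1 + 1 = i by omega,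
          Nat.add_sub_cancel] at this ⊢
        exact this

/-- Lower bound for the probability of a tour around the starting point. -/
theorem Crosses.tour {ρ : ℝ} (hρ : 0 < ρ) {a : ℝ≥0∞} (h : Γ.Crosses ρ a) (v : Γ.verts) :
    a ^ 13 ≤ Γ.walkLaw v {x | Follows ρ (tourAt v ρ) 13 x} := by
  refine h.follows 13 _ (fun i => PlaneGraph.tour (i + 1) - PlaneGraph.tour i) ?_ ?_ v ?_
  · intro i hi
    unfold UnitStep
    interval_cases i <;> norm_num [PlaneGraph.tour, Complex.ext_iff]
  · intro i _
    simp only [tourAt]; ring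
  · have : tourAt v ρ 0 = v := by
      simp [tourAt, PlaneGraph.tour, Complex.ext_iff]
    rw [this]
    exact Metric.mem_ball_self (by positivity)

/-- Turns a probability bound into a deterministic fact: an event of positive probability contains
an actual path of the graph. -/
theorem exists_of_pos {v : Γ.verts} {A : Set (ℕ → Γ.verts)} (h : Γ.walkLaw v A ≠ 0) :
    ∃ x ∈ A, x 0 = v ∧ ∀ n, Γ.weight (x n) (x (n + 1)) ≠ 0 := by
  by_contra hcon
  push Not at hcon
  refine h (measure_mono_null (fun x hx => ?_) ((Γ.walkLaw_start v).and (Γ.walkLaw_edges v)))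
  rintro ⟨h1, h2⟩
  obtain ⟨n, hn⟩ := hcon x hx h1
  exact h2 n hn

/-- Edges are short. -/
theorem Crosses.edge_subset {ρ : ℝ} (hρ : 0 < ρ) {a : ℝ≥0∞} (ha : a ≠ 0) (h : Γ.Crosses ρ a)
    {u w : Γ.verts} (huw : Γ.weight u w ≠ 0) : range (Γ.edge u w) ⊆ Metric.ball (u : ℂ) (7 * ρ) := by
  by_contra hcon
  have h1 := h.tour hρ u
  obtain ⟨x, hx, -, hxw⟩ := exists_of_pos ((pos_iff_ne_zero.2 (pow_ne_zero 13 ha)).trans_le h1).ne'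
  obtain ⟨N, hN, hmeet⟩ := hx.meets hρ hxw
  -- A long edge is a path, with `S = {u}`, that leaves the ball. The tour stays in the ball, and
  -- the meeting vertex is never the centre `u`.
  rcases hmeet (Metric.ball (u : ℂ) (7 * ρ)) (fun s hs => hasLog_ball hs) {u} u
    ⟨rfl, u, w, .refl, huw, hcon⟩ (by simpa using hρ.le) (by simpa using hρ.le) with
    ⟨i, -, hi, hne⟩ | ⟨i, hi, hne⟩
  · exact hne (by rw [mem_singleton_iff.1 hi])
  · exact hne ((edge_subset_trail (Nat.zero_le i) hi).trans (hN 0 N (Nat.zero_le _) le_rfl))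

theorem reach_of_path {x : ℕ → Γ.verts} (hx : ∀ n, Γ.weight (x n) (x (n + 1)) ≠ 0) (n : ℕ) :
    Relation.ReflTransGen (fun a b => Γ.weight a b ≠ 0) (x 0) (x n) := by
  induction n with
  | zero => exact .refl
  | succ n ih => exact ih.tail (hx n)

/-- From every vertex one can leave every bounded set. -/
theorem Crosses.exists_reach {ρ : ℝ} (hρ : 0 < ρ) {a : ℝ≥0∞} (ha : a ≠ 0) (h : Γ.Crosses ρ a)
    {D : Set ℂ} (hD : Bornology.IsBounded D) (v : Γ.verts) :
    ∃ u : Γ.verts, (u : ℂ) ∉ D ∧ Relation.ReflTransGen (fun a b => Γ.weight a b ≠ 0) v u := by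
  -- Go to the right, one rectangle after another; each crossing has positive probability, so it is
  -- realized by a path.
  have key : ∀ k : ℕ, ∃ u : Γ.verts, (u : ℂ) ∈ Metric.ball ((v : ℂ) + (2 * ρ * k : ℝ)) (ρ / 4) ∧
      Relation.ReflTransGen (fun a b => Γ.weight a b ≠ 0) v u := by
    intro k
    induction k with
    | zero => exact ⟨v, by simpa using hρ, .refl⟩
    | succ k ih =>
      obtain ⟨u, hu, hvu⟩ := ih
      have h1 := h _ 1 (Or.inl rfl) u hu
      obtain ⟨x, ⟨n, hn, -⟩, hx0, hxw⟩ := exists_of_pos ((pos_iff_ne_zero.2 ha).trans_le h1).ne'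
      refine ⟨x n, ?_, hvu.trans (hx0 ▸ reach_of_path hxw n)⟩
      have : (v : ℂ) + (2 * ρ * (k + 1 : ℕ) : ℝ) =
          (v : ℂ) + (2 * ρ * k : ℝ) + (2 * ρ : ℝ) * 1 := by push_cast; ring
      rw [this]
      exact hn
  obtain ⟨M, hM⟩ := hD.subset_closedBall v
  obtain ⟨k, hk⟩ := exists_nat_gt ((M + ρ) / (2 * ρ))
  obtain ⟨u, hu, hvu⟩ := key k
  refine ⟨u, fun huD => ?_, hvu⟩
  have h1 := mem_closedBall_iff_norm.1 (hM huD)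
  rw [mem_ball_iff_norm] at hu
  rw [div_lt_iff₀ (by positivity)] at hk
  have h2 : ((2 * ρ * k : ℝ) : ℂ) = ((u : ℂ) - v) - (u - (v + (2 * ρ * k : ℝ))) := by ring
  have h3 := norm_sub_le ((u : ℂ) - v) (u - (v + (2 * ρ * k : ℝ)))
  rw [← h2, Complex.norm_real, Real.norm_of_nonneg (by positivity)] at h3
  linarith

theorem finite_verts_of_bounded {D : Set ℂ} (hD : Bornology.IsBounded D) :
    {v : Γ.verts | (v : ℂ) ∈ D}.Finite := by
  have h := (Γ.proper _ hD.isCompact_closure).1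
  refine Finite.of_finite_image (f := Subtype.val) (h.subset ?_) Subtype.val_injective.injOn
  rintro _ ⟨v, hv, rfl⟩
  exact ⟨v.2, subset_closure hv⟩

/-- The maximum principle: a subharmonic function does not decrease along some path to the
outside. -/
theorem Crosses.exists_increasing_path {ρ : ℝ} (hρ : 0 < ρ) {a : ℝ≥0∞} (ha : a ≠ 0)
    (h : Γ.Crosses ρ a) {D : Set ℂ} (hD : Bornology.IsBounded D) {f : Γ.verts → ℝ≥0∞}
    (hf1 : ∀ v, f v ≤ 1) (hf : ∀ v : Γ.verts, (v : ℂ) ∈ D → f v ≤ ∑' u, Γ.jump v u * f u)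
    {w : Γ.verts} (hw : (w : ℂ) ∈ D) :
    ∃ b b', Relation.ReflTransGen
      (fun a b => Γ.weight a b ≠ 0 ∧ (b : ℂ) ∈ D ∧ f w ≤ f b) w b ∧
      Γ.weight b b' ≠ 0 ∧ (b' : ℂ) ∉ D ∧ f w ≤ f b' := by
  by_contra hcon
  push Not at hcon
  -- The vertices accessible in `D` without going below the level `f w`. By contradiction, an edge
  -- out of `R` only leads below that level.
  set R : Set Γ.verts := {y | Relation.ReflTransGen
      (fun a b => Γ.weight a b ≠ 0 ∧ (b : ℂ) ∈ D ∧ f w ≤ f b) w y} with hR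
  have hRD : ∀ y ∈ R, (y : ℂ) ∈ D ∧ f w ≤ f y := by
    intro y hy
    rcases Relation.ReflTransGen.cases_tail hy with rfl | ⟨c, -, h⟩
    · exact ⟨hw, le_rfl⟩
    · exact h.2
  have hRfin : R.Finite := (finite_verts_of_bounded hD).subset fun y hy => (hRD y hy).1
  obtain ⟨y, hyR, hmax⟩ := hRfin.exists_maximalFor f R ⟨w, .refl⟩
  have hmax : ∀ z ∈ R, f z ≤ f y := fun z hz => by
    rcases le_total (f z) (f y) with h | h
    · exact h
    · exact hmax hz h
  have hstep : ∀ b ∈ R, ∀ u, Γ.weight b u ≠ 0 → f w ≤ f u → u ∈ R := by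
    intro b hb u hbu hfu
    refine hb.tail ⟨hbu, ?_, hfu⟩
    by_contra huD
    exact absurd hfu (not_le.2 (hcon b u hb hbu huD))
  -- The maximum over `R` also bounds `f` at the neighbours of `R`, so subharmonicity forces
  -- equality at all the neighbours of a maximum point. The maximum would spread to everything
  -- accessible from `y`, even outside `D`.
  have hclosed : ∀ b ∈ R, f b = f y → ∀ u, Γ.weight b u ≠ 0 → u ∈ R ∧ f u = f y := by
    intro b hb hby u hbu
    have hle : ∀ u', Γ.weight b u' ≠ 0 → f u' ≤ f y := by
      intro u' hu'
      rcases le_total (f w) (f u') with h | h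
      · exact hmax _ (hstep b hb u' hu' h)
      · exact h.trans (hRD y hyR).2
    have hfu : f u = f y := by
      refine le_antisymm (hle u hbu) (not_lt.1 fun hlt => ?_)
      have h1 := hf b (hRD b hb).1
      have h2 : ∑' u', Γ.jump b u' * f u' < ∑' u', Γ.jump b u' * f y := by
        refine ENNReal.tsum_lt_tsum (i := u) ?_ (fun u' => ?_) ?_
        · refine ne_top_of_le_ne_top ENNReal.one_ne_top ?_
          calc ∑' u', Γ.jump b u' * f u' ≤ ∑' u', Γ.jump b u' :=
                ENNReal.tsum_le_tsum fun u' => mul_le_of_le_one_right' (hf1 u')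
            _ = 1 := PMF.tsum_coe _
        · by_cases h0 : Γ.weight b u' = 0
          · have : Γ.jump b u' = 0 := by
              by_contra h3; exact Γ.jump_ne_zero.1 h3 h0
            simp [this]
          · exact mul_le_mul' le_rfl (hle u' h0)
        · exact ENNReal.mul_lt_mul_right (Γ.jump_ne_zero.2 hbu) (PMF.apply_ne_top _ _) hlt
      rw [ENNReal.tsum_mul_right, PMF.tsum_coe, one_mul] at h2
      exact absurd h1 (not_le.2 (hby ▸ h2))
    exact ⟨hstep b hb u hbu (by rw [hfu]; exact (hRD y hyR).2), hfu⟩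
  obtain ⟨u, huD, hyu⟩ := h.exists_reach hρ ha hD y
  have key : ∀ u, Relation.ReflTransGen (fun a b => Γ.weight a b ≠ 0) y u → u ∈ R ∧ f u = f y := by
    intro u hyu
    induction hyu with
    | refl => exact ⟨hyR, rfl⟩
    | @tail c d _ hcd ih => exact hclosed c ih.1 ih.2 d hcd
  exact huD (hRD u (key u hyu).1).1

end PlaneGraph

end

noncomputable section

namespace PlaneGraph

variable {Γ : PlaneGraph}

/-! ### Killed walks -/

theorem dependsUpTo_alive (D : Set ℂ) (T : Set Γ.verts) (n : ℕ) : DependsUpTo n (Γ.Alive D T · n) := by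
  rintro x y h ⟨h1, h2⟩
  refine ⟨fun i hi => h i hi ▸ h1 i hi, fun i hi => ?_⟩
  rw [← h i hi.le, ← h (i + 1) hi]
  exact h2 i hi

theorem Alive.shift {D : Set ℂ} {T : Set Γ.verts} {x : ℕ → Γ.verts} {n k : ℕ}
    (h : Γ.Alive D T x (n + k)) : Γ.Alive D T (shiftSeq n x) k :=
  ⟨fun _ hi => h.1 _ (by omega), fun _ hi => h.2 _ (by omega)⟩

theorem Alive.mono {D : Set ℂ} {T : Set Γ.verts} {x : ℕ → Γ.verts} {n k : ℕ}
    (h : Γ.Alive D T x n) (hk : k ≤ n) : Γ.Alive D T x k :=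
  ⟨fun _ hi => h.1 _ (by omega), fun _ hi => h.2 _ (by omega)⟩

theorem StepIn.left_mem {D : Set ℂ} {u v : Γ.verts} (h : Γ.StepIn D u v) : (u : ℂ) ∈ D :=
  h.2 (edge_zero_mem u v)

theorem StepIn.right_mem {D : Set ℂ} {u v : Γ.verts} (h : Γ.StepIn D u v) : (v : ℂ) ∈ D :=
  h.2 (edge_one_mem u v)

/-- The walk almost surely leaves a bounded domain. -/
theorem Crosses.ae_killed {ρ : ℝ} (hρ : 0 < ρ) {a : ℝ≥0∞} (ha : a ≠ 0) (h : Γ.Crosses ρ a)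
    {D : Set ℂ} (hD : Bornology.IsBounded D) (v : Γ.verts) :
    ∀ᵐ x ∂Γ.walkLaw v, ∃ n, ¬ Γ.StepIn D (x n) (x (n + 1)) := by
  set E : Set (ℕ → Γ.verts) := {x | ∀ n, Γ.StepIn D (x n) (x (n + 1))} with hE
  have hEm : MeasurableSet E := by
    have : E = ⋂ n, {x | Γ.StepIn D (x n) (x (n + 1))} := by ext; simp [hE]
    rw [this]
    refine MeasurableSet.iInter fun n => DependsUpTo.measurableSet (n := n + 1) fun _ _ hxy hx => ?_
    rw [← hxy n (Nat.le_succ n), ← hxy (n + 1) le_rfl]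
    exact hx
  have hout : ∀ u : Γ.verts, (u : ℂ) ∉ D → Γ.walkLaw u E = 0 := by
    intro u hu
    refine measure_mono_null (fun x hx => ?_) (Γ.walkLaw_start u)
    rintro (h0 : x 0 = u)
    exact hu (h0 ▸ (hx 0).left_mem)
  have hsub : ∀ u, Γ.walkLaw u E ≤ ∑' w, Γ.jump u w * Γ.walkLaw w E := by
    intro u
    rw [← walkLaw_first_step _ _ hEm]
    exact measure_mono fun x hx n => by simpa [shiftSeq, add_assoc, add_comm 1] using hx (1 + n)
  -- The probability of never being killed is subharmonic and vanishes outside `D`; an increasing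
  -- path to the outside makes it vanish everywhere.
  have : Γ.walkLaw v E = 0 := by
    by_cases hv : (v : ℂ) ∈ D
    · obtain ⟨b, b', -, -, hb', hle⟩ := h.exists_increasing_path hρ ha hD
        (f := fun u => Γ.walkLaw u E) (fun _ => prob_le_one) (fun u _ => hsub u) hv
      simp only [hout b' hb', nonpos_iff_eq_zero] at hle
      exact hle
    · exact hout v hv
  refine measure_mono_null (fun x hx => ?_) this
  simpa [hE] using hx

/-- The set `T` contains, near every other vertex of `D`, the starting point of a path in `T`
that leaves `D`. -/
def IsNet (Γ : PlaneGraph) (D : Set ℂ) (T : Set Γ.verts) (ρ : ℝ) : Prop :=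
  ∀ v : Γ.verts, (v : ℂ) ∈ D → v ∉ T → ∃ u : Γ.verts, Γ.Exits D T u ∧
    |(u : ℂ).re - (v : ℂ).re| ≤ ρ ∧ |(u : ℂ).im - (v : ℂ).im| ≤ ρ

/-- A walk that makes the tour around `v` meets the nearby path in `T`, or leaves `D`, before it can
get out of the ball. -/
theorem Crosses.escape_one {ρ : ℝ} (hρ : 0 < ρ) {a : ℝ≥0∞} (h : Γ.Crosses ρ a) {D : Set ℂ}
    (hD : ∀ s ∉ D, HasLog D s) {T : Set Γ.verts} (hT : Γ.IsNet D T ρ) {v : Γ.verts}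
    (hv : (v : ℂ) ∈ D) :
    Γ.walkLaw v {x | ∃ n, x 0 = v ∧ Γ.Alive D T x n ∧ (x n : ℂ) ∉ Metric.ball (v : ℂ) (7 * ρ)} ≤
      1 - a ^ 13 := by
  by_cases hvT : v ∈ T
  · refine (measure_mono_null (t := ∅) ?_ measure_empty).le.trans zero_le
    rintro x ⟨n, h0, h1, -⟩
    exact absurd (h0 ▸ hvT) (h1.1 0 (Nat.zero_le n))
  obtain ⟨u, hu, hu1, hu2⟩ := hT v hv hvT
  have h1 := h.tour hρ v
  have hm := measurableSet_follows (Γ := Γ) ρ (tourAt v ρ) 13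
  have h2 := prob_compl_eq_one_sub (μ := Γ.walkLaw v) hm
  calc _ ≤ Γ.walkLaw v {x | Follows ρ (tourAt v ρ) 13 x}ᶜ := by
        refine measure_mono_ae ?_
        filter_upwards [Γ.walkLaw_edges v] with x hx
        rintro ⟨n, h3, h4, h5⟩ h6
        obtain ⟨N, hN, hmeet⟩ := Follows.meets hρ h6 hx
        have hn : N < n := by
          by_contra hn
          exact h5 (hN n n le_rfl (not_lt.1 hn) (vertex_mem_trail le_rfl le_rfl))
        rcases hmeet D hD T u hu hu1 hu2 with ⟨i, hi, hiT, -⟩ | ⟨i, hi, hiD⟩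
        · exact h4.1 i (hi.trans hn.le) hiT
        · exact hiD (h4.2 i (hi.trans hn)).2
    _ ≤ 1 - a ^ 13 := by rw [h2]; exact tsub_le_tsub_left h1 1

theorem measurableSet_alive_and (D : Set ℂ) (T : Set Γ.verts) (A : Set Γ.verts) :
    MeasurableSet {x : ℕ → Γ.verts | ∃ n, Γ.Alive D T x n ∧ x n ∈ A} :=
  measurableSet_exists (φ := fun n x => Γ.Alive D T x n ∧ x n ∈ A)
    fun n _ _ hxy hx => ⟨dependsUpTo_alive D T n hxy hx.1, hxy n le_rfl ▸ hx.2⟩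

/-- The probability that the killed walk goes far is exponentially small. -/
theorem Crosses.escape {ρ : ℝ} (hρ : 0 < ρ) {a : ℝ≥0∞} (ha : a ≠ 0) (h : Γ.Crosses ρ a)
    {D : Set ℂ} (hD : ∀ s ∉ D, HasLog D s) {T : Set Γ.verts} (hT : Γ.IsNet D T ρ) (m : ℕ)
    {v : Γ.verts} (hv : (v : ℂ) ∈ D) :
    Γ.walkLaw v {x | ∃ n, Γ.Alive D T x n ∧ x n ∈ {u : Γ.verts | 14 * ρ * m ≤ dist (u : ℂ) v}} ≤
      (1 - a ^ 13) ^ m := by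
  induction m generalizing v with
  | zero => rw [pow_zero]; exact prob_le_one
  | succ m ih =>
    -- Restart at the first exit from the ball of radius `7 ρ`. The last edge is shorter than `7 ρ`,
    -- so the exit vertex is within `14 ρ` of `v` and a distance `14 ρ m` remains to be covered.
    set φ : ℕ → (ℕ → Γ.verts) → Prop := fun n x =>
      x 0 = v ∧ Γ.Alive D T x n ∧ (x n : ℂ) ∉ Metric.ball (v : ℂ) (7 * ρ) with hφ
    have hφd : ∀ n, DependsUpTo n (φ n) := by
      rintro n x y hxy ⟨h1, h2, h3⟩
      exact ⟨hxy 0 (Nat.zero_le n) ▸ h1, dependsUpTo_alive D T n hxy h2, hxy n le_rfl ▸ h3⟩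
    have h1 := Γ.walkLaw_firstTime_le v hφd (E := fun u => {x | ∃ n, Γ.Alive D T x n ∧
        x n ∈ {w : Γ.verts | 14 * ρ * m ≤ dist (w : ℂ) u}})
      (fun u => measurableSet_alive_and D T _) (c := (1 - a ^ 13) ^ m) ?_
    · rw [pow_succ']
      refine le_trans ?_ (h1.trans (mul_le_mul' (h.escape_one hρ hD hT hv) le_rfl))
      refine measure_mono_ae ?_
      filter_upwards [Γ.walkLaw_start v] with x hx0
      rintro ⟨n, hn, hfar⟩
      change 14 * ρ * (m + 1 : ℕ) ≤ dist (x n : ℂ) v at hfar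
      have hfar7 : (x n : ℂ) ∉ Metric.ball (v : ℂ) (7 * ρ) := by
        rw [Metric.mem_ball, not_lt]
        refine le_trans ?_ hfar
        push_cast
        nlinarith [mul_nonneg hρ.le (Nat.cast_nonneg (α := ℝ) m)]
      obtain ⟨k, hk, hkmin⟩ := exists_firstTime (φ := φ) ⟨n, hx0, hn, hfar7⟩
      have hkn : k ≤ n := by
        by_contra hlt
        exact hkmin n (not_le.1 hlt) ⟨hx0, hn, hfar7⟩
      refine ⟨k, ⟨hk, hkmin⟩, n - k, Alive.shift (by rwa [Nat.add_sub_cancel' hkn]), ?_⟩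
      have hk0 : k ≠ 0 := by
        rintro rfl
        exact hk.2.2 (by rw [hx0]; exact Metric.mem_ball_self (by positivity))
      obtain ⟨j, rfl⟩ := Nat.exists_eq_succ_of_ne_zero hk0
      have hj : (x j : ℂ) ∈ Metric.ball (v : ℂ) (7 * ρ) := by
        by_contra hj
        exact hkmin j (Nat.lt_succ_self j) ⟨hx0, hk.2.1.mono (Nat.le_succ j), hj⟩
      have hstep := h.edge_subset hρ ha (hk.2.1.2 j (Nat.lt_succ_self j)).1
        (edge_one_mem (x j) (x (j + 1)))
      rw [Metric.mem_ball] at hj hstep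
      change 14 * ρ * m ≤ dist (x (j + 1 + (n - (j + 1))) : ℂ) (x (j + 1))
      rw [Nat.add_sub_cancel' hkn]
      have h3 := dist_triangle4 (x n : ℂ) (x (j + 1)) (x j) v
      push_cast at hfar
      nlinarith
    · rintro n x ⟨h0, h2, h3⟩
      refine ih ?_
      rcases Nat.eq_zero_or_pos n with rfl | hn
      · rw [h0]; exact hv
      · obtain ⟨j, rfl⟩ := Nat.exists_eq_succ_of_ne_zero hn.ne'
        exact (h2.2 j (Nat.lt_succ_self j)).right_mem

/-! ### The Harnack inequality for harmonic measure -/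

/-- The probability that the walk from `w` leaves `B` at `y`. -/
def exitProb (Γ : PlaneGraph) (B : Set ℂ) (y w : Γ.verts) : ℝ≥0∞ :=
  Γ.walkLaw w {x | ∃ n, x n = y ∧ ∀ i < n, (x i : ℂ) ∈ B}

theorem measurableSet_exitProb (B : Set ℂ) (y : Γ.verts) :
    MeasurableSet {x : ℕ → Γ.verts | ∃ n, x n = y ∧ ∀ i < n, (x i : ℂ) ∈ B} :=
  measurableSet_exists (φ := fun n x => x n = y ∧ ∀ i < n, (x i : ℂ) ∈ B) fun n _ _ h hx =>
    ⟨h n le_rfl ▸ hx.1, fun i hi => h i hi.le ▸ hx.2 i hi⟩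

theorem exitProb_self (B : Set ℂ) (y : Γ.verts) : Γ.exitProb B y y = 1 := by
  refine (prob_compl_eq_zero_iff (measurableSet_exitProb B y)).1
    (measure_mono_null (t := {x | ¬ x 0 = y}) (fun x hx h0 => hx ?_) (Γ.walkLaw_start y))
  exact ⟨0, h0, fun i hi => absurd hi (Nat.not_lt_zero i)⟩

theorem exitProb_eq {B : Set ℂ} {y w : Γ.verts} (hy : (y : ℂ) ∉ B) (hw : (w : ℂ) ∈ B) :
    Γ.exitProb B y w = ∑' u, Γ.jump w u * Γ.exitProb B y u := by
  rw [exitProb, ← measure_congr (μ := Γ.walkLaw w)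
    (s := shiftSeq 1 ⁻¹' {x | ∃ n, x n = y ∧ ∀ i < n, (x i : ℂ) ∈ B})]
  · exact Γ.walkLaw_first_step w (measurableSet_exitProb B y)
  filter_upwards [Γ.walkLaw_start w] with x hx
  refine propext ⟨?_, ?_⟩
  · rintro ⟨n, h1, h2⟩
    refine ⟨1 + n, h1, fun i hi => ?_⟩
    rcases Nat.eq_zero_or_pos i with rfl | h0
    · rw [hx]; exact hw
    · have := h2 (i - 1) (by omega)
      rwa [shiftSeq, Nat.add_sub_cancel' h0] at this
  · rintro ⟨n, h1, h2⟩
    have hn : 1 ≤ n := by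
      rcases Nat.eq_zero_or_pos n with rfl | h0
      · rw [hx] at h1; exact absurd (h1 ▸ hw) hy
      · exact h0
    refine ⟨n - 1, ?_, fun i hi => h2 (1 + i) (by omega)⟩
    rw [shiftSeq, Nat.add_sub_cancel' hn]; exact h1

/-- The first vertex outside `B` is unique, so the events are disjoint. -/
theorem tsum_exitProb_le (B : Set ℂ) (w : Γ.verts) :
    ∑' y : {y : Γ.verts // (y : ℂ) ∉ B}, Γ.exitProb B y w ≤ 1 := by
  unfold exitProb
  rw [← measure_iUnion]
  · exact prob_le_one
  · rintro ⟨y, hy⟩ ⟨y', hy'⟩ hne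
    refine disjoint_left.2 ?_
    rintro x ⟨n, h1, h2⟩ ⟨n', h1', h2'⟩
    simp only at h1 h1'
    rcases lt_trichotomy n n' with h | h | h
    · exact hy (h1 ▸ h2' n h)
    · exact hne (Subtype.ext (by simp only; rw [← h1, ← h1', h]))
    · exact hy' (h1' ▸ h2 n' h)
  · exact fun y => measurableSet_exitProb B y.1

/-- By the maximum principle, a path from `w` leaves the ball along which the exit probability never
falls below its value at `w`. The tour around `w₀` stays in the ball and so meets this path; the
walk starts afresh at the meeting vertex. -/
theorem Crosses.harnack {ρ : ℝ} (hρ : 0 < ρ) {a : ℝ≥0∞} (ha : a ≠ 0) (h : Γ.Crosses ρ a) {z : ℂ}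
    {r : ℝ} (hr : 8 * ρ ≤ r) {y w w₀ : Γ.verts} (hy : (y : ℂ) ∉ Metric.ball z r)
    (hw : (w : ℂ) ∈ Metric.closedBall z (ρ / 2)) (hw₀ : (w₀ : ℂ) ∈ Metric.closedBall z (ρ / 2)) :
    a ^ 13 * Γ.exitProb (Metric.ball z r) y w ≤ Γ.exitProb (Metric.ball z r) y w₀ := by
  set B := Metric.ball z r with hB
  have hsub : Metric.ball (w₀ : ℂ) (7 * ρ) ⊆ B := by
    refine Metric.ball_subset_ball' ?_
    rw [Metric.mem_closedBall] at hw₀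
    linarith
  have hwB : (w : ℂ) ∈ B := by
    rw [Metric.mem_closedBall] at hw
    rw [hB, Metric.mem_ball]
    linarith
  obtain ⟨b, b', hwb, hbb, hb', hle⟩ := h.exists_increasing_path hρ ha
    (Metric.isBounded_ball (x := z) (r := r)) (f := Γ.exitProb B y) (fun _ => prob_le_one)
    (fun v hv => (exitProb_eq hy hv).le) hwB
  set S : Set Γ.verts := {v | Γ.exitProb B y w ≤ Γ.exitProb B y v} with hS
  have hex : Γ.Exits B S w :=
    ⟨le_refl (Γ.exitProb B y w), b, b', Relation.ReflTransGen.mono (fun _ _ h => ⟨h.1, h.2.2⟩) _ _ hwb, hbb,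
      fun hs => hb' (hs (edge_one_mem b b'))⟩
  have hdist : ‖(w : ℂ) - w₀‖ ≤ ρ := by
    rw [← dist_eq_norm]
    rw [Metric.mem_closedBall] at hw hw₀
    rw [dist_comm] at hw₀
    linarith [dist_triangle (w : ℂ) z w₀]
  set φ : ℕ → (ℕ → Γ.verts) → Prop := fun n x => x n ∈ S ∧ ∀ i ≤ n, (x i : ℂ) ∈ B with hφ
  have hφd : ∀ n, DependsUpTo n (φ n) := fun n x x' hxx hx =>
    ⟨hxx n le_rfl ▸ hx.1, fun i hi => hxx i hi ▸ hx.2 i hi⟩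
  have h1 : a ^ 13 ≤ Γ.walkLaw w₀ {x | ∃ n, φ n x} := by
    refine (h.tour hρ w₀).trans (measure_mono_ae ?_)
    filter_upwards [Γ.walkLaw_edges w₀] with x hx
    intro hf
    obtain ⟨N, hN, hmeet⟩ := Follows.meets hρ hf hx
    have hNB : ∀ i j, i ≤ j → j ≤ N → Γ.trail x i j ⊆ B := fun i j h1 h2 => (hN i j h1 h2).trans hsub
    rcases hmeet B (fun s hs => hasLog_ball hs) S w hex
      (by rw [← Complex.sub_re]; exact (Complex.abs_re_le_norm _).trans hdist)
      (by rw [← Complex.sub_im]; exact (Complex.abs_im_le_norm _).trans hdist) with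
      ⟨n, hn, hnS, -⟩ | ⟨i, hi, hne⟩
    · exact ⟨n, hnS, fun i hi => hNB i i le_rfl (hi.trans hn) (vertex_mem_trail le_rfl le_rfl)⟩
    · exact absurd ((edge_subset_trail (Nat.zero_le i) hi).trans (hNB 0 N (Nat.zero_le N) le_rfl)) hne
  refine (mul_le_mul' h1 le_rfl).trans ((Γ.le_walkLaw_firstTime w₀ hφd
    (E := fun _ => {x | ∃ n, x n = y ∧ ∀ i < n, (x i : ℂ) ∈ B})
    (fun _ => measurableSet_exitProb B y) fun n x hx => hx.1).trans (measure_mono ?_))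
  rintro x ⟨n, ⟨⟨-, h2⟩, -⟩, k, h3, h4⟩
  refine ⟨n + k, h3, fun i hi => ?_⟩
  rcases le_or_gt i n with h | h
  · exact h2 i h
  · have := h4 (i - n) (by omega)
    rwa [shiftSeq, Nat.add_sub_cancel' h.le] at this

end PlaneGraph

end

noncomputable section

/-! ### Sums over words -/

theorem tsum_list {V : Type*} (g : List V → ℝ≥0∞) :
    ∑' L, g L = g [] + ∑' u, ∑' L, g (u :: L) := by
  classical
  rw [ENNReal.tsum_eq_add_tsum_ite []]
  congr 1
  have hinj : Function.Injective fun p : V × List V => p.1 :: p.2 := by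
    rintro ⟨u, L⟩ ⟨u', L'⟩ h
    simpa using h
  rw [← hinj.tsum_eq, ENNReal.tsum_prod']
  · simp
  · intro L hL
    cases L with
    | nil => simp at hL
    | cons u L => exact ⟨(u, L), rfl⟩

namespace PlaneGraph

open scoped Classical in
/-- The transition probabilities of the walk killed on the boundary of `D` and in `T`. -/
def killStep (Γ : PlaneGraph) (D : Set ℂ) (T : Set Γ.verts) (u v : Γ.verts) : ℝ≥0∞ :=
  if Γ.StepIn D u v ∧ v ∉ T then Γ.jump u v else 0

/-- The weight of the path that starts at `v` and then visits the vertices of the list. -/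
def pathWt (Γ : PlaneGraph) (D : Set ℂ) (T : Set Γ.verts) : Γ.verts → List Γ.verts → ℝ≥0∞
  | _, [] => 1
  | v, u :: L => Γ.killStep D T v u * pathWt Γ D T u L

variable {Γ : PlaneGraph} {D : Set ℂ} {T : Set Γ.verts}

theorem killStep_le (u v : Γ.verts) : Γ.killStep D T u v ≤ Γ.jump u v := by
  unfold killStep
  split_ifs
  · exact le_rfl
  · exact zero_le

theorem killStep_eq_zero {u v : Γ.verts} (h : ¬ (Γ.StepIn D u v ∧ v ∉ T)) :
    Γ.killStep D T u v = 0 := if_neg h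

theorem tsum_killStep_mul_le {v : Γ.verts} {E : Set (ℕ → Γ.verts)} (hE : MeasurableSet E) :
    ∑' u, Γ.killStep D T v u * Γ.walkLaw u E ≤
      Γ.walkLaw v {x | x 0 = v ∧ Γ.StepIn D (x 0) (x 1) ∧ shiftSeq 1 x ∈ E} := by
  have hE' : MeasurableSet ({x : ℕ → Γ.verts | Γ.StepIn D v (x 0)} ∩ E) :=
    (DependsUpTo.measurableSet (n := 0) fun x y h hx => by
      rw [← h 0 le_rfl]; exact hx).inter hE
  calc ∑' u, Γ.killStep D T v u * Γ.walkLaw u E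
      ≤ ∑' u, Γ.jump v u * Γ.walkLaw u ({x : ℕ → Γ.verts | Γ.StepIn D v (x 0)} ∩ E) := by
        refine ENNReal.tsum_le_tsum fun u => ?_
        by_cases h : Γ.StepIn D v u ∧ u ∉ T
        · refine mul_le_mul' (killStep_le v u) (measure_mono_ae ?_)
          filter_upwards [Γ.walkLaw_start u] with x hx hxE
          refine ⟨?_, hxE⟩
          change Γ.StepIn D v (x 0)
          rw [hx]; exact h.1
        · rw [killStep_eq_zero h, zero_mul]; exact zero_le
    _ = Γ.walkLaw v (shiftSeq 1 ⁻¹' ({x : ℕ → Γ.verts | Γ.StepIn D v (x 0)} ∩ E)) :=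
        (Γ.walkLaw_first_step v hE').symm
    _ ≤ _ := by
        refine measure_mono_ae ?_
        filter_upwards [Γ.walkLaw_start v] with x hx
        rintro ⟨h1, h2⟩
        refine ⟨hx, ?_, h2⟩
        rw [hx]; exact h1

/-- A superharmonic function dominates the sum over words. -/
theorem tsum_words_le {ι : Type*} (acc : ι → List Γ.verts → Prop) (f : ι → Γ.verts → ℝ≥0∞)
    (next : ι → Γ.verts → ι) (inv : ι → Γ.verts → Prop) (rew : ι → Γ.verts → Γ.verts → ℝ≥0∞)
    (hnil : ∀ s, ¬ acc s [])
    (hcons : ∀ s v u, inv s v → Γ.StepIn D v u → u ∉ T → ∀ g : List Γ.verts → ℝ≥0∞,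
      (∑' L, {L | acc s (u :: L)}.indicator g L) ≤
        rew s v u * g [] + ∑' L, {L | acc (next s u) L}.indicator g L)
    (hinv : ∀ s v u, inv s v → Γ.StepIn D v u → u ∉ T → inv (next s u) u)
    (hf : ∀ s v, inv s v → ∑' u, Γ.killStep D T v u * (rew s v u + f (next s u) u) ≤ f s v)
    {s : ι} {v : Γ.verts} (hs : inv s v) :
    ∑' L, {L | acc s L}.indicator (Γ.pathWt D T v) L ≤ f s v := by
  -- `acc` is the language of an automaton with transitions `next`, and `rew` counts the words that
  -- stop at the current letter. Induction on a bound for the length; a finite sum involves bounded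
  -- lengths only.
  have key : ∀ n : ℕ, ∀ s v, inv s v →
      ∑' L, {L | acc s L}.indicator ({L | L.length ≤ n}.indicator (Γ.pathWt D T v)) L ≤ f s v := by
    intro n
    induction n with
    | zero =>
      intro s v _
      refine (ENNReal.tsum_eq_zero.2 fun L => ?_).le.trans zero_le
      by_cases h : L = []
      · subst h; simp [hnil]
      · simp [indicator, h]
    | succ n ih =>
      intro s v hv
      rw [tsum_list]
      have h0 : {L | acc s L}.indicator ({L | L.length ≤ n + 1}.indicator (Γ.pathWt D T v)) [] = 0 :=
        indicator_of_notMem (hnil s) _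
      rw [h0, zero_add]
      refine le_trans (ENNReal.tsum_le_tsum fun u => ?_) (hf s v hv)
      by_cases h : Γ.StepIn D v u ∧ u ∉ T
      · have e : ∀ L, {L | acc s L}.indicator ({L | L.length ≤ n + 1}.indicator (Γ.pathWt D T v))
            (u :: L) = Γ.killStep D T v u * {L | acc s (u :: L)}.indicator
              ({L | L.length ≤ n}.indicator (Γ.pathWt D T u)) L := by
          intro L
          simp only [indicator, mem_ofPred_eq, List.length_cons, Nat.add_le_add_iff_right, pathWt,
            mul_ite, mul_zero]
        simp_rw [e]
        rw [ENNReal.tsum_mul_left]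
        refine mul_le_mul' le_rfl ((hcons s v u hv h.1 h.2 _).trans (add_le_add ?_ ?_))
        · simp [pathWt]
        · exact ih _ _ (hinv s v u hv h.1 h.2)
      · refine (ENNReal.tsum_eq_zero.2 fun L => ?_).le.trans zero_le
        simp [indicator, pathWt, killStep_eq_zero h]
  rw [ENNReal.tsum_eq_iSup_sum]
  refine iSup_le fun F => ?_
  refine le_trans (le_trans ?_ (ENNReal.sum_le_tsum F)) (key (F.sup List.length) s v hs)
  refine Finset.sum_le_sum fun L hL => ?_
  have : L.length ≤ F.sup List.length := Finset.le_sup (f := List.length) hL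
  simp [indicator, this]

/-! ### Loops crossing an annulus -/

open scoped Classical in
/-- The words that end with a passage from `A` to the vertex `y`; the first argument tells
whether `A` has been visited after the last visit of the complement of `B`. -/
def Upcrossing (A B : Set ℂ) (y : Γ.verts) : Bool → List Γ.verts → Prop
  | _, [] => False
  | false, u :: L => Upcrossing A B y (decide ((u : ℂ) ∈ A)) L
  | true, u :: L => if (u : ℂ) ∈ B then Upcrossing A B y true L else
      u = y ∧ L = [] ∨ Upcrossing A B y false L

/-- The probability that the killed walk visits `A`. -/
def hitProb (Γ : PlaneGraph) (D : Set ℂ) (T : Set Γ.verts) (A : Set ℂ) (v : Γ.verts) : ℝ≥0∞ :=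
  Γ.walkLaw v {x | ∃ n, Γ.Alive D T x n ∧ x n ∈ {u : Γ.verts | (u : ℂ) ∈ A}}

theorem hitProb_eq_one {A : Set ℂ} {v : Γ.verts} (hv : (v : ℂ) ∈ A) (hT : v ∉ T) :
    Γ.hitProb D T A v = 1 := by
  refine (prob_compl_eq_zero_iff (measurableSet_alive_and D T _)).1
    (measure_mono_null (t := {x | ¬ x 0 = v}) (fun x hx h0 => hx ?_) (Γ.walkLaw_start v))
  refine ⟨0, ⟨fun i hi => ?_, fun i hi => absurd hi (Nat.not_lt_zero i)⟩, ?_⟩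
  · rw [Nat.le_zero.1 hi, h0]; exact hT
  · rw [h0]; exact hv

theorem tsum_killStep_hitProb_le {A : Set ℂ} {v : Γ.verts} (hT : v ∉ T) :
    ∑' u, Γ.killStep D T v u * Γ.hitProb D T A u ≤ Γ.hitProb D T A v := by
  refine (tsum_killStep_mul_le (measurableSet_alive_and D T _)).trans (measure_mono ?_)
  rintro x ⟨h0, h1, n, h2, h3⟩
  refine ⟨1 + n, ⟨fun i hi => ?_, fun i hi => ?_⟩, h3⟩
  · rcases Nat.eq_zero_or_pos i with rfl | hi0
    · rw [h0]; exact hT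
    · have := h2.1 (i - 1) (by omega)
      rwa [shiftSeq, Nat.add_sub_cancel' hi0] at this
  · rcases Nat.eq_zero_or_pos i with rfl | hi0
    · exact h1
    · have := h2.2 (i - 1) (by omega)
      rw [shiftSeq, shiftSeq, ← add_assoc, Nat.add_sub_cancel' hi0] at this
      exact this

/-- If `h` is the expected number of passages that end at `y`, for walks starting outside `B`, then
`h ≤ s (M + h)`: reach `A`, leave `B` at `y` or elsewhere, begin again. This suggests the bound `2 s
M` when `2 s ≤ 1`. The superharmonic function that proves it is `2 M` times the hitting probability
of `A` before the visit to `A`, and the exit probability at `y` plus `2 s M` after it. -/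
theorem tsum_upcrossing_le {A B : Set ℂ} (hIB : A ⊆ B) {s M : ℝ≥0∞} (hs : 2 * s ≤ 1)
    (hg : ∀ u : Γ.verts, (u : ℂ) ∈ D → (u : ℂ) ∉ B → Γ.hitProb D T A u ≤ s) {y : Γ.verts}
    (hyB : (y : ℂ) ∉ B) (hM : ∀ w : Γ.verts, (w : ℂ) ∈ A → Γ.exitProb B y w ≤ M)
    (hyD : (y : ℂ) ∈ D) (hyT : y ∉ T) :
    ∑' L, {L | Upcrossing A B y false L}.indicator (Γ.pathWt D T y) L ≤ 2 * s * M := by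
  classical
  have hg0 : ∀ u : Γ.verts, (u : ℂ) ∉ B → (u : ℂ) ∈ D → 2 * M * Γ.hitProb D T A u ≤ 2 * s * M := by
    intro u h1 h2
    calc 2 * M * Γ.hitProb D T A u ≤ 2 * M * s := mul_le_mul' le_rfl (hg u h2 h1)
      _ = 2 * s * M := by ring
  have h := tsum_words_le (D := D) (T := T) (ι := Bool) (Upcrossing A B y)
    (fun b v => if b then Γ.exitProb B y v + 2 * s * M else 2 * M * Γ.hitProb D T A v)
    (fun b u => if b then decide ((u : ℂ) ∈ B) else decide ((u : ℂ) ∈ A))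
    -- The state knows the position: in `B` while a passage is under way, outside `A` otherwise.
    (fun b v => v ∉ T ∧ if b then (v : ℂ) ∈ B else (v : ℂ) ∉ A)
    (fun b _ u => if b then if u = y then 1 else 0 else 0) ?_ ?_ ?_ ?_ (s := false) (v := y)
    ⟨hyT, by simpa using fun h => hyB (hIB h)⟩
  · simp only [Bool.false_eq_true, if_false] at h
    exact h.trans (hg0 y hyB hyD)
  · intro b; cases b <;> simp [Upcrossing]
  · intro b v u _ _ _ g
    cases b
    · simp [Upcrossing]
    · by_cases hu : (u : ℂ) ∈ B
      · simp [Upcrossing, hu]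
      · simp only [Upcrossing, hu, if_false, if_true, decide_false]
        by_cases huy : u = y
        · simp only [huy, true_and, if_true, one_mul]
          have : ∀ L : List Γ.verts, {L | L = [] ∨ Upcrossing A B y false L}.indicator g L ≤
              ({([] : List Γ.verts)} : Set (List Γ.verts)).indicator g L +
                {L | Upcrossing A B y false L}.indicator g L := by
            intro L
            by_cases h1 : L = []
            · simp [indicator, h1]
            · simp [indicator, h1]
          refine (ENNReal.tsum_le_tsum this).trans ?_
          rw [ENNReal.tsum_add]
          refine add_le_add ?_ le_rfl
          rw [tsum_eq_single []]
          · simp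
          · intro L hL; simp [hL]
        · simp [huy]
  · intro b v u hv _ huT
    refine ⟨huT, ?_⟩
    cases b
    · by_cases hu : (u : ℂ) ∈ A
      · simpa [hu] using hIB hu
      · simp [hu]
    · by_cases hu : (u : ℂ) ∈ B
      · simp [hu]
      · simpa [hu] using fun h => hu (hIB h)
  · intro b v hv
    cases b
    · simp only [Bool.false_eq_true, if_false, zero_add] at hv ⊢
      calc _ ≤ ∑' u, 2 * M * (Γ.killStep D T v u * Γ.hitProb D T A u) := by
            refine ENNReal.tsum_le_tsum fun u => ?_
            by_cases h : Γ.StepIn D v u ∧ u ∉ T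
            · rw [mul_left_comm]
              refine mul_le_mul' le_rfl ?_
              by_cases hu : (u : ℂ) ∈ A
              · rw [hitProb_eq_one hu h.2]
                simp only [hu, decide_true, if_true, mul_one]
                calc Γ.exitProb B y u + 2 * s * M ≤ M + 1 * M :=
                      add_le_add (hM u hu) (mul_le_mul' hs le_rfl)
                  _ = 2 * M := by ring
              · simp [hu]
            · rw [killStep_eq_zero h, zero_mul]; exact zero_le
        _ ≤ 2 * M * Γ.hitProb D T A v := by
            rw [ENNReal.tsum_mul_left]
            exact mul_le_mul' le_rfl (tsum_killStep_hitProb_le hv.1)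
    · simp only [if_true] at hv ⊢
      calc _ ≤ ∑' u, Γ.jump v u * (Γ.exitProb B y u + 2 * s * M) := by
            refine ENNReal.tsum_le_tsum fun u => ?_
            by_cases h : Γ.StepIn D v u ∧ u ∉ T
            · refine mul_le_mul' (killStep_le v u) ?_
              by_cases hu : (u : ℂ) ∈ B
              · have : u ≠ y := fun h => hyB (h ▸ hu)
                simp [hu, this]
              · simp only [hu, decide_false, Bool.false_eq_true, if_false]
                refine add_le_add ?_ (hg0 u hu h.1.right_mem)
                split_ifs with huy
                · rw [huy, exitProb_self]
                · exact zero_le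
            · rw [killStep_eq_zero h, zero_mul]; exact zero_le
        _ = Γ.exitProb B y v + 2 * s * M := by
            simp_rw [mul_add]
            rw [ENNReal.tsum_add, ← exitProb_eq hyB hv.2, ENNReal.tsum_mul_right, PMF.tsum_coe,
              one_mul]

/-! ### The mass of loops -/

theorem coe_q (u v : Γ.verts) : ((Γ.q u v : ℝ≥0) : ℝ≥0∞) = Γ.jump u v :=
  ENNReal.coe_toNNReal (PMF.apply_ne_top _ _)

/-- The weight of a rooted loop. -/
def loopWt (Γ : PlaneGraph) (l : List Γ.verts) : ℝ≥0 := (List.zipWith Γ.q l (l.rotate 1)).prod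

theorem loopWt_eq_of_isRotated {l l' : List Γ.verts} (h : l ~r l') : Γ.loopWt l = Γ.loopWt l' := by
  obtain ⟨n, rfl⟩ := h
  unfold loopWt
  rw [List.rotate_rotate, add_comm, ← List.rotate_rotate,
    ← List.zipWith_rotate_distrib _ _ _ _ (by simp)]
  exact ((List.rotate_perm _ _).prod_eq).symm

/-- All the rooted loops of the class have the same weight, and there are at most as many of them as
the length by which it is divided. -/
theorem loopMass_le_loopWt (l : List Γ.verts) (hl : l ≠ []) :
    Γ.loopMass (l : Cycle Γ.verts) ≤ Γ.loopWt l := by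
  classical
  have hlen : (0 : ℝ≥0) < l.length := by exact_mod_cast List.length_pos_iff.2 hl
  have h1 : ∀ l' ∈ (l : Cycle Γ.verts).lists.toFinset, Γ.rootedMass l' = Γ.loopWt l / l.length := by
    intro l' hl'
    have h2 : l' ~r l := by
      rw [Multiset.mem_toFinset, Cycle.mem_lists_iff_coe_eq] at hl'
      exact Cycle.coe_eq_coe.1 hl'
    rw [loopWt_eq_of_isRotated h2.symm, ← h2.perm.length_eq]
    rfl
  have h3 : ((l : Cycle Γ.verts).lists.toFinset.card : ℝ≥0) ≤ l.length := by
    refine Nat.cast_le.2 ((Multiset.toFinset_card_le _).trans ?_)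
    rw [Cycle.lists_coe, Multiset.coe_card, List.length_cyclicPermutations_of_ne_nil _ hl]
  have h4 : Γ.loopMass (l : Cycle Γ.verts) =
      ∑ l' ∈ (l : Cycle Γ.verts).lists.toFinset, Γ.rootedMass l' := by
    unfold loopMass
    congr!
  rw [h4, Finset.sum_congr rfl h1, Finset.sum_const, nsmul_eq_mul]
  calc _ ≤ (l.length : ℝ≥0) * (Γ.loopWt l / l.length) := mul_le_mul' h3 le_rfl
    _ = Γ.loopWt l := mul_div_cancel₀ _ hlen.ne'

theorem coe_prod_zipWith {v y : Γ.verts} {t : List Γ.verts}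
    (h : List.IsChain (fun a b => Γ.StepIn D a b ∧ b ∉ T) (v :: (t ++ [y]))) :
    (((List.zipWith Γ.q (v :: t) (t ++ [y])).prod : ℝ≥0) : ℝ≥0∞) = Γ.pathWt D T v (t ++ [y]) := by
  induction t generalizing v with
  | nil =>
    simp only [List.nil_append, List.isChain_cons_cons] at h
    simp [pathWt, killStep, h.1.1, h.1.2, coe_q]
  | cons u t ih =>
    simp only [List.cons_append, List.isChain_cons_cons] at h
    have := ih h.2
    simp only [List.cons_append, List.zipWith_cons_cons, List.prod_cons, ENNReal.coe_mul] at this ⊢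
    rw [this, pathWt, killStep, if_pos h.1, coe_q]

/-- The mass of an unrooted loop is at most the weight of any of its words. -/
theorem loopMass_le_pathWt {c : Cycle Γ.verts} {y : Γ.verts} {t : List Γ.verts}
    (hc : ((y :: t : List Γ.verts) : Cycle Γ.verts) = c) (hch : c.Chain (Γ.StepIn D))
    (hT : ∀ u ∈ c, u ∉ T) : (Γ.loopMass c : ℝ≥0∞) ≤ Γ.pathWt D T y (t ++ [y]) := by
  subst hc
  rw [Cycle.chain_coe_cons] at hch
  have h : List.IsChain (fun a b => Γ.StepIn D a b ∧ b ∉ T) (y :: (t ++ [y])) := by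
    have hmem : ∀ u ∈ y :: (t ++ [y]), u ∉ T := by
      intro u hu
      refine hT u ?_
      simpa [or_comm, or_assoc] using hu
    have h2 : ∀ (L : List Γ.verts), (∀ u ∈ L, u ∉ T) → List.IsChain (Γ.StepIn D) L →
        List.IsChain (fun a b => Γ.StepIn D a b ∧ b ∉ T) L := by
      intro L
      induction L with
      | nil => intro _ _; exact List.isChain_nil
      | cons a L ih =>
        intro hL hc
        cases L with
        | nil => exact List.isChain_singleton _
        | cons b L =>
          rw [List.isChain_cons_cons] at hc ⊢
          exact ⟨⟨hc.1, hL b (by simp)⟩, ih (fun u hu => hL u (by simp [hu])) hc.2⟩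
    exact h2 _ hmem hch
  rw [← coe_prod_zipWith h]
  refine ENNReal.coe_le_coe.2 ((loopMass_le_loopWt (y :: t) (by simp)).trans (le_of_eq ?_))
  simp [loopWt]

theorem Upcrossing.of_forall_mem {A B : Set ℂ} {y : Γ.verts} (hy : (y : ℂ) ∉ B)
    {L : List Γ.verts} (hL : ∀ u ∈ L, (u : ℂ) ∈ B) : Upcrossing A B y true (L ++ [y]) := by
  induction L with
  | nil => simp [Upcrossing, hy]
  | cons u L ih =>
    simp only [List.cons_append, Upcrossing, hL u (by simp), if_true]
    exact ih fun w hw => hL w (by simp [hw])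

theorem Upcrossing.append {A B : Set ℂ} (hAB : A ⊆ B) {y a : Γ.verts} (ha : (a : ℂ) ∈ A)
    {L R : List Γ.verts} (hR : Upcrossing A B y true R) (b : Bool) :
    Upcrossing A B y b (L ++ a :: R) := by
  induction L generalizing b with
  | nil => cases b <;> simp [Upcrossing, ha, hAB ha, hR]
  | cons u L ih =>
    cases b
    · exact ih _
    · simp only [List.cons_append, Upcrossing]
      split_ifs
      · exact ih _
      · exact Or.inr (ih _)

theorem exists_first_notMem {B : Set ℂ} (L : List Γ.verts) (h : ∃ u ∈ L, (u : ℂ) ∉ B) :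
    ∃ (L₁ : List Γ.verts) (y : Γ.verts) (L₂ : List Γ.verts),
      L = L₁ ++ y :: L₂ ∧ (y : ℂ) ∉ B ∧ ∀ u ∈ L₁, (u : ℂ) ∈ B := by
  induction L with
  | nil => simp at h
  | cons a L ih =>
    by_cases ha : (a : ℂ) ∈ B
    · obtain ⟨u, hu, huB⟩ := h
      have : u ∈ L := by
        rcases List.mem_cons.1 hu with rfl | h
        · exact absurd ha huB
        · exact h
      obtain ⟨L₁, y, L₂, rfl, h1, h2⟩ := ih ⟨u, this, huB⟩
      refine ⟨a :: L₁, y, L₂, rfl, h1, fun w hw => ?_⟩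
      rcases List.mem_cons.1 hw with rfl | h
      · exact ha
      · exact h2 w h
    · exact ⟨[], a, L, rfl, ha, by simp⟩

/-- A loop that visits `A` and the complement of `B` can be rooted at the end of a passage. -/
theorem exists_upcrossing_word {A B : Set ℂ} (hAB : A ⊆ B) (c : Cycle Γ.verts)
    (hA : ∃ u ∈ c, (u : ℂ) ∈ A) (hB : ∃ u ∈ c, (u : ℂ) ∉ B) :
    ∃ (y : Γ.verts) (t : List Γ.verts), ((y :: t : List Γ.verts) : Cycle Γ.verts) = c ∧
      (y : ℂ) ∉ B ∧ Upcrossing A B y false (t ++ [y]) := by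
  induction c using Quotient.inductionOn' with
  | h l =>
    change (∃ u ∈ (l : Cycle Γ.verts), (u : ℂ) ∈ A) at hA
    change (∃ u ∈ (l : Cycle Γ.verts), (u : ℂ) ∉ B) at hB
    simp only [Cycle.mem_coe_iff] at hA hB
    obtain ⟨a, hal, ha⟩ := hA
    obtain ⟨s, t, rfl⟩ := List.append_of_mem hal
    obtain ⟨u, hu, huB⟩ := hB
    have hua : u ∈ t ++ s := by
      simp only [List.mem_append, List.mem_cons] at hu ⊢
      rcases hu with h | rfl | h
      · exact Or.inr h
      · exact absurd (hAB ha) huB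
      · exact Or.inl h
    -- Following the loop from `a ∈ A`, let `y` be the first vertex outside `B`; read from `y`, the
    -- loop ends with the passage `a, L₁, y`.
    obtain ⟨L₁, y, L₂, hL, hy, hL₁⟩ := exists_first_notMem (t ++ s) ⟨u, hua, huB⟩
    refine ⟨y, L₂ ++ a :: L₁, ?_, hy, ?_⟩
    · refine Cycle.coe_eq_coe.2 ?_
      have h1 : (s ++ a :: t) ~r (a :: t ++ s) := List.isRotated_append
      have h2 : (a :: t ++ s) = (a :: L₁) ++ (y :: L₂) := by
        rw [List.cons_append, hL, List.cons_append]
      have h3 : ((a :: L₁) ++ (y :: L₂)) ~r (y :: L₂ ++ a :: L₁) := List.isRotated_append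
      rw [h2] at h1
      exact (h1.trans h3).symm
    · rw [List.append_assoc, List.cons_append]
      exact Upcrossing.append hAB ha (Upcrossing.of_forall_mem hy hL₁) false

/-- The mass of the loops that avoid `T` and cross an annulus. -/
theorem Crosses.tsum_loopMass_le {ρ : ℝ} (hρ : 0 < ρ) {a : ℝ≥0∞} (ha : a ≠ 0)
    (h : Γ.Crosses ρ a) (hD : ∀ s ∉ D, HasLog D s) (hT : Γ.IsNet D T ρ) {m : ℕ}
    (hm : 2 * (1 - a ^ 13) ^ m ≤ 1) {z : ℂ} {r : ℝ} (hr : 8 * ρ ≤ r)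
    (hr' : 14 * ρ * m + ρ / 2 ≤ r) :
    ∑' c : Γ.DiscreteLoop D, {c : Γ.DiscreteLoop D | (∀ u ∈ c.1, u ∉ T) ∧
        (∃ u ∈ c.1, (u : ℂ) ∈ Metric.closedBall z (ρ / 2)) ∧
        ∃ u ∈ c.1, (u : ℂ) ∉ Metric.ball z r}.indicator (fun c => (Γ.loopMass c.1 : ℝ≥0∞)) c ≤
      2 * (1 - a ^ 13) ^ m * (a ^ 13)⁻¹ := by
  classical
  set A := Metric.closedBall z (ρ / 2) with hA
  set B := Metric.ball z r with hB
  have hAB : A ⊆ B := Metric.closedBall_subset_ball (by linarith)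
  set S := {c : Γ.DiscreteLoop D | (∀ u ∈ c.1, u ∉ T) ∧ (∃ u ∈ c.1, (u : ℂ) ∈ A) ∧
    ∃ u ∈ c.1, (u : ℂ) ∉ B} with hS
  rw [← tsum_subtype S fun c => (Γ.loopMass c.1 : ℝ≥0∞)]
  rcases isEmpty_or_nonempty S with hemp | ⟨⟨c₀, hc₀⟩⟩
  · simp
  -- Any vertex of `A` serves as the reference point of the Harnack inequality; without one there is
  -- no loop to count.
  obtain ⟨w₀, -, hw₀⟩ := hc₀.2.1
  have hword : ∀ c : S, ∃ (y : Γ.verts) (t : List Γ.verts),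
      ((y :: t : List Γ.verts) : Cycle Γ.verts) = c.1.1 ∧
      (y : ℂ) ∉ B ∧ Upcrossing A B y false (t ++ [y]) := fun c =>
    exists_upcrossing_word hAB c.1.1 c.2.2.1 c.2.2.2
  choose y t hyt hyB hup using hword
  have hyD : ∀ c, (y c : ℂ) ∈ D ∧ y c ∉ T := by
    intro c
    refine ⟨?_, c.2.1 _ (by rw [← hyt c]; simp)⟩
    have := c.1.2.2
    rw [← hyt c, Cycle.chain_coe_cons] at this
    cases ht : t c with
    | nil =>
      rw [ht] at this
      simp only [List.nil_append, List.isChain_cons_cons] at this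
      exact this.1.left_mem
    | cons u l =>
      rw [ht] at this
      simp only [List.cons_append, List.isChain_cons_cons] at this
      exact this.1.left_mem
  set s : ℝ≥0∞ := (1 - a ^ 13) ^ m with hs
  -- From outside `B` the walk must cover at least `r - ρ / 2 ≥ 14 ρ m` to reach `A`.
  have hg : ∀ u : Γ.verts, (u : ℂ) ∈ D → (u : ℂ) ∉ B → Γ.hitProb D T A u ≤ s := by
    intro u huD huB
    refine le_trans (measure_mono ?_) (h.escape hρ ha hD hT m huD)
    rintro x ⟨n, h1, h2⟩
    refine ⟨n, h1, ?_⟩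
    change (x n : ℂ) ∈ A at h2
    change 14 * ρ * m ≤ dist (x n : ℂ) u
    rw [hA, Metric.mem_closedBall] at h2
    rw [hB, Metric.mem_ball, not_lt] at huB
    linarith [dist_triangle_left (u : ℂ) z (x n), dist_comm (x n : ℂ) z]
  have ha13 : a ^ 13 ≠ 0 := pow_ne_zero _ ha
  have ha1 : a ^ 13 ≠ ∞ := by
    refine ne_top_of_le_ne_top ENNReal.one_ne_top ((h.tour hρ w₀).trans prob_le_one)
  have hM : ∀ y : Γ.verts, (y : ℂ) ∉ B → ∀ w : Γ.verts, (w : ℂ) ∈ A →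
      Γ.exitProb B y w ≤ (a ^ 13)⁻¹ * Γ.exitProb B y w₀ := by
    intro y hy w hw
    rw [mul_comm, ← div_eq_mul_inv, ENNReal.le_div_iff_mul_le (Or.inl ha13) (Or.inl ha1), mul_comm]
    exact h.harnack hρ ha hr hy hw hw₀
  set F : {y : Γ.verts // (y : ℂ) ∉ B} × List Γ.verts → ℝ≥0∞ := fun p =>
    if (p.1 : ℂ) ∈ D ∧ p.1.1 ∉ T then
      {L | Upcrossing A B p.1.1 false L}.indicator (Γ.pathWt D T p.1.1) p.2 else 0 with hF
  have hinj : Function.Injective fun c : S =>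
      ((⟨y c, hyB c⟩, t c ++ [y c]) : {y : Γ.verts // (y : ℂ) ∉ B} × List Γ.verts) := by
    intro c c' hcc
    simp only [Prod.mk.injEq, Subtype.mk.injEq] at hcc
    obtain ⟨h1, h2⟩ := hcc
    rw [h1, List.append_cancel_right_eq] at h2
    refine Subtype.ext (Subtype.ext ?_)
    rw [← hyt c, ← hyt c', h1, h2]
  -- With the bound `M` proportional to the exit probability from `w₀`, the sum over `y` costs
  -- nothing, however many exit vertices there are.
  calc ∑' c : S, (Γ.loopMass c.1.1 : ℝ≥0∞)
      ≤ ∑' c : S, F (⟨y c, hyB c⟩, t c ++ [y c]) := by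
        refine ENNReal.tsum_le_tsum fun c => ?_
        simp only [hF, hyD c, not_false_eq_true, and_self, if_true]
        rw [indicator_of_mem (show t c ++ [y c] ∈ {L | Upcrossing A B (y c) false L} from hup c)]
        exact loopMass_le_pathWt (hyt c) c.1.2.2 c.2.1
    _ ≤ ∑' p, F p := ENNReal.tsum_comp_le_tsum_of_injective hinj F
    _ = ∑' y, ∑' L, F (y, L) := ENNReal.tsum_prod'
    _ ≤ ∑' y : {y : Γ.verts // (y : ℂ) ∉ B}, 2 * s * ((a ^ 13)⁻¹ * Γ.exitProb B y w₀) := by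
        refine ENNReal.tsum_le_tsum fun y => ?_
        by_cases hy : (y : ℂ) ∈ D ∧ y.1 ∉ T
        · simp only [hF, hy, not_false_eq_true, and_self, if_true]
          exact tsum_upcrossing_le hAB hm hg y.2 (hM y y.2) hy.1 hy.2
        · simp [hF, hy]
    _ ≤ 2 * s * (a ^ 13)⁻¹ := by
        simp_rw [← mul_assoc]
        rw [ENNReal.tsum_mul_left]
        exact mul_le_of_le_one_right' (tsum_exitProb_le B w₀)

end PlaneGraph

end

noncomputable section

namespace PlaneGraph

variable {Γ : PlaneGraph} {D : Set ℂ}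

/-! ### The total mass of the loops -/

/-- The total weight of the words of length `n` that can be read from `v`. -/
def wordSum (Γ : PlaneGraph) (D : Set ℂ) (n : ℕ) (v : Γ.verts) : ℝ≥0∞ :=
  ∑' L, {L : List Γ.verts | L.length = n}.indicator (Γ.pathWt D ∅ v) L

theorem wordSum_succ (n : ℕ) (v : Γ.verts) :
    Γ.wordSum D (n + 1) v = ∑' u, Γ.killStep D ∅ v u * Γ.wordSum D n u := by
  rw [wordSum, tsum_list, indicator_of_notMem (by simp), zero_add]
  refine tsum_congr fun u => ?_
  rw [wordSum, ← ENNReal.tsum_mul_left]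
  refine tsum_congr fun L => ?_
  simp [indicator, pathWt]

/-- The walk makes `n` steps in `D`. -/
def stepsIn (Γ : PlaneGraph) (D : Set ℂ) (n : ℕ) : Set (ℕ → Γ.verts) :=
  {x | ∀ i < n, Γ.StepIn D (x i) (x (i + 1))}

theorem measurableSet_stepsIn (n : ℕ) : MeasurableSet (Γ.stepsIn D n) :=
  DependsUpTo.measurableSet (n := n) fun _ _ hxy hx i hi => by
    rw [← hxy i hi.le, ← hxy (i + 1) hi]; exact hx i hi

/-- The Markov property for words: the first `k` letters contribute the probability of `k` steps in
`D`. -/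
theorem wordSum_add_le (k n : ℕ) (v : Γ.verts) :
    Γ.wordSum D (n + k) v ≤ Γ.walkLaw v (Γ.stepsIn D k) * ⨆ u, Γ.wordSum D n u := by
  induction k generalizing v with
  | zero =>
    have : Γ.stepsIn D 0 = univ := by ext; simp [stepsIn]
    rw [this, measure_univ, one_mul]
    exact le_iSup (Γ.wordSum D n) v
  | succ k ih =>
    rw [← add_assoc, wordSum_succ]
    refine (ENNReal.tsum_le_tsum fun u => mul_le_mul' le_rfl (ih u)).trans ?_
    simp_rw [← mul_assoc]
    rw [ENNReal.tsum_mul_right]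
    refine mul_le_mul' ((tsum_killStep_mul_le (measurableSet_stepsIn k)).trans
      (measure_mono ?_)) le_rfl
    rintro x ⟨-, h1, h2⟩ i hi
    rcases Nat.eq_zero_or_pos i with rfl | h0
    · exact h1
    · have := h2 (i - 1) (by omega)
      rw [shiftSeq, shiftSeq, ← add_assoc, Nat.add_sub_cancel' h0] at this
      exact this

/-- The walk is almost surely killed, and the finitely many vertices of `D` allow a common `k`. -/
theorem Crosses.exists_stepsIn_le {ρ : ℝ} (hρ : 0 < ρ) {a : ℝ≥0∞} (ha : a ≠ 0) (h : Γ.Crosses ρ a)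
    (hD : Bornology.IsBounded D) : ∃ k, 0 < k ∧ ∀ v, Γ.walkLaw v (Γ.stepsIn D k) ≤ 2⁻¹ := by
  have h1 : ∀ v : Γ.verts, ∃ k, Γ.walkLaw v (Γ.stepsIn D k) ≤ 2⁻¹ := by
    intro v
    have h2 : Antitone (Γ.stepsIn D) := fun m n hmn x hx i hi => hx i (hi.trans_le hmn)
    have h3 := tendsto_measure_iInter_atTop (μ := Γ.walkLaw v)
      (fun n => (measurableSet_stepsIn (Γ := Γ) (D := D) n).nullMeasurableSet) h2
      ⟨0, measure_ne_top _ _⟩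
    have h4 : Γ.walkLaw v (⋂ n, Γ.stepsIn D n) = 0 := by
      refine measure_mono_null (fun x hx => ?_) (h.ae_killed hρ ha hD v)
      rintro ⟨n, hn⟩
      exact hn (mem_iInter.1 hx (n + 1) n (Nat.lt_succ_self n))
    rw [h4] at h3
    exact ((h3.eventually_le_const (by simp : (0 : ℝ≥0∞) < 2⁻¹))).exists
  choose k hk using h1
  have hf := finite_verts_of_bounded (Γ := Γ) hD
  refine ⟨hf.toFinset.sup k + 1, Nat.succ_pos _, fun v => ?_⟩
  by_cases hv : (v : ℂ) ∈ D
  · refine (measure_mono ?_).trans (hk v)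
    have : k v ≤ hf.toFinset.sup k := Finset.le_sup (by simpa using hv)
    exact fun x hx i hi => hx i (by omega)
  · refine (measure_mono_null (fun x hx => ?_) (Γ.walkLaw_start v)).le.trans zero_le
    rintro (h0 : x 0 = v)
    exact hv (h0 ▸ (hx 0 (Nat.succ_pos _)).left_mem)

theorem Crosses.tsum_pathWt_ne_top {ρ : ℝ} (hρ : 0 < ρ) {a : ℝ≥0∞} (ha : a ≠ 0)
    (h : Γ.Crosses ρ a) (hD : Bornology.IsBounded D) (v : Γ.verts) :
    ∑' L, Γ.pathWt D ∅ v L ≠ ∞ := by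
  obtain ⟨k, hk0, hk⟩ := h.exists_stepsIn_le hρ ha hD
  set s : ℕ → ℝ≥0∞ := fun n => ⨆ u, Γ.wordSum D n u with hs
  have hsk : ∀ n, s (n + k) ≤ 2⁻¹ * s n := fun n =>
    iSup_le fun u => (wordSum_add_le k n u).trans (mul_le_mul' (hk u) le_rfl)
  have hs0 : s 0 ≤ 1 := by
    refine iSup_le fun u => ?_
    have : ∀ L : List Γ.verts, {L : List Γ.verts | L.length = 0}.indicator (Γ.pathWt D ∅ u) L =
        if L = [] then 1 else 0 := by
      intro L
      by_cases hL : L = []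
      · simp [hL, pathWt]
      · simp [hL]
    rw [wordSum, tsum_congr this]
    exact (tsum_ite_eq [] fun _ => (1 : ℝ≥0∞)).le
  have hs1 : ∀ n, s n ≤ 1 := fun n => iSup_le fun u => by
    have := wordSum_add_le (D := D) n 0 u
    rw [zero_add] at this
    exact this.trans (mul_le_one' prob_le_one hs0)
  -- The terms are at most 1 and halve every `k` steps, so a partial sum `σ` satisfies `σ ≤ k + σ /
  -- 2`; it is finite and can be cancelled.
  have hsum : ∀ N, ∑ n ∈ Finset.range N, s n ≤ 2 * k := by
    intro N
    have hfin : ∑ n ∈ Finset.range N, s n ≠ ∞ :=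
      ENNReal.sum_ne_top.2 fun n _ => ne_top_of_le_ne_top ENNReal.one_ne_top (hs1 n)
    have h1 : ∑ n ∈ Finset.range N, s n ≤ k + 2⁻¹ * ∑ n ∈ Finset.range N, s n := by
      calc ∑ n ∈ Finset.range N, s n ≤ ∑ n ∈ Finset.range (k + N), s n :=
            Finset.sum_le_sum_of_subset (Finset.range_mono (by omega))
        _ = ∑ n ∈ Finset.range k, s n + ∑ n ∈ Finset.range N, s (k + n) :=
            Finset.sum_range_add _ _ _
        _ ≤ ∑ n ∈ Finset.range k, 1 + ∑ n ∈ Finset.range N, 2⁻¹ * s n := by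
            refine add_le_add (Finset.sum_le_sum fun n _ => hs1 n) (Finset.sum_le_sum fun n _ => ?_)
            rw [add_comm]; exact hsk n
        _ = _ := by rw [← Finset.mul_sum]; simp
    have h2 : 2 * ∑ n ∈ Finset.range N, s n ≤ 2 * k + ∑ n ∈ Finset.range N, s n := by
      refine (mul_le_mul' (le_refl 2) h1).trans (le_of_eq ?_)
      rw [mul_add, ← mul_assoc, ENNReal.mul_inv_cancel (by simp) (by simp), one_mul]
    rw [two_mul] at h2
    exact (ENNReal.add_le_add_iff_right hfin).1 h2
  have h3 : ∑' L, Γ.pathWt D ∅ v L = ∑' n, Γ.wordSum D n v := by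
    unfold wordSum
    rw [ENNReal.tsum_comm]
    refine tsum_congr fun L => ?_
    rw [tsum_eq_single L.length]
    · simp
    · intro n hn
      exact indicator_of_notMem (s := {L : List Γ.verts | L.length = n}) (fun h => hn h.symm) _
  rw [h3]
  refine ne_top_of_le_ne_top (b := 2 * (k : ℝ≥0∞)) (by finiteness) ?_
  rw [ENNReal.tsum_eq_iSup_nat]
  exact iSup_le fun N => (Finset.sum_le_sum fun n _ => le_iSup (Γ.wordSum D n) v).trans (hsum N)

/-- The random walk loop measure of a bounded domain is finite. -/
theorem Crosses.tsum_loopMass_ne_top {ρ : ℝ} (hρ : 0 < ρ) {a : ℝ≥0∞} (ha : a ≠ 0)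
    (h : Γ.Crosses ρ a) (hD : Bornology.IsBounded D) :
    ∑' c : Γ.DiscreteLoop D, (Γ.loopMass c.1 : ℝ≥0∞) ≠ ∞ := by
  have hf := finite_verts_of_bounded (Γ := Γ) hD
  have := hf.fintype
  have hhead : ∀ c : Γ.DiscreteLoop D, ((c.word.head c.word_ne_nil : Γ.verts) : ℂ) ∈ D := by
    intro c
    have h1 := c.isChain_word
    cases ht : c.word.tail with
    | nil =>
      rw [ht] at h1
      simp only [List.cons_append, List.nil_append, List.isChain_cons_cons] at h1
      exact h1.1.left_mem
    | cons u l =>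
      rw [ht] at h1
      simp only [List.cons_append, List.isChain_cons_cons] at h1
      exact h1.1.left_mem
  set F : {v : Γ.verts // v ∈ {v : Γ.verts | (v : ℂ) ∈ D}} × List Γ.verts → ℝ≥0∞ :=
    fun p => Γ.pathWt D ∅ p.1 p.2
  set g : Γ.DiscreteLoop D → {v : Γ.verts // v ∈ {v : Γ.verts | (v : ℂ) ∈ D}} × List Γ.verts :=
    fun c => (⟨c.word.head c.word_ne_nil, hhead c⟩, c.word.tail ++ [c.word.head c.word_ne_nil])
  have hg : Function.Injective g := by
    intro c c' hcc
    simp only [g, Prod.mk.injEq, Subtype.mk.injEq] at hcc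
    obtain ⟨h1, h2⟩ := hcc
    rw [h1, List.append_cancel_right_eq] at h2
    refine Subtype.ext ?_
    rw [← c.coe_word, ← c'.coe_word, ← List.cons_head_tail c.word_ne_nil,
      ← List.cons_head_tail c'.word_ne_nil, h1, h2]
  refine ne_top_of_le_ne_top ?_ ((ENNReal.tsum_le_tsum fun c : Γ.DiscreteLoop D =>
    (?_ : (Γ.loopMass c.1 : ℝ≥0∞) ≤ F (g c))).trans (ENNReal.tsum_comp_le_tsum_of_injective hg F))
  · rw [ENNReal.tsum_prod', tsum_fintype]
    exact ENNReal.sum_ne_top.2 fun v _ => h.tsum_pathWt_ne_top hρ ha hD v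
  · refine loopMass_le_pathWt ?_ c.2.2 fun u _ => notMem_empty u
    rw [List.cons_head_tail, c.coe_word]

/-! ### The loop soup is almost surely finite -/

instance : Countable (Γ.DiscreteLoop D) := by
  unfold DiscreteLoop Cycle
  infer_instance

/-- This is `1 - exp (-r) ≤ r`; masses of sets of loops thereby bound probabilities. -/
theorem poissonMeasure_ne_zero_le (r : ℝ≥0) : poissonMeasure r {n | n ≠ 0} ≤ r := by
  have h : {n : ℕ | n ≠ 0} = {0}ᶜ := rfl
  rw [h, prob_compl_eq_one_sub (measurableSet_singleton 0), poissonMeasure_singleton]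
  simp only [pow_zero, mul_one, Nat.factorial_zero, Nat.cast_one, div_one]
  rw [tsub_le_iff_right, ← ENNReal.ofReal_coe_nnreal, ← ENNReal.ofReal_one,
    ← ENNReal.ofReal_add r.coe_nonneg (Real.exp_pos _).le]
  refine ENNReal.ofReal_le_ofReal ?_
  have := Real.add_one_le_exp (-(r : ℝ))
  linarith

instance : IsProbabilityMeasure (Γ.countLaw D) := by unfold countLaw; infer_instance

theorem countLaw_ne_zero_le (c : Γ.DiscreteLoop D) :
    Γ.countLaw D {N | N c ≠ 0} ≤ Γ.loopMass c.1 := by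
  refine le_trans (le_of_eq ?_) (poissonMeasure_ne_zero_le _)
  have h := Measure.infinitePi_map_eval (fun c : Γ.DiscreteLoop D => poissonMeasure (Γ.loopMass c.1)) c
  rw [← h, Measure.map_apply (measurable_pi_apply c) (MeasurableSet.of_discrete)]
  rfl

theorem countLaw_exists_le (S : Set (Γ.DiscreteLoop D)) :
    Γ.countLaw D {N | ∃ c ∈ S, N c ≠ 0} ≤
      ∑' c : Γ.DiscreteLoop D, S.indicator (fun c => (Γ.loopMass c.1 : ℝ≥0∞)) c := by
  rw [← tsum_subtype S fun c => (Γ.loopMass c.1 : ℝ≥0∞)]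
  refine le_trans (le_of_eq ?_) ((measure_iUnion_le fun c : S => {N : Γ.DiscreteLoop D → ℕ | N c ≠ 0}).trans
    (ENNReal.tsum_le_tsum fun c => countLaw_ne_zero_le c.1))
  congr 1
  ext N
  simp

/-- The Borel–Cantelli lemma. -/
theorem ae_finite_support (h : ∑' c : Γ.DiscreteLoop D, (Γ.loopMass c.1 : ℝ≥0∞) ≠ ∞) :
    ∀ᵐ N ∂Γ.countLaw D, N.support.Finite :=
  ae_finite_setOfPred_mem (ne_top_of_le_ne_top h (ENNReal.tsum_le_tsum fun c => countLaw_ne_zero_le c))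

end PlaneGraph

end

noncomputable section

/-! ### Removing small loops from a soup; measurability and couplings -/

namespace LoopSeq

variable {D : Set ℂ}

theorem ofList_apply_lt (z : D) {L : List (LoopIn D)} {n : ℕ} (h : n < L.length) :
    (ofList z L).1 n = L[n] := List.getD_eq_getElem _ _ h

theorem diam_ofList_of_le (z : D) {L : List (LoopIn D)} {n : ℕ} (h : L.length ≤ n) :
    ((ofList z L).1 n).diam = 0 := by
  have : (ofList z L).1 n = LoopIn.const z := List.getD_eq_default _ _ h
  rw [this, LoopIn.diam_const]

/-- Makes the arbitrary order in which `soup` lists the loops harmless. -/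
theorem edist_ofList_of_perm (z : D) {L L' : List (LoopIn D)} (h : L.Perm L') :
    edist (ofList z L) (ofList z L') = 0 := by
  classical
  refine le_antisymm ?_ zero_le
  set m : ℕ → ℕ := fun i => if hi : i < L.length then h.idxBij ⟨i, hi⟩ else i with hm
  have hmi : ∀ i (hi : i < L.length), m i = h.idxBij ⟨i, hi⟩ := fun i hi => by simp only [hm, hi, dif_pos]
  have hinj : InjOn m (Finset.range L.length) := by
    intro i hi j hj hij
    simp only [Finset.coe_range, mem_Iio] at hi hj
    rw [hmi i hi, hmi j hj] at hij
    have := h.idxBij_injective (Fin.ext hij)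
    exact congrArg Fin.val this
  refine (edist_le_cost _ _ hinj).trans ((cost_le_iff _ _ _ _ _).2 ⟨?_, ?_, ?_⟩)
  · intro i hi
    rw [Finset.mem_range] at hi
    rw [ofList_apply_lt z hi, hmi i hi, ofList_apply_lt z (h.idxBij ⟨i, hi⟩).2,
      h.getElem_idxBij_eq_getElem ⟨i, hi⟩, edist_self]
  · intro i hi
    rw [Finset.mem_range, not_lt] at hi
    simp [diam_ofList_of_le z hi]
  · intro j hj
    by_cases hj' : j < L'.length
    · refine absurd ?_ hj
      rw [Finset.mem_image]
      refine ⟨h.symm.idxBij ⟨j, hj'⟩, ?_, ?_⟩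
      · exact Finset.mem_range.2 (h.symm.idxBij ⟨j, hj'⟩).2
      · rw [hmi _ (h.symm.idxBij ⟨j, hj'⟩).2, Fin.eta, h.idxBij_idxBij_symm]
    · simp [diam_ofList_of_le z (not_lt.1 hj')]

/-- Match the common loops with themselves; each other loop is unmatched and costs half its
diameter. -/
theorem edist_ofList_append_le (z : D) {L₁ L₂ : List (LoopIn D)} {r : ℝ≥0∞}
    (h : ∀ γ ∈ L₂, γ.diam / 2 ≤ r) : edist (ofList z (L₁ ++ L₂)) (ofList z L₁) ≤ r := by
  refine (edist_le_cost _ _ (J := Finset.range L₁.length) (m := id) (injOn_id _)).trans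
    ((cost_le_iff _ _ _ _ _).2 ⟨?_, ?_, ?_⟩)
  · intro i hi
    rw [Finset.mem_range] at hi
    rw [id, ofList_apply_lt z hi, ofList_apply_lt z (by simp; omega), List.getElem_append_left hi,
      edist_self]
    exact zero_le
  · intro i hi
    rw [Finset.mem_range, not_lt] at hi
    by_cases hi' : i < (L₁ ++ L₂).length
    · rw [ofList_apply_lt z hi', List.getElem_append_right hi]
      exact h _ (List.getElem_mem _)
    · simp [diam_ofList_of_le z (not_lt.1 hi')]
  · intro j hj
    rw [Finset.image_id, Finset.mem_range, not_lt] at hj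
    simp [diam_ofList_of_le z hj]

end LoopSeq

theorem LoopSoup.edist_ofList_le {D : Set ℂ} (z : D) {L L' L₂ : List (LoopIn D)} {r : ℝ≥0∞}
    (hL : L.Perm (L' ++ L₂)) (h : ∀ γ ∈ L₂, γ.diam / 2 ≤ r) :
    edist (LoopSoup.ofList z L) (LoopSoup.ofList z L') ≤ r := by
  have h1 : edist (LoopSoup.ofList z L) (LoopSoup.ofList z L') =
      edist (LoopSeq.ofList z L) (LoopSeq.ofList z L') := SeparationQuotient.edist_mk _ _
  rw [h1]
  refine (edist_triangle _ _ _).trans ((add_le_add (LoopSeq.edist_ofList_of_perm z hL).le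
    (LoopSeq.edist_ofList_append_le z h)).trans (by rw [zero_add]))

namespace PlaneGraph

variable {Γ : PlaneGraph} {D : Set ℂ}

/-- The multiplicities split into those of the loops that visit `T` and those of the others, so up
to order one list is the other followed by small loops. -/
theorem edist_soup_attachedTo_le (hD : D.Nonempty) {N : Γ.DiscreteLoop D → ℕ}
    (hN : N.support.Finite) (T : Set Γ.verts) {r : ℝ≥0∞}
    (h : ∀ c : Γ.DiscreteLoop D, N c ≠ 0 → (∀ u ∈ c.1, u ∉ T) → c.toLoop.diam / 2 ≤ r) :
    edist (soup hD N) (soup hD (attachedTo T N)) ≤ r := by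
  classical
  have hN' : (attachedTo T N).support.Finite := hN.subset fun c hc hc' => hc (by
    simp only [attachedTo, hc', ite_self])
  set R : Γ.DiscreteLoop D → ℕ := fun c => if ∃ u ∈ T, u ∈ c.1 then 0 else N c with hR
  have hRf : R.support.Finite := hN.subset fun c hc hc' => hc (by simp only [hR, hc', ite_self])
  have hsum : Finsupp.ofSupportFinite N hN =
      Finsupp.ofSupportFinite (attachedTo T N) hN' + Finsupp.ofSupportFinite R hRf := by
    ext c
    simp only [Finsupp.coe_add, Pi.add_apply, Finsupp.ofSupportFinite_coe, attachedTo, hR]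
    by_cases hc : ∃ u ∈ T, u ∈ c.1
    · simp only [if_pos hc, add_zero]
    · simp only [if_neg hc, zero_add]
  unfold soup
  rw [dif_pos hN, dif_pos hN']
  refine LoopSoup.edist_ofList_le _ (L₂ :=
    ((Finsupp.toMultiset (Finsupp.ofSupportFinite R hRf)).toList.map DiscreteLoop.toLoop)) ?_ ?_
  · rw [← List.map_append]
    refine List.Perm.map _ ?_
    rw [← Multiset.coe_eq_coe, ← Multiset.coe_add]
    simp only [Multiset.coe_toList]
    rw [hsum, map_add]
  · intro γ hγ
    obtain ⟨c, hc, rfl⟩ := List.mem_map.1 hγ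
    rw [Multiset.mem_toList, Finsupp.mem_toMultiset, Finsupp.mem_support_iff,
      Finsupp.ofSupportFinite_coe] at hc
    simp only [hR] at hc
    by_cases hcT : ∃ u ∈ T, u ∈ c.1
    · rw [if_pos hcT] at hc; exact absurd rfl hc
    · rw [if_neg hcT] at hc
      exact h c hc fun u hu huT => hcT ⟨u, huT, hu⟩

/-- The finitely supported multiplicities form a countable set, off which the map is constant;
nothing is required of the choices of roots and orders. -/
theorem measurable_soup (hD : D.Nonempty) : Measurable (soup (Γ := Γ) hD) := by
  have hcount : {N : Γ.DiscreteLoop D → ℕ | N.support.Finite}.Countable := by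
    refine (countable_range fun f : Γ.DiscreteLoop D →₀ ℕ => (f : Γ.DiscreteLoop D → ℕ)).mono ?_
    intro N hN
    exact ⟨Finsupp.ofSupportFinite N hN, rfl⟩
  intro B _
  rw [← inter_union_compl (soup hD ⁻¹' B) {N : Γ.DiscreteLoop D → ℕ | N.support.Finite}]
  refine (hcount.mono inter_subset_right).measurableSet.union ?_
  have h2 : ∀ N : Γ.DiscreteLoop D → ℕ, ¬ N.support.Finite →
      soup hD N = LoopSoup.ofList ⟨hD.some, hD.some_mem⟩ [] := fun N hN => by
    unfold soup; rw [dif_neg hN]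
  by_cases hB : LoopSoup.ofList ⟨hD.some, hD.some_mem⟩ [] ∈ B
  · convert hcount.measurableSet.compl using 1
    refine inter_eq_right.2 fun N hN => ?_
    rw [mem_preimage, h2 N hN]; exact hB
  · convert MeasurableSet.empty
    refine eq_empty_of_forall_notMem fun N hN => hB ?_
    rw [← h2 N hN.2]; exact hN.1

theorem measurable_attachedTo (T : Set Γ.verts) :
    Measurable (attachedTo (D := D) T) := by
  classical
  refine measurable_pi_iff.2 fun c => ?_
  unfold attachedTo
  split_ifs
  · exact measurable_pi_apply c
  · exact measurable_const

instance : IsProbabilityMeasure Γ.wilsonLaw := by unfold wilsonLaw; infer_instance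

instance : IsProbabilityMeasure (Γ.jointLaw D) := by unfold jointLaw; infer_instance

end PlaneGraph

/-- A coupling bounds the Lévy–Prokhorov distance. -/
theorem levyProkhorovEDist_map_le {Ω E : Type*} [MeasurableSpace Ω] [PseudoEMetricSpace E]
    [MeasurableSpace E] [OpensMeasurableSpace E] {μ : Measure Ω} [IsProbabilityMeasure μ]
    {f g : Ω → E} (hf : Measurable f) (hg : Measurable g) {r : ℝ≥0∞}
    (h : μ {x | ¬ edist (f x) (g x) ≤ r} ≤ r) :
    levyProkhorovEDist (μ.map f) (μ.map g) ≤ r := by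
  have := Measure.isProbabilityMeasure_map (μ := μ) hf.aemeasurable
  have := Measure.isProbabilityMeasure_map (μ := μ) hg.aemeasurable
  refine levyProkhorovEDist_le_of_forall_le _ _ _ fun s B hrs hs hB => ?_
  rw [Measure.map_apply hf hB, Measure.map_apply hg Metric.isOpen_thickening.measurableSet]
  refine (measure_mono (t := g ⁻¹' Metric.thickening s.toReal B ∪ {x | ¬ edist (f x) (g x) ≤ r})
    fun x hx => ?_).trans ((measure_union_le _ _).trans (add_le_add le_rfl (h.trans hrs.le)))
  by_cases hx' : edist (f x) (g x) ≤ r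
  · refine Or.inl ?_
    rw [mem_preimage, Metric.mem_thickening_iff_exists_edist_lt]
    refine ⟨f x, hx, ?_⟩
    rw [edist_comm, ENNReal.ofReal_toReal hs.ne]
    exact hx'.trans_lt hrs
  · exact Or.inr hx'

end

noncomputable section

namespace PlaneGraph

/-! ### Loop erasure -/

theorem loopErase_head? {V : Type*} (l : List V) : (loopErase l).head? = l.head? := by
  cases l with
  | nil => rw [loopErase]
  | cons v l => rw [loopErase]; simp

theorem exists_eq_append_afterLast {V : Type*} (v : V) (l : List V) :
    ∃ l', v :: l = l' ++ v :: afterLast v l := by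
  classical
  induction l using List.reverseRecOn with
  | nil => exact ⟨[], by simp [afterLast]⟩
  | append_singleton l a ih =>
    unfold afterLast at ih ⊢
    by_cases ha : a = v
    · subst ha
      rw [List.rtakeWhile_concat_neg _ _ _ (by simp)]
      exact ⟨a :: l, by simp⟩
    · rw [List.rtakeWhile_concat_pos _ _ _ (by simpa using ha)]
      obtain ⟨l', hl'⟩ := ih
      refine ⟨l', ?_⟩
      rw [← List.cons_append, hl']
      simp

/-- The loop erasure of a path is a path with the same end. -/
theorem isChain_loopErase {V : Type*} {r : V → V → Prop} (l : List V) (h : List.IsChain r l) :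
    List.IsChain r (loopErase l) ∧ (loopErase l).getLast? = l.getLast? := by
  induction hn : l.length using Nat.strong_induction_on generalizing l with
  | _ n ih =>
    cases l with
    | nil => rw [loopErase]; exact ⟨List.isChain_nil, rfl⟩
    | cons v l =>
      obtain ⟨l', hl'⟩ := exists_eq_append_afterLast v l
      have h1 : List.IsChain r (v :: afterLast v l) := by
        rw [hl'] at h
        exact h.right_of_append
      have hlt : (afterLast v l).length < n := by
        rw [← hn]; exact Nat.lt_succ_of_le (length_afterLast_le v l)
      obtain ⟨h2, h3⟩ := ih _ hlt (afterLast v l) h1.tail rfl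
      have h4 : (v :: l).getLast? = (v :: afterLast v l).getLast? := by
        rw [hl', List.getLast?_append, List.getLast?_cons, Option.some_or]
      rw [h4, loopErase]
      refine ⟨?_, ?_⟩
      · rw [List.isChain_cons] at h1 ⊢
        refine ⟨fun y hy => h1.1 y ?_, h2⟩
        rwa [loopErase_head?] at hy
      · rw [List.getLast?_cons, List.getLast?_cons, h3]

variable {Γ : PlaneGraph} {D : Set ℂ} {T : Set Γ.verts}

theorem Exits.of_step {u u' : Γ.verts} (hu : u ∈ T) (huu : Γ.weight u u' ≠ 0)
    (h : Γ.Exits D T u') : Γ.Exits D T u := by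
  obtain ⟨h1, b, b', h2, h3⟩ := h
  exact ⟨hu, b, b', h2.head ⟨huu, h1⟩, h3⟩

theorem exits_of_isChain {L : List Γ.verts} (hL : List.IsChain (fun u v => Γ.weight u v ≠ 0) L)
    (hT : ∀ u ∈ L, u ∈ T) (hlast : ∀ u ∈ L.getLast?, Γ.Exits D T u) : ∀ u ∈ L, Γ.Exits D T u := by
  induction L with
  | nil => simp
  | cons v L ih =>
    cases L with
    | nil => simpa using hlast
    | cons w L =>
      have h1 := ih hL.tail (fun u hu => hT u (List.mem_cons_of_mem _ hu))
        (by simpa [List.getLast?_cons] using hlast)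
      rw [List.isChain_cons_cons] at hL
      intro u hu
      rcases List.mem_cons.1 hu with rfl | hu
      · exact (h1 w (by simp)).of_step (hT _ (by simp)) hL.1
      · exact h1 u hu

/-! ### Wilson's algorithm -/

/-- The properties that the walks have almost surely. -/
def IsKilledWalk (Γ : PlaneGraph) (D : Set ℂ) (v : Γ.verts) (x : ℕ → Γ.verts) : Prop :=
  x 0 = v ∧ (∀ n, Γ.weight (x n) (x (n + 1)) ≠ 0) ∧ ∃ n, ¬ Γ.StepIn D (x n) (x (n + 1))

theorem Crosses.ae_isKilledWalk {ρ : ℝ} (hρ : 0 < ρ) {a : ℝ≥0∞} (ha : a ≠ 0) (h : Γ.Crosses ρ a)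
    (hD : Bornology.IsBounded D) : ∀ᵐ X ∂Γ.wilsonLaw, ∀ v, Γ.IsKilledWalk D v (X v) := by
  rw [ae_all_iff]
  intro v
  have h1 : ∀ᵐ x ∂Γ.walkLaw v, Γ.IsKilledWalk D v x := by
    filter_upwards [Γ.walkLaw_start v, Γ.walkLaw_edges v, h.ae_killed hρ ha hD v] with x h1 h2 h3
    exact ⟨h1, h2, h3⟩
  exact (measurePreserving_eval_infinitePi Γ.walkLaw v).quasiMeasurePreserving.ae h1

theorem IsKilledWalk.start_mem_branch {v : Γ.verts} {x : ℕ → Γ.verts} (h : Γ.IsKilledWalk D v x) :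
    v ∈ Γ.branch D T x := by
  have h1 : (Γ.branch D T x).head? = some v := by
    rw [branch, loopErase_head?, List.head?_map, List.head?_range]
    simp [h.1]
  exact List.mem_of_mem_head? h1

/-- A branch is a path of the graph whose last vertex is in `T`, whence a path already leaves `D`,
or is followed by a step out of `D`. -/
theorem IsKilledWalk.exits {v : Γ.verts} {x : ℕ → Γ.verts} (h : Γ.IsKilledWalk D v x)
    (hT : ∀ u ∈ T, Γ.Exits D T u) :
    ∀ u ∈ T ∪ {u | u ∈ Γ.branch D T x}, Γ.Exits D (T ∪ {u | u ∈ Γ.branch D T x}) u := by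
  set T' := T ∪ {u | u ∈ Γ.branch D T x} with hT'
  rintro u (hu | hu)
  · exact (hT u hu).mono subset_union_left
  set n := Γ.stopIndex D T x with hn
  have hend : x n ∈ T ∨ ¬ Γ.StepIn D (x n) (x (n + 1)) := by
    -- The walk is killed, so `stopIndex` is not the default value of an empty infimum.
    have : {n | x n ∈ T ∨ ¬ Γ.StepIn D (x n) (x (n + 1))}.Nonempty :=
      h.2.2.imp fun n hn => Or.inr hn
    exact Nat.sInf_mem this
  have hchain : List.IsChain (fun u v => Γ.weight u v ≠ 0) ((List.range (n + 1)).map x) := by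
    rw [List.isChain_map, List.isChain_range]
    intro m _
    exact h.2.1 m
  obtain ⟨h1, h2⟩ := isChain_loopErase _ hchain
  have hlast : ((List.range (n + 1)).map x).getLast? = some (x n) := by
    rw [List.range_succ]; simp
  rw [hlast] at h2
  have hnT : x n ∈ T' := Or.inr (List.mem_of_mem_getLast? h2)
  refine exits_of_isChain h1 (fun w hw => Or.inr hw) (fun w hw => ?_) u hu
  rw [h2] at hw
  obtain rfl : x n = w := by simpa using hw
  rcases hend with hs | hs
  · exact (hT _ hs).mono subset_union_left
  · exact ⟨hnT, x n, x (n + 1), .refl, h.2.1 n, fun hD => hs ⟨h.2.1 n, hD⟩⟩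

open scoped Classical in
/-- The set sampled after at most `j` new branches. -/
def sampled (Γ : PlaneGraph) (D : Set ℂ) (X : Γ.verts → ℕ → Γ.verts) :
    ℕ → Set Γ.verts → List Γ.verts → Set Γ.verts
  | _, T, [] => T
  | 0, T, _ :: _ => T
  | j + 1, T, v :: l =>
    if v ∈ T then sampled Γ D X (j + 1) T l
    else sampled Γ D X j (T ∪ {u | u ∈ Γ.branch D T (X v)}) l

theorem sampled_eq (X : Γ.verts → ℕ → Γ.verts) (j : ℕ) (T : Set Γ.verts) (l : List Γ.verts) :
    Γ.sampled D X j T l = T ∪ {u | ∃ b ∈ (Γ.wilson D X T l).take j, u ∈ Γ.branch D b.2 (X b.1)} := by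
  induction l generalizing j T with
  | nil => simp [sampled, wilson]
  | cons v l ih =>
    cases j with
    | zero => simp [sampled]
    | succ j =>
      rw [sampled, wilson]
      split_ifs with hv
      · exact ih _ _
      · rw [ih, union_assoc]
        congr 1
        ext u
        simp

theorem firstBranches_eq (X : Γ.verts → ℕ → Γ.verts) (ord : List Γ.verts) (j : ℕ) :
    Γ.firstBranches D ord X j = Γ.sampled D X j ∅ ord := by
  rw [sampled_eq, empty_union]; rfl

theorem subset_sampled (X : Γ.verts → ℕ → Γ.verts) (j : ℕ) (T : Set Γ.verts) (l : List Γ.verts) :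
    T ⊆ Γ.sampled D X j T l := by
  rw [sampled_eq]; exact subset_union_left

theorem exits_sampled {X : Γ.verts → ℕ → Γ.verts} (hX : ∀ v, Γ.IsKilledWalk D v (X v)) (j : ℕ)
    {T : Set Γ.verts} (hT : ∀ u ∈ T, Γ.Exits D T u) (l : List Γ.verts) :
    ∀ u ∈ Γ.sampled D X j T l, Γ.Exits D (Γ.sampled D X j T l) u := by
  induction l generalizing j T with
  | nil => simpa [sampled] using hT
  | cons v l ih =>
    cases j with
    | zero => simpa [sampled] using hT
    | succ j =>
      rw [sampled]
      split_ifs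
      · exact ih _ hT
      · exact ih _ ((hX v).exits hT)

/-- An examined vertex is already sampled or starts a branch that contains it, so `j` branches
dispose of at least `j` vertices (or of the whole list). -/
theorem take_subset_sampled {X : Γ.verts → ℕ → Γ.verts} (hX : ∀ v, Γ.IsKilledWalk D v (X v)) (j : ℕ)
    (T : Set Γ.verts) (l : List Γ.verts) : ∀ u ∈ l.take j, u ∈ Γ.sampled D X j T l := by
  induction l generalizing j T with
  | nil => simp
  | cons v l ih =>
    cases j with
    | zero => simp
    | succ j =>
      intro u hu
      rw [List.take_succ_cons, List.mem_cons] at hu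
      rw [sampled]
      split_ifs with hv
      · rcases hu with rfl | hu
        · exact subset_sampled X _ _ _ hv
        · exact ih (j + 1) T u ((List.take_subset_take_left l (Nat.le_succ j)) hu)
      · rcases hu with rfl | hu
        · exact subset_sampled X _ _ _ (Or.inr (hX u).start_mem_branch)
        · exact ih j _ u hu

/-- Only the walks from the vertices of the list are used; this is the source of independence. -/
theorem sampled_congr {X Y : Γ.verts → ℕ → Γ.verts} (j : ℕ) (T : Set Γ.verts) {l : List Γ.verts}
    (h : ∀ v ∈ l, X v = Y v) : Γ.sampled D X j T l = Γ.sampled D Y j T l := by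
  induction l generalizing j T with
  | nil => simp [sampled]
  | cons v l ih =>
    have h1 : ∀ v ∈ l, X v = Y v := fun v hv => h v (List.mem_cons_of_mem _ hv)
    cases j with
    | zero => simp [sampled]
    | succ j =>
      rw [sampled, sampled, h v (by simp), ih _ _ h1, ih _ _ h1]

/-- The later walks start after the first vertices of the ordering, and are stopped in the set
sampled before. -/
theorem exists_of_mem_drop_wilson (X : Γ.verts → ℕ → Γ.verts) (j : ℕ) (T : Set Γ.verts)
    (l : List Γ.verts) (b : Γ.verts × Set Γ.verts) (hb : b ∈ (Γ.wilson D X T l).drop j) :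
    ∃ l₁ l₂, l = l₁ ++ b.1 :: l₂ ∧ j ≤ l₁.length ∧ b.2 = Γ.sampled D X l₁.length T l₁ ∧
      b.1 ∉ b.2 := by
  induction l generalizing j T with
  | nil => simp [wilson] at hb
  | cons v l ih =>
    rw [wilson] at hb
    split_ifs at hb with hv
    · obtain ⟨l₁, l₂, rfl, h1, h2, h3⟩ := ih j T hb
      refine ⟨v :: l₁, l₂, rfl, h1.trans (by simp), ?_, h3⟩
      -- A list yields at most as many branches as it has vertices, so the extra allowed branch
      -- changes nothing.
      rw [List.length_cons, sampled, if_pos hv, h2, sampled_eq, sampled_eq, List.take_of_length_le,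
        List.take_of_length_le]
      all_goals
        have h4 : ∀ (l : List Γ.verts) (T : Set Γ.verts), (Γ.wilson D X T l).length ≤ l.length := by
          intro l
          induction l with
          | nil => simp [wilson]
          | cons v l ih =>
            intro T
            rw [wilson]
            split_ifs
            · exact (ih T).trans (by simp)
            · simpa using ih _
        have := h4 l₁ T
        omega
    · cases j with
      | zero =>
        rw [List.drop_zero, List.mem_cons] at hb
        rcases hb with rfl | hb
        · exact ⟨[], l, rfl, le_rfl, by simp [sampled], hv⟩
        · obtain ⟨l₁, l₂, rfl, h1, h2, h3⟩ := ih 0 _ (by simpa using hb)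
          exact ⟨v :: l₁, l₂, rfl, Nat.zero_le _, by rw [List.length_cons, sampled, if_neg hv, h2], h3⟩
      | succ j =>
        rw [List.drop_succ_cons] at hb
        obtain ⟨l₁, l₂, rfl, h1, h2, h3⟩ := ih j _ hb
        exact ⟨v :: l₁, l₂, rfl, by simpa using h1,
          by rw [List.length_cons, sampled, if_neg hv, h2], h3⟩

/-! ### Measurability and independence -/

theorem measurableSet_stopIndex (D : Set ℂ) (T : Set Γ.verts) (n : ℕ) :
    MeasurableSet {x : ℕ → Γ.verts | Γ.stopIndex D T x = n} := by
  have hP : ∀ m, MeasurableSet {x : ℕ → Γ.verts | x m ∈ T ∨ ¬ Γ.StepIn D (x m) (x (m + 1))} :=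
    fun m => DependsUpTo.measurableSet (n := m + 1) fun x y h hx => by
      rw [← h m (Nat.le_succ m), ← h (m + 1) le_rfl]; exact hx
  -- The second set accounts for walks that never stop, whose index is `sInf ∅ = 0`.
  have : {x : ℕ → Γ.verts | Γ.stopIndex D T x = n} =
      ({x | x n ∈ T ∨ ¬ Γ.StepIn D (x n) (x (n + 1))} ∩
        ⋂ m, ⋂ _ : m < n, {x | x m ∈ T ∨ ¬ Γ.StepIn D (x m) (x (m + 1))}ᶜ) ∪
      ({x | n = 0} ∩ ⋂ m, {x | x m ∈ T ∨ ¬ Γ.StepIn D (x m) (x (m + 1))}ᶜ) := by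
    ext x
    constructor
    · intro hx
      change sInf {n | x n ∈ T ∨ ¬ Γ.StepIn D (x n) (x (n + 1))} = n at hx
      rcases eq_empty_or_nonempty {n | x n ∈ T ∨ ¬ Γ.StepIn D (x n) (x (n + 1))} with he | he
      · rw [he, Nat.sInf_empty] at hx
        refine Or.inr ⟨hx.symm, mem_iInter.2 fun m hm => ?_⟩
        exact eq_empty_iff_forall_notMem.1 he m hm
      · refine Or.inl ⟨?_, mem_iInter₂.2 fun m hm h => ?_⟩
        · rw [← hx]; exact Nat.sInf_mem he
        · rw [← hx] at hm
          exact Nat.notMem_of_lt_sInf hm h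
    · rintro (⟨h1, h2⟩ | ⟨h1, h2⟩)
      · change sInf {n | x n ∈ T ∨ ¬ Γ.StepIn D (x n) (x (n + 1))} = n
        refine le_antisymm (Nat.sInf_le h1) ?_
        by_contra hlt
        have h3 : sInf {n | x n ∈ T ∨ ¬ Γ.StepIn D (x n) (x (n + 1))} ∈
            {n | x n ∈ T ∨ ¬ Γ.StepIn D (x n) (x (n + 1))} := Nat.sInf_mem ⟨n, h1⟩
        exact mem_iInter₂.1 h2 _ (not_le.1 hlt) h3
      · change sInf {n | x n ∈ T ∨ ¬ Γ.StepIn D (x n) (x (n + 1))} = n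
        have : {n | x n ∈ T ∨ ¬ Γ.StepIn D (x n) (x (n + 1))} = ∅ :=
          eq_empty_iff_forall_notMem.2 fun m hm => mem_iInter.1 h2 m hm
        rw [this, Nat.sInf_empty]
        exact Eq.symm h1
  rw [this]
  exact ((hP n).inter (MeasurableSet.iInter fun m => MeasurableSet.iInter fun _ => (hP m).compl)).union
    ((MeasurableSet.const _).inter (MeasurableSet.iInter fun m => (hP m).compl))

theorem measurableSet_branch (D : Set ℂ) (T : Set Γ.verts) (L : List Γ.verts) :
    MeasurableSet {x : ℕ → Γ.verts | Γ.branch D T x = L} := by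
  have : {x : ℕ → Γ.verts | Γ.branch D T x = L} =
      ⋃ n, {x : ℕ → Γ.verts | Γ.stopIndex D T x = n} ∩
        {x | loopErase ((List.range (n + 1)).map x) = L} := by
    ext x
    simp [branch]
  rw [this]
  refine MeasurableSet.iUnion fun n => (measurableSet_stopIndex D T n).inter
    (DependsUpTo.measurableSet (n := n) fun x y h hx => ?_)
  have : (List.range (n + 1)).map x = (List.range (n + 1)).map y :=
    List.map_congr_left fun i hi => h i (by simpa [Nat.lt_succ_iff] using hi)
  rw [← this]; exact hx

theorem measurableSet_sampled (D : Set ℂ) (j : ℕ) (T : Set Γ.verts) (l : List Γ.verts)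
    (A : Set Γ.verts) : MeasurableSet {X : Γ.verts → ℕ → Γ.verts | Γ.sampled D X j T l = A} := by
  induction l generalizing j T with
  | nil => simp only [sampled]; exact MeasurableSet.const _
  | cons v l ih =>
    cases j with
    | zero => simp only [sampled]; exact MeasurableSet.const _
    | succ j =>
      simp only [sampled]
      by_cases hv : v ∈ T
      · simp only [if_pos hv]; exact ih _ _
      · simp only [if_neg hv]
        have : {X : Γ.verts → ℕ → Γ.verts |
            Γ.sampled D X j (T ∪ {u | u ∈ Γ.branch D T (X v)}) l = A} =
            ⋃ L : List Γ.verts, ((fun X : Γ.verts → ℕ → Γ.verts => X v) ⁻¹'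
              {x | Γ.branch D T x = L}) ∩ {X | Γ.sampled D X j (T ∪ {u | u ∈ L}) l = A} := by
          ext X
          simp
        rw [this]
        exact MeasurableSet.iUnion fun L =>
          ((measurableSet_branch D T L).preimage (measurable_pi_apply v)).inter (ih _ _)

theorem finite_sampled (X : Γ.verts → ℕ → Γ.verts) (j : ℕ) {T : Set Γ.verts} (hT : T.Finite)
    (l : List Γ.verts) : (Γ.sampled D X j T l).Finite := by
  induction l generalizing j T with
  | nil => simpa [sampled] using hT
  | cons v l ih =>
    cases j with
    | zero => simpa [sampled] using hT
    | succ j =>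
      rw [sampled]
      split_ifs
      · exact ih _ hT
      · exact ih _ (hT.union (List.finite_toSet _))

/-- The walk from `v` is independent of the set sampled from other vertices. -/
theorem wilsonLaw_sampled_inter (D : Set ℂ) (j : ℕ) {l : List Γ.verts} {v : Γ.verts} (hv : v ∉ l)
    (A : Set Γ.verts) {E : Set (ℕ → Γ.verts)} (hE : MeasurableSet E) :
    Γ.wilsonLaw {X | Γ.sampled D X j ∅ l = A ∧ X v ∈ E} =
      Γ.wilsonLaw {X | Γ.sampled D X j ∅ l = A} * Γ.walkLaw v E := by
  classical
  have hind : iIndepFun (fun (i : Γ.verts) (X : Γ.verts → ℕ → Γ.verts) => X i) Γ.wilsonLaw :=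
    iIndepFun_infinitePi (P := Γ.walkLaw) (X := fun _ x => x) fun _ => measurable_id
  have h1 := hind.indepFun_finset l.toFinset {v} (by simpa using hv) fun i => measurable_pi_apply i
  -- Dummy walks from the other vertices turn the sampled set into a function of the walks from `l`.
  let e : ((i : l.toFinset) → ℕ → Γ.verts) → Γ.verts → ℕ → Γ.verts :=
    fun Y i => if hi : i ∈ l.toFinset then Y ⟨i, hi⟩ else fun _ => v
  have he : Measurable e := by
    refine measurable_pi_iff.2 fun i => ?_
    by_cases hi : i ∈ l.toFinset
    · simp only [e, hi, dif_pos]; exact measurable_pi_apply _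
    · simp only [e, hi, dif_neg, not_false_eq_true]; exact measurable_const
  have hs : ∀ X, Γ.sampled D (e fun i : l.toFinset => X i) j ∅ l = Γ.sampled D X j ∅ l := by
    intro X
    refine sampled_congr j ∅ fun u hu => ?_
    simp [e, hu]
  have h2 := h1.measure_inter_preimage_eq_mul {Y | Γ.sampled D (e Y) j ∅ l = A}
    {Y | Y ⟨v, by simp⟩ ∈ E} ((measurableSet_sampled D j ∅ l A).preimage he)
    (hE.preimage (measurable_pi_apply _))
  have h3 : (fun (X : Γ.verts → ℕ → Γ.verts) (i : l.toFinset) => X i) ⁻¹'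
      {Y | Γ.sampled D (e Y) j ∅ l = A} = {X | Γ.sampled D X j ∅ l = A} := by
    ext X
    change Γ.sampled D (e fun i : l.toFinset => X i) j ∅ l = A ↔ _
    rw [hs]; rfl
  rw [h3] at h2
  refine h2.trans ?_
  congr 1
  rw [← (measurePreserving_eval_infinitePi Γ.walkLaw v).measure_preimage hE.nullMeasurableSet]
  rfl

/-- A bound for the walk from `v` stopped in a deterministic set yields one for the walk of
Wilson's algorithm. -/
theorem wilsonLaw_le_of_forall (D : Set ℂ) (j : ℕ) {l : List Γ.verts} {v : Γ.verts} (hv : v ∉ l)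
    (P : Set Γ.verts → Prop) {E : Set Γ.verts → Set (ℕ → Γ.verts)} (hE : ∀ A, MeasurableSet (E A))
    {r : ℝ≥0∞} (h : ∀ A, P A → Γ.walkLaw v (E A) ≤ r) :
    Γ.wilsonLaw {X | P (Γ.sampled D X j ∅ l) ∧ X v ∈ E (Γ.sampled D X j ∅ l)} ≤ r := by
  -- Sampled sets are finite, so they take countably many values and one may condition on each.
  have hsub : {X | P (Γ.sampled D X j ∅ l) ∧ X v ∈ E (Γ.sampled D X j ∅ l)} ⊆
      ⋃ A : {A : Finset Γ.verts // P A}, {X | Γ.sampled D X j ∅ l = A ∧ X v ∈ E A} := by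
    rintro X ⟨h1, h2⟩
    have hf := finite_sampled (D := D) X j finite_empty l
    refine mem_iUnion.2 ⟨⟨hf.toFinset, by simpa using h1⟩, ?_⟩
    simpa using h2
  have hdisj : Pairwise (Function.onFun Disjoint fun A : {A : Finset Γ.verts // P A} =>
      {X : Γ.verts → ℕ → Γ.verts | Γ.sampled D X j ∅ l = (A.1 : Set Γ.verts)}) := by
    intro A B hAB
    refine disjoint_left.2 fun X (h1 : _ = _) (h2 : _ = _) => hAB (Subtype.ext ?_)
    exact Finset.coe_injective (h1.symm.trans h2)
  calc _ ≤ ∑' A : {A : Finset Γ.verts // P A},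
        Γ.wilsonLaw {X | Γ.sampled D X j ∅ l = (A.1 : Set Γ.verts) ∧ X v ∈ E A.1} :=
        (measure_mono hsub).trans (measure_iUnion_le _)
    _ ≤ ∑' A : {A : Finset Γ.verts // P A},
        Γ.wilsonLaw {X | Γ.sampled D X j ∅ l = (A.1 : Set Γ.verts)} * r := by
        refine ENNReal.tsum_le_tsum fun A => ?_
        rw [wilsonLaw_sampled_inter D j hv _ (hE _)]
        exact mul_le_mul' le_rfl (h _ A.2)
    _ ≤ r := by
        rw [ENNReal.tsum_mul_right, ← measure_iUnion hdisj fun A => measurableSet_sampled D j ∅ l _]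
        exact mul_le_of_le_one_left' prob_le_one

theorem measurable_rwls (hD : D.Nonempty) : Measurable (Γ.rwls hD) :=
  (measurable_soup hD).comp measurable_snd

theorem measurable_rwlsAttached (hD : D.Nonempty) (ord : List Γ.verts) (j : ℕ) :
    Measurable (Γ.rwlsAttached hD ord j) := by
  intro B hB
  have : Γ.rwlsAttached hD ord j ⁻¹' B = ⋃ A : Finset Γ.verts,
      {X | Γ.sampled D X j ∅ ord = A} ×ˢ
        ((fun N => soup hD (attachedTo (A : Set Γ.verts) N)) ⁻¹' B) := by
    ext ⟨X, N⟩
    simp only [rwlsAttached, firstBranches_eq, mem_preimage, mem_iUnion, mem_prod, mem_ofPred_eq]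
    constructor
    · intro h
      have hf := finite_sampled (D := D) X j finite_empty ord
      exact ⟨hf.toFinset, by simp, by simpa using h⟩
    · rintro ⟨A, h1, h2⟩
      rwa [h1]
  rw [this]
  exact MeasurableSet.iUnion fun A => (measurableSet_sampled D j ∅ ord _).prod
    (hB.preimage ((measurable_soup hD).comp (measurable_attachedTo _)))

end PlaneGraph

end

noncomputable section

theorem ediam_le_of_subset_ball {s : Set ℂ} {z : ℂ} {r : ℝ} (h : s ⊆ Metric.ball z r) :
    Metric.ediam s ≤ 2 * ENNReal.ofReal r := by
  refine (Metric.ediam_mono (fun x hx => ?_)).trans (Metric.ediam_closedEBall_le (x := z))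
  rw [Metric.mem_closedEBall, edist_dist]
  exact ENNReal.ofReal_le_ofReal (Metric.mem_ball.1 (h hx)).le

namespace PlaneGraph

variable {Γ : PlaneGraph} {D : Set ℂ}

/-! ### Cells -/

/-- The cells of `6⁻ⁱ ℤ²` in the square of half side `A`. -/
def cells (A i : ℕ) : Finset (ℤ × ℤ) :=
  Finset.Ico (-(A * 6 ^ i : ℤ)) (A * 6 ^ i) ×ˢ Finset.Ico (-(A * 6 ^ i : ℤ)) (A * 6 ^ i)

theorem card_cells (A i : ℕ) : (cells A i).card = 4 * A ^ 2 * 36 ^ i := by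
  have h : (Finset.Ico (-(A * 6 ^ i : ℤ)) (A * 6 ^ i)).card = 2 * A * 6 ^ i := by
    rw [Int.card_Ico, sub_neg_eq_add]
    have : (A * 6 ^ i + A * 6 ^ i : ℤ) = ((2 * A * 6 ^ i : ℕ) : ℤ) := by push_cast; ring
    rw [this, Int.toNat_natCast]
  rw [cells, Finset.card_product, h]
  have : (36 : ℕ) ^ i = 6 ^ i * 6 ^ i := by rw [← mul_pow]; norm_num
  rw [this]; ring

theorem cell_mem_cells {A : ℕ} (i : ℕ) {z : ℂ} (hz : z ∈ Metric.ball (0 : ℂ) A) :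
    cell i z ∈ cells A i := by
  rw [Metric.mem_ball, dist_zero_right] at hz
  have h6 : (0 : ℝ) < 6 ^ i := by positivity
  have key : ∀ t : ℝ, |t| < A → ⌊6 ^ i * t⌋ ∈ Finset.Ico (-(A * 6 ^ i : ℤ)) (A * 6 ^ i) := by
    intro t ht
    rw [abs_lt] at ht
    rw [Finset.mem_Ico, Int.le_floor, Int.floor_lt]
    push_cast
    constructor <;> nlinarith
  exact Finset.mem_product.2 ⟨key _ ((Complex.abs_re_le_norm z).trans_lt hz),
    key _ ((Complex.abs_im_le_norm z).trans_lt hz)⟩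

theorem abs_sub_cellCenter_le (i : ℕ) (z : ℂ) :
    |z.re - (cellCenter i (cell i z)).re| ≤ 6⁻¹ ^ i / 2 ∧
      |z.im - (cellCenter i (cell i z)).im| ≤ 6⁻¹ ^ i / 2 := by
  have h6 : (0 : ℝ) < 6 ^ i := by positivity
  have key : ∀ t : ℝ, |t - (⌊6 ^ i * t⌋ + 1 / 2) / 6 ^ i| ≤ (6 : ℝ)⁻¹ ^ i / 2 := by
    intro t
    have h1 := Int.floor_le (6 ^ i * t)
    have h2 := Int.lt_floor_add_one (6 ^ i * t)
    have h3 : t - (⌊6 ^ i * t⌋ + 1 / 2) / 6 ^ i = (6 ^ i * t - (⌊6 ^ i * t⌋ + 1 / 2)) / 6 ^ i := by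
      field_simp
    rw [h3, inv_pow, abs_div, abs_of_pos h6, div_le_iff₀ h6, div_mul_eq_mul_div,
      inv_mul_cancel₀ h6.ne', abs_le]
    constructor <;> linarith
  exact ⟨key z.re, key z.im⟩

theorem dist_cellCenter_lt (i : ℕ) (z : ℂ) : dist z (cellCenter i (cell i z)) < 6⁻¹ ^ i := by
  obtain ⟨h1, h2⟩ := abs_sub_cellCenter_le i z
  have h6 : (0 : ℝ) < 6⁻¹ ^ i := by positivity
  rw [abs_le] at h1 h2
  rw [Complex.dist_eq_re_im, Real.sqrt_lt' h6]
  nlinarith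

theorem abs_sub_le_of_cell_eq {i : ℕ} {z w : ℂ} (h : cell i w = cell i z) :
    |w.re - z.re| ≤ 6⁻¹ ^ i ∧ |w.im - z.im| ≤ 6⁻¹ ^ i := by
  obtain ⟨h1, h2⟩ := abs_sub_cellCenter_le i z
  obtain ⟨h3, h4⟩ := abs_sub_cellCenter_le i w
  rw [h] at h3 h4
  rw [abs_le] at h1 h2 h3 h4
  constructor <;> rw [abs_le] <;> constructor <;> linarith

/-! ### The Good Ordering -/

theorem unchosen_subset (D : Set ℂ) (i : ℕ) : Γ.unchosen D i ⊆ {v | (v : ℂ) ∈ D} := by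
  induction i with
  | zero => exact le_rfl
  | succ i ih => exact sdiff_subset.trans ih

theorem mem_unchosen_iff {i : ℕ} {v : Γ.verts} :
    v ∈ Γ.unchosen D i ↔ (v : ℂ) ∈ D ∧ ∀ k < i, v ∉ Γ.Q D k := by
  induction i with
  | zero => simp [unchosen]
  | succ i ih =>
    change (v ∈ Γ.unchosen D i ∧ v ∉ Γ.Q D i) ↔ _
    rw [ih, and_assoc, and_congr_right_iff]
    intro _
    constructor
    · rintro ⟨h1, h2⟩ k hk
      rcases Nat.lt_succ_iff_lt_or_eq.1 hk with h | rfl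
      · exact h1 k h
      · exact h2
    · exact fun h => ⟨fun k hk => h k (Nat.lt_succ_of_lt hk), h i (Nat.lt_succ_self i)⟩

theorem mem_of_mem_Q {i : ℕ} {v : Γ.verts} (h : v ∈ Γ.Q D i) : (v : ℂ) ∈ D :=
  unchosen_subset D i h.1

theorem Q_level_unique {i k : ℕ} {v : Γ.verts} (hi : v ∈ Γ.Q D i) (hk : v ∈ Γ.Q D k) : i = k := by
  rcases lt_trichotomy i k with h | h | h
  · exact absurd hi ((mem_unchosen_iff.1 hk.1).2 i h)
  · exact h
  · exact absurd hk ((mem_unchosen_iff.1 hi.1).2 k h)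

/-- The tie-breaking order includes the coordinates, so it separates distinct vertices. -/
theorem eq_of_cell_eq {i : ℕ} {v w : Γ.verts} (hv : v ∈ Γ.Q D i) (hw : w ∈ Γ.Q D i)
    (h : cell i (v : ℂ) = cell i (w : ℂ)) : v = w := by
  have h1 := hv.2 w hw.1 h.symm
  have h2 := hw.2 v hv.1 h
  rw [h] at h1
  have h3 := le_antisymm h1 h2
  simp only [EmbeddingLike.apply_eq_iff_eq, Prod.mk.injEq] at h3
  exact Subtype.ext (Complex.ext h3.2.1 h3.2.2)

theorem exists_mem_Q (hD : Bornology.IsBounded D) {i : ℕ} {v : Γ.verts}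
    (hv : v ∈ Γ.unchosen D i) : ∃ w ∈ Γ.Q D i, cell i (w : ℂ) = cell i (v : ℂ) := by
  set S := {w ∈ Γ.unchosen D i | cell i (w : ℂ) = cell i (v : ℂ)} with hS
  have hf : S.Finite := (finite_verts_of_bounded hD).subset fun w hw => unchosen_subset D i hw.1
  obtain ⟨w, hw, hmin⟩ := exists_min_image S
    (fun w : Γ.verts => toLex (dist (w : ℂ) (cellCenter i (cell i v)),
      toLex ((w : ℂ).re, (w : ℂ).im))) hf ⟨v, hv, rfl⟩
  refine ⟨w, ⟨hw.1, fun u hu hcell => ?_⟩, hw.2⟩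
  rw [hw.2] at hcell ⊢
  exact hmin u ⟨hu, hcell⟩

theorem card_Q_le {A i : ℕ} (hA : D ⊆ Metric.ball 0 A) (F : Finset Γ.verts)
    (hF : ∀ v ∈ F, v ∈ Γ.Q D i) : F.card ≤ 4 * A ^ 2 * 36 ^ i := by
  rw [← card_cells]
  exact Finset.card_le_card_of_injOn (fun v => cell i (v : ℂ))
    (fun v hv => cell_mem_cells i (hA (mem_of_mem_Q (hF v hv))))
    fun v hv w hw h => eq_of_cell_eq (hF v hv) (hF w hw) h

/-- A cell of side `6⁻ⁱ ≤ δ` lies in the ball of radius `δ` about its centre. -/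
theorem BoundedDensity.card_le {δ : ℝ} {C : ℕ} (h : Γ.BoundedDensity δ C) {A i : ℕ}
    (hA : D ⊆ Metric.ball 0 A) (hi : 6⁻¹ ^ i ≤ δ) (F : Finset Γ.verts)
    (hF : ∀ v ∈ F, (v : ℂ) ∈ D) : F.card ≤ 4 * A ^ 2 * 36 ^ i * C := by
  classical
  rw [← card_cells]
  refine (Finset.card_le_mul_card_image_of_maps_to (f := fun v : Γ.verts => cell i (v : ℂ))
    (t := cells A i) (fun v hv => cell_mem_cells i (hA (hF v hv))) C fun c _ => ?_).trans
    (le_of_eq (mul_comm _ _))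
  have h1 : ((Finset.image Subtype.val {v ∈ F | cell i (v : ℂ) = c} : Finset ℂ) : Set ℂ) ⊆
      Γ.verts ∩ Metric.ball (cellCenter i c) δ := by
    intro z hz
    simp only [Finset.coe_image, Finset.coe_filter, mem_image] at hz
    obtain ⟨v, ⟨-, rfl⟩, rfl⟩ := hz
    exact ⟨v.2, (dist_cellCenter_lt i v).trans_le hi⟩
  have h2 := (encard_le_encard h1).trans_lt (h (cellCenter i c))
  rw [encard_coe_eq_coe_finsetCard, Finset.card_image_of_injective _ Subtype.val_injective] at h2
  exact (by exact_mod_cast h2 : _ < C).le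

theorem IsGoodOrdering.nodup {ord : List Γ.verts} (h : Γ.IsGoodOrdering D ord) : ord.Nodup := by
  refine h.2.imp ?_
  rintro v w ⟨i, k, h1, h2, h3⟩ rfl
  rcases h3 with h3 | ⟨-, h3⟩
  · exact h3.ne (Q_level_unique h1 h2)
  · exact lt_irrefl _ h3

/-- The vertices of the earlier levels come first. -/
theorem IsGoodOrdering.mem_prefix {l₁ l₂ : List Γ.verts} {v w : Γ.verts}
    (h : Γ.IsGoodOrdering D (l₁ ++ v :: l₂)) {i : ℕ} (hw : w ∈ Γ.Q D i)
    (hv : ∀ k ≤ i, v ∉ Γ.Q D k) : w ∈ l₁ := by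
  have h1 := (h.1 w).2 (mem_of_mem_Q hw)
  rw [List.mem_append, List.mem_cons] at h1
  rcases h1 with h1 | rfl | h1
  · exact h1
  · exact absurd hw (hv i le_rfl)
  · have h2 := (List.pairwise_append.1 h.2).2.1
    obtain ⟨a, b, ha, hb, hab⟩ := (List.pairwise_cons.1 h2).1 w h1
    rw [Q_level_unique hb hw] at hab
    exact absurd ha (hv a (by rcases hab with h | ⟨h, -⟩ <;> omega))

/-- The first levels are exhausted by the first vertices. -/
theorem IsGoodOrdering.length_lt {A : ℕ} (hA : D ⊆ Metric.ball 0 A) {l₁ l₂ : List Γ.verts}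
    {w : Γ.verts} (h : Γ.IsGoodOrdering D (l₁ ++ w :: l₂)) {i k : ℕ} (hki : k ≤ i)
    (hw : w ∈ Γ.Q D k) : l₁.length < ∑ a ∈ Finset.range (i + 1), 4 * A ^ 2 * 36 ^ a := by
  classical
  have h1 : ∀ u ∈ l₁ ++ [w], ∃ a ≤ i, u ∈ Γ.Q D a := by
    intro u hu
    rw [List.mem_append, List.mem_singleton] at hu
    rcases hu with hu | rfl
    · obtain ⟨a, b, ha, hb, hab⟩ := (List.pairwise_append.1 h.2).2.2 u hu w (by simp)
      rw [Q_level_unique hb hw] at hab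
      exact ⟨a, by rcases hab with h | ⟨h, -⟩ <;> omega, ha⟩
    · exact ⟨k, hki, hw⟩
  have h2 : (l₁ ++ [w]).Nodup := by
    have := h.nodup
    rw [List.append_cons] at this
    exact this.of_append_left
  have h3 : (l₁ ++ [w]).toFinset ⊆ (Finset.range (i + 1)).biUnion fun a =>
      (l₁ ++ [w]).toFinset.filter fun u => u ∈ Γ.Q D a := by
    intro u hu
    obtain ⟨a, ha, hua⟩ := h1 u (List.mem_toFinset.1 hu)
    exact Finset.mem_biUnion.2 ⟨a, Finset.mem_range.2 (by omega), Finset.mem_filter.2 ⟨hu, hua⟩⟩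
  have h4 := (Finset.card_le_card h3).trans (Finset.card_biUnion_le.trans
    (Finset.sum_le_sum fun a _ => card_Q_le hA _ fun v hv => (Finset.mem_filter.1 hv).2))
  rw [List.toFinset_card_of_nodup h2, List.length_append, List.length_singleton] at h4
  exact h4

theorem IsGoodOrdering.mem_take {A : ℕ} (hA : D ⊆ Metric.ball 0 A) {ord : List Γ.verts}
    (h : Γ.IsGoodOrdering D ord) {i k j : ℕ} (hki : k ≤ i)
    (hj : ∑ a ∈ Finset.range (i + 1), 4 * A ^ 2 * 36 ^ a ≤ j) {w : Γ.verts} (hw : w ∈ Γ.Q D k) :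
    w ∈ ord.take j := by
  obtain ⟨l₁, l₂, rfl⟩ := List.append_of_mem ((h.1 w).2 (mem_of_mem_Q hw))
  have h1 := h.length_lt hA hki hw
  rw [List.append_cons, List.take_append]
  refine List.mem_append_left _ ?_
  rw [List.take_of_length_le (by simp; omega)]
  simp

/-- A vertex outside `T` is still available at step `i`, so a vertex is picked in its cell; that one
is in `T`, at most one side of a cell away. -/
theorem isNet_of_Q_subset (hD : Bornology.IsBounded D) {T : Set Γ.verts}
    (hT : ∀ u ∈ T, Γ.Exits D T u) {i : ℕ} (hQ : ∀ k ≤ i, Γ.Q D k ⊆ T) {ρ : ℝ}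
    (hρ : 6⁻¹ ^ i ≤ ρ) : Γ.IsNet D T ρ := by
  intro v hv hvT
  have h1 : v ∈ Γ.unchosen D i := mem_unchosen_iff.2 ⟨hv, fun k hk hvk => hvT (hQ k hk.le hvk)⟩
  obtain ⟨w, hw, hcell⟩ := exists_mem_Q hD h1
  obtain ⟨h2, h3⟩ := abs_sub_le_of_cell_eq hcell
  exact ⟨w, hT w (hQ i le_rfl hw), h2.trans hρ, h3.trans hρ⟩

/-! ### Diameters -/

theorem range_curve_subset_ball {ρ : ℝ} (hρ : 0 < ρ) {a : ℝ≥0∞} (ha : a ≠ 0) (h : Γ.Crosses ρ a)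
    (c : Γ.DiscreteLoop D) {z : ℂ} {r : ℝ} (hc : ∀ u ∈ c.1, (u : ℂ) ∈ Metric.ball z r) :
    range c.toLoop.1 ⊆ Metric.ball z (r + 7 * ρ) := by
  have h1 : List.IsChain (Γ.StepIn (Metric.ball z (r + 7 * ρ)))
      (c.word.head c.word_ne_nil :: c.word.tail ++ [c.word.head c.word_ne_nil]) := by
    refine c.isChain_word.imp_of_mem_imp fun u w hu _ huw => ⟨huw.1, ?_⟩
    have hu' : u ∈ c.1 := by
      rw [← c.coe_word, Cycle.mem_coe_iff]
      rw [List.cons_head_tail, List.mem_append, List.mem_singleton] at hu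
      rcases hu with hu | rfl
      · exact hu
      · exact List.head_mem _
    refine (h.edge_subset hρ ha huw.1).trans (Metric.ball_subset_ball' ?_)
    have := hc u hu'
    rw [Metric.mem_ball] at this
    linarith
  rintro _ ⟨t, rfl⟩
  exact Γ.range_curve_subset _ _ _ h1 (loopOfPath_mem_range _ t)

theorem diam_toLoop_le {ρ : ℝ} (hρ : 0 < ρ) {a : ℝ≥0∞} (ha : a ≠ 0) (h : Γ.Crosses ρ a)
    (c : Γ.DiscreteLoop D) {z : ℂ} {r : ℝ} (hc : ∀ u ∈ c.1, (u : ℂ) ∈ Metric.ball z r) :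
    c.toLoop.diam / 2 ≤ ENNReal.ofReal (r + 7 * ρ) := by
  refine ENNReal.div_le_of_le_mul' ?_
  exact ediam_le_of_subset_ball (range_curve_subset_ball hρ ha h c hc)

theorem trace_subset {ρ : ℝ} (hρ : 0 < ρ) {a : ℝ≥0∞} (ha : a ≠ 0) (h : Γ.Crosses ρ a)
    {T : Set Γ.verts} {x : ℕ → Γ.verts} (hx : ∀ n, Γ.weight (x n) (x (n + 1)) ≠ 0) {z : ℂ} {r : ℝ}
    (hr : ∀ n, Γ.Alive D T x n → dist (x n : ℂ) z < r) :
    Γ.trace D T x ⊆ Metric.ball z (r + 7 * ρ) := by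
  intro y hy
  obtain ⟨n, hn, t, rfl, -⟩ := mem_iUnion₂.1 hy
  have h1 := h.edge_subset hρ ha (hx n) (mem_range_self t)
  have h2 := hr n hn
  rw [Metric.mem_ball] at h1 ⊢
  linarith [dist_triangle (Γ.edge (x n) (x (n + 1)) t) (x n : ℂ) z]

end PlaneGraph

end

noncomputable section

namespace PlaneGraph

variable {Γ : PlaneGraph} {D : Set ℂ}

/-! ### The later walks are small -/

/-- The sequences that move away from `v` before being killed or stopped in `T`. -/
def escapes (D : Set ℂ) (v : Γ.verts) (ρ : ℝ) (m : ℕ) (T : Set Γ.verts) : Set (ℕ → Γ.verts) :=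
  {x | ∃ n, Γ.Alive D T x n ∧ x n ∈ {u : Γ.verts | 14 * ρ * m ≤ dist (u : ℂ) v}}

/-- Without repetitions in `ord`, the prefix before `v` is determined and does not contain `v`; the
walk from `v` is then independent of the set sampled before, and `Crosses.escape` applies to each
value of that set. -/
theorem Crosses.wilsonLaw_escapes_le {ρ : ℝ} (hρ : 0 < ρ) {a : ℝ≥0∞} (ha : a ≠ 0)
    (h : Γ.Crosses ρ a) (hD : ∀ s ∉ D, HasLog D s) {ord : List Γ.verts} (hord : ord.Nodup)
    {v : Γ.verts} (hv : (v : ℂ) ∈ D) (m : ℕ) :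
    Γ.wilsonLaw {X | ∃ l₁ l₂, ord = l₁ ++ v :: l₂ ∧
        Γ.IsNet D (Γ.sampled D X l₁.length ∅ l₁) ρ ∧
        X v ∈ escapes D v ρ m (Γ.sampled D X l₁.length ∅ l₁)} ≤ (1 - a ^ 13) ^ m := by
  by_cases hex : ∃ l₁ l₂, ord = l₁ ++ v :: l₂
  · obtain ⟨l₁, l₂, rfl⟩ := hex
    have hnotin : ∀ l l', (l ++ v :: l').Nodup → v ∉ l := fun l l' hl hvl =>
      (List.nodup_append.1 hl).2.2 v hvl v (by simp) rfl
    refine le_trans (measure_mono ?_) (wilsonLaw_le_of_forall D l₁.length (hnotin _ _ hord)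
      (fun A => Γ.IsNet D A ρ) (E := escapes D v ρ m) (fun A => measurableSet_alive_and D A _)
      fun A hA => h.escape hρ ha hD hA m hv)
    rintro X ⟨l, l', heq, h1, h2⟩
    obtain ⟨rfl, -, -⟩ := (List.append_cons_inj_of_notMem (hnotin _ _ hord)
      (List.nodup_cons.1 hord.of_append_right).1).1 heq
    exact ⟨h1, h2⟩
  · refine (measure_mono_null (t := ∅) ?_ measure_empty).le.trans zero_le
    rintro X ⟨l₁, l₂, h1, -⟩
    exact hex ⟨l₁, l₂, h1⟩

theorem sum_Icc_half_pow_le (i₀ n : ℕ) :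
    ∑ i ∈ Finset.Icc i₀ n, (2⁻¹ : ℝ≥0∞) ^ i ≤ 2 * 2⁻¹ ^ i₀ := by
  calc ∑ i ∈ Finset.Icc i₀ n, (2⁻¹ : ℝ≥0∞) ^ i ≤ ∑ i ∈ Finset.Ico i₀ (i₀ + (n + 1)), 2⁻¹ ^ i :=
        Finset.sum_le_sum_of_subset fun i hi => by
          rw [Finset.mem_Icc] at hi
          rw [Finset.mem_Ico]
          omega
    _ = ∑ k ∈ Finset.range (n + 1), 2⁻¹ ^ i₀ * 2⁻¹ ^ k := by
        rw [Finset.sum_Ico_eq_sum_range]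
        simp [pow_add]
    _ ≤ ∑' k, 2⁻¹ ^ i₀ * 2⁻¹ ^ k := ENNReal.sum_le_tsum _
    _ = 2 * 2⁻¹ ^ i₀ := by
        rw [ENNReal.tsum_mul_left, ENNReal.tsum_geometric, ENNReal.one_sub_inv_two, inv_inv, mul_comm]

/-- The decay `q ^ (K * i)` of an escape probability beats the number of cells of side `6⁻ⁱ`. -/
theorem pow_mul_pow_le_half_pow {q : ℝ≥0∞} {K : ℕ} (hK : 36 * q ^ K ≤ 2⁻¹) (i : ℕ) :
    36 ^ i * q ^ (K * i) ≤ 2⁻¹ ^ i := by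
  rw [pow_mul, ← mul_pow]
  exact pow_le_pow_left₀ zero_le hK i

/-- When a walk starts from a vertex of `Q_{i+1}`, the levels up to `i` are sampled and form a net
of mesh `6⁻ⁱ`. The walk then goes to distance `14 * 6⁻ⁱ * (K * i)` with probability at most `(1 - a
^ 13) ^ (K * i)`, and at most `B * 36 ^ i` vertices are concerned; the union bound is a geometric
series from `i₀`. -/
theorem wilsonLaw_not_laterWalksSmall_le {a : ℝ≥0∞} (ha : a ≠ 0) {n : ℕ}
    (hcr : ∀ i ≤ n, Γ.Crosses (6⁻¹ ^ i) a) (hDb : Bornology.IsBounded D)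
    (hD : ∀ s ∉ D, HasLog D s) {A : ℕ} (hA : D ⊆ Metric.ball 0 A) {ord : List Γ.verts}
    (hord : Γ.IsGoodOrdering D ord) {i₀ : ℕ} (hi₀ : i₀ ≤ n) {K : ℕ}
    (hK : 36 * (1 - a ^ 13) ^ K ≤ 2⁻¹) {ε : ℝ}
    (hε : ∀ i, i₀ ≤ i → 28 * (K * i : ℕ) * 6⁻¹ ^ i + 14 * 6⁻¹ ^ i ≤ ε) {B : ℕ}
    (hB : 4 * A ^ 2 * 36 ≤ B) (hV : ∀ F : Finset Γ.verts, (∀ v ∈ F, (v : ℂ) ∈ D) →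
      F.card ≤ B * 36 ^ n) {j : ℕ} (hj : ∑ k ∈ Finset.range (i₀ + 1), 4 * A ^ 2 * 36 ^ k ≤ j) :
    Γ.wilsonLaw {X | ¬ Γ.LaterWalksSmall D ord X j ε} ≤ B * (2 * 2⁻¹ ^ i₀) := by
  classical
  set V := (finite_verts_of_bounded (Γ := Γ) hDb).toFinset with hVdef
  have hVD : ∀ v, v ∈ V ↔ (v : ℂ) ∈ D := fun v => by simp [hVdef]
  -- The last scale serves all the levels beyond `n` at once; there `hV` counts the vertices of `D`.
  set S : ℕ → Finset Γ.verts := fun i => V.filter fun v => i = n ∨ v ∈ Γ.Q D (i + 1) with hS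
  set E : ℕ → Γ.verts → Set (Γ.verts → ℕ → Γ.verts) := fun i v =>
    {X | ∃ l₁ l₂, ord = l₁ ++ v :: l₂ ∧ Γ.IsNet D (Γ.sampled D X l₁.length ∅ l₁) (6⁻¹ ^ i) ∧
      X v ∈ escapes D v (6⁻¹ ^ i) (K * i) (Γ.sampled D X l₁.length ∅ l₁)} with hE
  have hpos : ∀ i : ℕ, (0 : ℝ) < 6⁻¹ ^ i := fun i => by positivity
  have hcard : ∀ i, (S i).card ≤ B * 36 ^ i := by
    intro i
    by_cases hi : i = n
    · subst hi
      exact hV _ fun v hv => (hVD v).1 (Finset.mem_filter.1 hv).1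
    · refine (card_Q_le (i := i + 1) hA (S i) fun v hv =>
        (Finset.mem_filter.1 hv).2.resolve_left hi).trans ?_
      rw [pow_succ' 36, ← mul_assoc]
      exact Nat.mul_le_mul_right _ hB
  have hsub : Γ.wilsonLaw {X | ¬ Γ.LaterWalksSmall D ord X j ε} ≤
      Γ.wilsonLaw (⋃ i ∈ Finset.Icc i₀ n, ⋃ v ∈ S i, E i v) := by
    refine measure_mono_ae ?_
    filter_upwards [(hcr 0 (Nat.zero_le n)).ae_isKilledWalk (hpos 0) ha hDb] with X hX hlater
    change ¬ ∀ b ∈ _, _ at hlater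
    push Not at hlater
    obtain ⟨⟨v, T⟩, hb, hbig⟩ := hlater
    obtain ⟨l₁, l₂, hl, hjl, hT, hvT⟩ := exists_of_mem_drop_wilson X j ∅ ord _ hb
    simp only at hl hT hvT hbig
    have hvD : (v : ℂ) ∈ D := (hord.1 v).1 (by rw [hl]; simp)
    -- The levels up to `i₀` have fewer vertices than would precede such a `v`, since at least `j`
    -- vertices come before it.
    have hv0 : ∀ k ≤ i₀, v ∉ Γ.Q D k := by
      intro k hk hvk
      have := (hl ▸ hord).length_lt hA hk hvk
      omega
    obtain ⟨i, hii, hin, hvi, hvS⟩ : ∃ i, i₀ ≤ i ∧ i ≤ n ∧ (∀ k ≤ i, v ∉ Γ.Q D k) ∧ v ∈ S i := by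
      by_cases hvn : ∀ k ≤ n, v ∉ Γ.Q D k
      · exact ⟨n, hi₀, le_rfl, hvn, Finset.mem_filter.2 ⟨(hVD v).2 hvD, Or.inl rfl⟩⟩
      · push Not at hvn
        obtain ⟨k, hk, hvk⟩ := hvn
        have hik : i₀ < k := by
          by_contra hlt
          exact hv0 k (not_lt.1 hlt) hvk
        obtain ⟨i, rfl⟩ := Nat.exists_eq_succ_of_ne_zero (Nat.ne_zero_of_lt hik)
        refine ⟨i, by omega, by omega, fun k' hk' hvk' => ?_,
          Finset.mem_filter.2 ⟨(hVD v).2 hvD, Or.inr hvk⟩⟩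
        have := Q_level_unique hvk hvk'
        omega
    have hnet : Γ.IsNet D (Γ.sampled D X l₁.length ∅ l₁) (6⁻¹ ^ i) := by
      refine isNet_of_Q_subset hDb (exits_sampled hX _ (fun u hu => absurd hu (notMem_empty u)) l₁)
        (i := i) (fun k hk w hw => ?_) le_rfl
      refine take_subset_sampled hX _ ∅ l₁ w ?_
      rw [List.take_length]
      exact (hl ▸ hord).mem_prefix hw fun k' hk' => hvi k' (hk'.trans hk)
    refine mem_iUnion₂.2 ⟨i, Finset.mem_Icc.2 ⟨hii, hin⟩, mem_iUnion₂.2 ⟨v, hvS, l₁, l₂, hl, hnet, ?_⟩⟩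
    by_contra hesc
    refine absurd hbig (not_lt.2 ?_)
    have h1 : ∀ m, Γ.Alive D T (X v) m → dist (X v m : ℂ) v < 14 * 6⁻¹ ^ i * (K * i : ℕ) := by
      intro m hm
      by_contra hge
      exact hesc ⟨m, hT ▸ hm, not_lt.1 hge⟩
    -- Twice the radius `14 * 6⁻ⁱ * (K * i) + 7 * 6⁻ⁱ`, the last term being for the edges.
    refine (ediam_le_of_subset_ball (trace_subset (hpos i) ha (hcr i hin) (hX v).2.1 h1)).trans ?_
    rw [← ENNReal.ofReal_ofNat 2, ← ENNReal.ofReal_mul (by norm_num)]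
    refine ENNReal.ofReal_le_ofReal ?_
    linarith [hε i hii]
  calc _ ≤ ∑ i ∈ Finset.Icc i₀ n, ∑ v ∈ S i, Γ.wilsonLaw (E i v) := by
        refine hsub.trans ((measure_biUnion_finset_le _ _).trans (Finset.sum_le_sum fun i _ => ?_))
        exact measure_biUnion_finset_le _ _
    _ ≤ ∑ i ∈ Finset.Icc i₀ n, (B : ℝ≥0∞) * 2⁻¹ ^ i := by
        refine Finset.sum_le_sum fun i hi => ?_
        refine (Finset.sum_le_card_nsmul _ _ ((1 - a ^ 13) ^ (K * i)) fun v hv => ?_).trans ?_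
        · exact (hcr i (Finset.mem_Icc.1 hi).2).wilsonLaw_escapes_le (hpos i) ha hD hord.nodup
            ((hVD v).1 (Finset.mem_filter.1 hv).1) _
        · rw [nsmul_eq_mul]
          calc ((S i).card : ℝ≥0∞) * (1 - a ^ 13) ^ (K * i)
              ≤ (B * 36 ^ i) * (1 - a ^ 13) ^ (K * i) :=
                mul_le_mul' (by exact_mod_cast hcard i) le_rfl
            _ ≤ B * 2⁻¹ ^ i := by
                rw [mul_assoc]; exact mul_le_mul' le_rfl (pow_mul_pow_le_half_pow hK i)
    _ ≤ B * (2 * 2⁻¹ ^ i₀) := by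
        rw [← Finset.mul_sum]
        exact mul_le_mul' le_rfl (sum_Icc_half_pow_le i₀ n)

/-! ### The loops that avoid the first branches are small -/

theorem DiscreteLoop.exists_mem (c : Γ.DiscreteLoop D) : ∃ u ∈ c.1, (u : ℂ) ∈ D := by
  refine ⟨c.word.head c.word_ne_nil, ?_, ?_⟩
  · rw [← c.coe_word, Cycle.mem_coe_iff]
    exact List.head_mem _
  · have h1 := c.isChain_word
    cases ht : c.word.tail with
    | nil =>
      rw [ht] at h1
      simp only [List.cons_append, List.nil_append, List.isChain_cons_cons] at h1
      exact h1.1.left_mem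
    | cons u l =>
      rw [ht] at h1
      simp only [List.cons_append, List.isChain_cons_cons] at h1
      exact h1.1.left_mem

/-- A large loop that visits a cell crosses an annulus around its centre; sum the annulus estimate
over the `4 * A ^ 2 * 36 ^ i` cells. -/
theorem countLaw_exists_large_le {a : ℝ≥0∞} (ha : a ≠ 0) {i : ℕ}
    (hcr : Γ.Crosses (2 * 6⁻¹ ^ i) a) (hD : ∀ s ∉ D, HasLog D s) {A : ℕ}
    (hA : D ⊆ Metric.ball 0 A) {T : Set Γ.verts} (hT : Γ.IsNet D T (2 * 6⁻¹ ^ i)) {K : ℕ}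
    (hK : 36 * (1 - a ^ 13) ^ K ≤ 2⁻¹) (hm : 2 * (1 - a ^ 13) ^ (K * i) ≤ 1) {ε : ℝ}
    (hε : 28 * (K * i : ℕ) * 6⁻¹ ^ i + 30 * 6⁻¹ ^ i ≤ ε) :
    Γ.countLaw D {N | ∃ c ∈ {c : Γ.DiscreteLoop D | (∀ u ∈ c.1, u ∉ T) ∧
        ¬ c.toLoop.diam / 2 ≤ ENNReal.ofReal ε}, N c ≠ 0} ≤
      8 * A ^ 2 * (a ^ 13)⁻¹ * 2⁻¹ ^ i := by
  -- Twice the side, so that the ball of radius `ρ / 2` covers the cell.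
  set ρ : ℝ := 2 * 6⁻¹ ^ i with hρdef
  have h6 : (0 : ℝ) < 6⁻¹ ^ i := by positivity
  have hρ : 0 < ρ := by positivity
  set m := K * i with hmdef
  -- Large enough both for the Harnack inequality (`8 ρ`) and for `m` escapes (`14 ρ m + ρ / 2`);
  -- with `7 ρ` more for the edges it gives the bound in `hε`.
  set r : ℝ := 14 * ρ * m + 8 * ρ with hr
  have hm0 : (0 : ℝ) ≤ 14 * ρ * m := by positivity
  set S : ℤ × ℤ → Set (Γ.DiscreteLoop D) := fun c₀ => {c | (∀ u ∈ c.1, u ∉ T) ∧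
    (∃ u ∈ c.1, (u : ℂ) ∈ Metric.closedBall (cellCenter i c₀) (ρ / 2)) ∧
    ∃ u ∈ c.1, (u : ℂ) ∉ Metric.ball (cellCenter i c₀) r} with hS
  have hsub : {N : Γ.DiscreteLoop D → ℕ | ∃ c ∈ {c : Γ.DiscreteLoop D | (∀ u ∈ c.1, u ∉ T) ∧
      ¬ c.toLoop.diam / 2 ≤ ENNReal.ofReal ε}, N c ≠ 0} ⊆
      ⋃ c₀ ∈ cells A i, {N | ∃ c ∈ S c₀, N c ≠ 0} := by
    rintro N ⟨c, ⟨hcT, hc⟩, hN⟩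
    obtain ⟨u, hu, huD⟩ := c.exists_mem
    refine mem_iUnion₂.2 ⟨cell i (u : ℂ), cell_mem_cells i (hA huD), c, ⟨hcT, ⟨u, hu, ?_⟩, ?_⟩, hN⟩
    · rw [Metric.mem_closedBall, hρdef]
      linarith [dist_cellCenter_lt i (u : ℂ)]
    · by_contra hin
      push Not at hin
      refine hc ((diam_toLoop_le hρ ha hcr c hin).trans (ENNReal.ofReal_le_ofReal ?_))
      rw [hr, hρdef]
      linarith
  calc _ ≤ ∑ c₀ ∈ cells A i, Γ.countLaw D {N | ∃ c ∈ S c₀, N c ≠ 0} :=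
        (measure_mono hsub).trans (measure_biUnion_finset_le _ _)
    _ ≤ ∑ c₀ ∈ cells A i, 2 * (1 - a ^ 13) ^ m * (a ^ 13)⁻¹ :=
        Finset.sum_le_sum fun c₀ _ => (countLaw_exists_le _).trans
          (hcr.tsum_loopMass_le hρ ha hD hT hm (by linarith) (by linarith))
    _ = 8 * A ^ 2 * (a ^ 13)⁻¹ * (36 ^ i * (1 - a ^ 13) ^ m) := by
        rw [Finset.sum_const, nsmul_eq_mul, card_cells]
        push_cast
        ring
    _ ≤ _ := mul_le_mul' le_rfl (pow_mul_pow_le_half_pow hK i)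

theorem measurableSet_sampled_mem (D : Set ℂ) (j : ℕ) (l : List Γ.verts) (P : Set Γ.verts → Prop) :
    MeasurableSet {X : Γ.verts → ℕ → Γ.verts | P (Γ.sampled D X j ∅ l)} := by
  have : {X : Γ.verts → ℕ → Γ.verts | P (Γ.sampled D X j ∅ l)} =
      ⋃ A : {A : Finset Γ.verts // P A}, {X | Γ.sampled D X j ∅ l = A} := by
    ext X
    constructor
    · intro h
      have hf := finite_sampled (D := D) X j finite_empty l
      exact mem_iUnion.2 ⟨⟨hf.toFinset, by simpa using h⟩, by simp⟩
    · intro h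
      obtain ⟨A, hA⟩ := mem_iUnion.1 h
      change _ = _ at hA
      change P _
      rw [hA]; exact A.2
  rw [this]
  exact MeasurableSet.iUnion fun A => measurableSet_sampled D j ∅ l _

/-- The two soups are coupled by using the same loops, and they differ by the loops that avoid the
first `j` branches. These are independent of the soup, so the sampled set may be frozen and
`countLaw_exists_large_le` applied to it. -/
theorem levyProkhorovEDist_rwls_le {a : ℝ≥0∞} (ha : a ≠ 0) {i : ℕ}
    (hcr : Γ.Crosses (2 * 6⁻¹ ^ i) a) (hDn : D.Nonempty) (hDb : Bornology.IsBounded D)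
    (hD : ∀ s ∉ D, HasLog D s) {A : ℕ} (hA : D ⊆ Metric.ball 0 A) {ord : List Γ.verts}
    (hord : Γ.IsGoodOrdering D ord) {K : ℕ} (hK : 36 * (1 - a ^ 13) ^ K ≤ 2⁻¹)
    (hm : 2 * (1 - a ^ 13) ^ (K * i) ≤ 1) {ε : ℝ}
    (hε : 28 * (K * i : ℕ) * 6⁻¹ ^ i + 30 * 6⁻¹ ^ i ≤ ε)
    (hε' : 8 * A ^ 2 * (a ^ 13)⁻¹ * 2⁻¹ ^ i ≤ ENNReal.ofReal ε) {j : ℕ}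
    (hj : ∑ k ∈ Finset.range (i + 1), 4 * A ^ 2 * 36 ^ k ≤ j) :
    levyProkhorovEDist ((Γ.jointLaw D).map (Γ.rwls hDn))
      ((Γ.jointLaw D).map (Γ.rwlsAttached hDn ord j)) ≤ ENNReal.ofReal ε := by
  have h6 : (0 : ℝ) < 6⁻¹ ^ i := by positivity
  have hρ : (0 : ℝ) < 2 * 6⁻¹ ^ i := by positivity
  refine levyProkhorovEDist_map_le (measurable_rwls hDn) (measurable_rwlsAttached hDn ord j) ?_
  set P : Γ.DiscreteLoop D → Set Γ.verts → Prop := fun c T => (∀ u ∈ c.1, u ∉ T) ∧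
    ¬ c.toLoop.diam / 2 ≤ ENNReal.ofReal ε with hP
  set B : Set ((Γ.verts → ℕ → Γ.verts) × (Γ.DiscreteLoop D → ℕ)) :=
    {p | ∃ c, P c (Γ.sampled D p.1 j ∅ ord) ∧ p.2 c ≠ 0} with hB
  have hBm : MeasurableSet B := by
    have : B = ⋃ c, {X | P c (Γ.sampled D X j ∅ ord)} ×ˢ ((fun N => N c) ⁻¹' {0}ᶜ) := by
      ext p
      simp [hB]
    rw [this]
    exact MeasurableSet.iUnion fun c => (measurableSet_sampled_mem D j ord (P c)).prod
      ((MeasurableSet.of_discrete (s := ({0}ᶜ : Set ℕ))).preimage (measurable_pi_apply c))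
  have hfin : ∀ᵐ p ∂Γ.jointLaw D, p.2.support.Finite :=
    Measure.quasiMeasurePreserving_snd.ae (ae_finite_support (hcr.tsum_loopMass_ne_top hρ ha hDb))
  calc _ ≤ Γ.jointLaw D B := by
        refine measure_mono_ae ?_
        filter_upwards [hfin] with p hp hbig
        by_contra hpB
        refine hbig (edist_soup_attachedTo_le hDn hp _ fun c hc hcT => ?_)
        by_contra hdiam
        refine hpB ⟨c, ⟨?_, hdiam⟩, hc⟩
        rwa [← firstBranches_eq]
    _ = ∫⁻ X, Γ.countLaw D (Prod.mk X ⁻¹' B) ∂Γ.wilsonLaw := Measure.prod_apply hBm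
    _ ≤ ∫⁻ _, ENNReal.ofReal ε ∂Γ.wilsonLaw := by
        refine lintegral_mono_ae ?_
        filter_upwards [hcr.ae_isKilledWalk hρ ha hDb] with X hX
        have hnet : Γ.IsNet D (Γ.sampled D X j ∅ ord) (2 * 6⁻¹ ^ i) :=
          isNet_of_Q_subset hDb (exits_sampled hX _ (fun u hu => absurd hu (notMem_empty u)) ord)
            (i := i) (fun k hk w hw => take_subset_sampled hX _ ∅ ord w (hord.mem_take hA hk hj hw))
            (by linarith)
        exact (countLaw_exists_large_le ha hcr hD hA hnet hK hm hε).trans hε'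
    _ = ENNReal.ofReal ε := by simp

end PlaneGraph

end

/-! ### Choice of the constants and conclusion -/

theorem theorem4p1 (D : Set ℂ) (hDo : IsOpen D) (hDb : Bornology.IsBounded D)
    (hDs : IsSimplyConnected D) (C : ℕ) (δ₀ α₀ : ℝ) (hδ₀ : 0 < δ₀) (hα₀ : 0 < α₀)
    (ε : ℝ) (hε : 0 < ε) :
    ∃ j₀ : ℕ, ∀ Γ : ℝ → PlaneGraph,
      (∀ δ, 0 < δ → (Γ δ).BoundedDensity δ C) →
      (∀ δ, 0 < δ → δ < δ₀ → (Γ δ).UniformCrossing δ δ₀ α₀) →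
      ∀ δ, 0 < δ → δ < δ₀ / 6 ^ j₀ → ∀ ord, (Γ δ).IsGoodOrdering D ord →
        (Γ δ).wilsonLaw {X | ¬ (Γ δ).LaterWalksSmall D ord X j₀ ε} ≤ ENNReal.ofReal ε ∧
        ∀ j, j₀ < j →
          AEMeasurable ((Γ δ).rwls hDs.nonempty) ((Γ δ).jointLaw D) ∧
          AEMeasurable ((Γ δ).rwlsAttached hDs.nonempty ord j) ((Γ δ).jointLaw D) ∧
          levyProkhorovEDist (((Γ δ).jointLaw D).map ((Γ δ).rwls hDs.nonempty))
            (((Γ δ).jointLaw D).map ((Γ δ).rwlsAttached hDs.nonempty ord j)) ≤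
              ENNReal.ofReal ε := by
  have hD : ∀ s ∉ D, HasLog D s := fun s hs => hDs.hasLog hDo hs
  set a : ℝ≥0∞ := ENNReal.ofReal α₀ with hadef
  have ha : a ≠ 0 := (ENNReal.ofReal_pos.2 hα₀).ne'
  have ha13 : a ^ 13 ≠ 0 := pow_ne_zero _ ha
  have hq : 1 - a ^ 13 < 1 := ENNReal.sub_lt_self ENNReal.one_ne_top one_ne_zero ha13
  -- `72 = 36 * 2`: multiplying by the growth factor 36 of the number of cells leaves `1 / 2`.
  obtain ⟨K, hK72⟩ := ((ENNReal.tendsto_pow_atTop_nhds_zero_of_lt_one hq).eventually_le_const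
    (ENNReal.inv_pos.2 (by simp) : (0 : ℝ≥0∞) < 72⁻¹)).exists
  have hK : 36 * (1 - a ^ 13) ^ K ≤ 2⁻¹ := by
    refine (mul_le_mul' le_rfl hK72).trans (le_of_eq ?_)
    have : (72 : ℝ≥0∞) = 36 * 2 := by norm_num
    rw [this, ENNReal.mul_inv (by simp) (by simp), ← mul_assoc,
      ENNReal.mul_inv_cancel (by simp) (by simp), one_mul]
  obtain ⟨A, hA⟩ : ∃ A : ℕ, D ⊆ Metric.ball 0 A := by
    obtain ⟨R, hR⟩ := hDb.subset_ball (0 : ℂ)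
    obtain ⟨A, hA⟩ := exists_nat_ge R
    exact ⟨A, hR.trans (Metric.ball_subset_ball hA)⟩
  -- Converts the scale `δ / δ₀` of the crossings into the scale `δ` of the density.
  obtain ⟨k₀, hk₀⟩ := exists_pow_lt_of_lt_one hδ₀ (by norm_num : (6⁻¹ : ℝ) < 1)
  set B : ℕ := 4 * A ^ 2 * 36 + 4 * A ^ 2 * 36 ^ (1 + k₀) * C with hBdef
  obtain ⟨i₁, hi₁⟩ : ∃ i₁ : ℕ, ∀ i, i₁ ≤ i → 28 * (K * i : ℕ) * 6⁻¹ ^ i + 30 * 6⁻¹ ^ i ≤ ε := by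
    have h1 := tendsto_self_mul_const_pow_of_lt_one (r := (6⁻¹ : ℝ)) (by norm_num) (by norm_num)
    have h2 := tendsto_pow_atTop_nhds_zero_of_lt_one (r := (6⁻¹ : ℝ)) (by norm_num) (by norm_num)
    have h3 := (h1.const_mul (28 * K : ℝ)).add (h2.const_mul (30 : ℝ))
    rw [mul_zero, mul_zero, add_zero] at h3
    obtain ⟨i₁, h4⟩ := Filter.eventually_atTop.1 (h3.eventually_le_const hε)
    refine ⟨i₁, fun i hi => le_trans (le_of_eq ?_) (h4 i hi)⟩
    push_cast
    ring
  -- The first summand is for the walks, the second for the loops.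
  obtain ⟨i₂, hi₂⟩ : ∃ i₂ : ℕ, ∀ i, i₂ ≤ i →
      (B * 2 + 8 * A ^ 2 * (a ^ 13)⁻¹) * 2⁻¹ ^ i ≤ ENNReal.ofReal ε := by
    have h1 := ENNReal.tendsto_pow_atTop_nhds_zero_of_lt_one
      (ENNReal.inv_lt_one.2 ENNReal.one_lt_two)
    have hne : (B * 2 + 8 * A ^ 2 * (a ^ 13)⁻¹ : ℝ≥0∞) ≠ ∞ := by
      have := ENNReal.inv_ne_top.2 ha13
      finiteness
    have h2 := ENNReal.Tendsto.const_mul h1 (Or.inr hne)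
    rw [mul_zero] at h2
    exact Filter.eventually_atTop.1 (h2.eventually_le_const (ENNReal.ofReal_pos.2 hε))
  -- At least 1, so that `2 * (1 - a ^ 13) ^ (K * i₀) ≤ 1`.
  set i₀ := max (max i₁ i₂) 1 with hi₀
  have hi₀1 : i₁ ≤ i₀ := (le_max_left _ _).trans (le_max_left _ _)
  have hi₀2 : i₂ ≤ i₀ := (le_max_right _ _).trans (le_max_left _ _)
  have hi₀3 : i₀ ≠ 0 := Nat.one_le_iff_ne_zero.1 (le_max_right _ _)
  have hm : 2 * (1 - a ^ 13) ^ (K * i₀) ≤ 1 := by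
    have h1 : (1 - a ^ 13) ^ (K * i₀) ≤ 2⁻¹ := by
      rw [pow_mul]
      calc ((1 - a ^ 13) ^ K) ^ i₀ ≤ (72⁻¹) ^ i₀ := pow_le_pow_left₀ zero_le hK72 _
        _ ≤ 72⁻¹ := pow_le_of_le_one zero_le (ENNReal.inv_le_one.2 (by norm_num)) hi₀3
        _ ≤ 2⁻¹ := ENNReal.inv_le_inv.2 (by norm_num)
    exact (mul_le_mul' le_rfl h1).trans (ENNReal.mul_inv_cancel (by simp) (by simp)).le
  -- The sum exhausts the levels up to `i₀`; the added `i₀` makes the hypothesis on `δ` imply `δ /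
  -- δ₀ < 6⁻¹ ^ i₀`.
  refine ⟨∑ k ∈ Finset.range (i₀ + 1), 4 * A ^ 2 * 36 ^ k + i₀, ?_⟩
  set j₀ := ∑ k ∈ Finset.range (i₀ + 1), 4 * A ^ 2 * 36 ^ k + i₀ with hj₀
  intro Γ hdens hcross δ hδ hδj ord hord
  have h6j : (1 : ℝ) ≤ 6 ^ j₀ := one_le_pow₀ (by norm_num)
  have hδδ₀ : δ < δ₀ := hδj.trans_le (div_le_self hδ₀.le h6j)
  have hU := hcross δ hδ hδδ₀
  have hx : 0 < δ / δ₀ := div_pos hδ hδ₀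
  have hxi : δ / δ₀ < 6⁻¹ ^ i₀ := by
    have h1 : δ / δ₀ < 6⁻¹ ^ j₀ := by
      rw [div_lt_iff₀ hδ₀, inv_pow, ← div_eq_inv_mul]
      exact hδj
    exact h1.trans_le (pow_le_pow_of_le_one (by norm_num) (by norm_num) (Nat.le_add_left _ _))
  -- The finest scale `6⁻ⁿ` at which crossings are guaranteed.
  obtain ⟨n, hn1, hn2⟩ := exists_nat_pow_near_of_lt_one hx
    ((div_le_one hδ₀).2 hδδ₀.le) (by norm_num : (0 : ℝ) < 6⁻¹) (by norm_num)
  have hi₀n : i₀ ≤ n := by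
    have := (pow_lt_pow_iff_right_of_lt_one₀ (by norm_num : (0 : ℝ) < 6⁻¹) (by norm_num)).1
      (hn1.trans hxi)
    omega
  have hcr : ∀ ρ, δ / δ₀ ≤ ρ → (Γ δ).Crosses ρ a := fun ρ hρ => hU.crosses hδ hδ₀ hρ
  -- Cells of side `6⁻¹ ^ (n + 1 + k₀) ≤ δ` contain at most `C` vertices each; the constant excess
  -- in their number is part of `B`.
  have hV : ∀ F : Finset (Γ δ).verts, (∀ v ∈ F, (v : ℂ) ∈ D) → F.card ≤ B * 36 ^ n := by
    intro F hF
    refine ((hdens δ hδ).card_le (i := n + 1 + k₀) hA ?_ F hF).trans ?_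
    · rw [pow_add]
      calc (6⁻¹ : ℝ) ^ (n + 1) * 6⁻¹ ^ k₀ ≤ δ / δ₀ * δ₀ :=
            mul_le_mul hn1.le hk₀.le (by positivity) hx.le
        _ = δ := div_mul_cancel₀ _ hδ₀.ne'
    · rw [hBdef, add_assoc n, pow_add 36 n]
      calc 4 * A ^ 2 * (36 ^ n * 36 ^ (1 + k₀)) * C = (4 * A ^ 2 * 36 ^ (1 + k₀) * C) * 36 ^ n := by
            ring
        _ ≤ _ := Nat.mul_le_mul_right _ (Nat.le_add_left _ _)
  refine ⟨?_, fun j hj => ⟨(PlaneGraph.measurable_rwls _).aemeasurable,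
    (PlaneGraph.measurable_rwlsAttached _ ord j).aemeasurable, ?_⟩⟩
  · refine (PlaneGraph.wilsonLaw_not_laterWalksSmall_le ha (n := n) (fun i hi => hcr _ (hn2.trans
      (pow_le_pow_of_le_one (by norm_num) (by norm_num) hi))) hDb hD hA hord hi₀n hK
      (fun i hi => ?_) (Nat.le_add_right _ _) hV (Nat.le_add_right _ _)).trans ?_
    · have h6 : (0 : ℝ) < 6⁻¹ ^ i := by positivity
      linarith [hi₁ i (hi₀1.trans hi)]
    · refine le_trans ?_ (hi₂ i₀ hi₀2)
      rw [← mul_assoc, add_mul]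
      exact le_self_add
  · refine PlaneGraph.levyProkhorovEDist_rwls_le ha (i := i₀) (hcr _ ?_) _ hDb hD hA hord hK hm
      (hi₁ i₀ hi₀1) (le_trans ?_ (hi₂ i₀ hi₀2)) (by omega)
    · have h6 : (0 : ℝ) < 6⁻¹ ^ i₀ := by positivity
      linarith
    · rw [add_mul]
      exact le_add_self
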